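/- \textbf{Setting.} A verifier circuit consists of $n$ witness qubits, $m$ ancilla qubits initialized to $|0\rangle$, one designated output qubit, and a sequence of gates from the set NOT, Hadamard, CNOT, Toffoli, and the phase gates $\mathrm{diag}(1,e^{\pm 2\pi i/2^k})$, $k\ge 0$. It accepts a state $|\psi\rangle$ of the witness qubits with the probability that measuring the output qubit after running it on $|\psi\rangle|0\rangle^{\otimes m}$ gives $1$; its highest acceptance probability over all $|\psi\rangle$ is $p_{max}$, and $\varphi_{\min}=\frac1\pi\arccos\sqrt{p_{max}}$. A family $(V_x)_x$ of circuits, one for each bit string $x$, is uniform if a description of $V_x$ (all numbers in it written in unary) is computable from $x$ in time polynomial in $|x|$; so its numbers $n_x$ of witness qubits and $m_x$ of ancillae are polynomially bounded in $|x|$. A promise problem $L=(L_{yes},L_{no})$ is in QMA with verifier $V$ and promise bounds $a,b$ if $V$ is a uniform family, $a,b$ are polynomial-time computable rational-valued functions of $|x|$ with $0\le b$, $a\le 1$ and $a-b\ge 1/\mathrm{poly}(|x|)$, some witness state is accepted by $V_x$ with probability at least $a(|x|)$ if $x\in L_{yes}$, and every witness state is accepted by $V_x$ with probability at most $b(|x|)$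 if $x\in L_{no}$. The class $\mathsf{QMA}_1$ consists of the promise problems that have such a verifier with $a=1$ exactly. \textbf{Theorem} ($\mathsf{QMA}(a^*,b)=\mathsf{QMA}_1$). (1) Let $L$ be in QMA with verifier $V$ and promise bounds $a,b$, and let $t$ be a polynomial-time computable function of $|x|$ with $t(|x|)=\mathrm{polylog}(|x|)$ such that for every $x\in L_{yes}$ the phase $\varphi_{\min}$ of $V_x$ can be expressed exactly by $t$ bits, that is, $\varphi_{\min}(V_x)=k/2^{t(|x|)}$ for some integer $0\le k<2^{t(|x|)}$. Then for every polynomial $r$ there is a uniform family of verifier circuits $V^*$ such that $V^*_x$ acts on $n_x+t(|x|)$ witness qubits and $\mathrm{poly}(|x|)$ ancillae, accepts some witness state with probability exactly $1$ if $x\in L_{yes}$, and accepts every witness state with probability at most $e^{-r(|x|)}$ if $x\in L_{no}$. (2) Consequently, the subclass of QMA consisting of the promise problems that have a verifier $V$ (with some promise bounds $a,b$) for which $\varphi_{\min}(V_x)$, for all $x\in L_{yes}$, can be expressed exactly by $t(|x|)=\mathrm{polylog}(|x|)$ bits is equal to $\mathsf{QMA}_1$. -/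

import Mathlib

noncomputable section

namespace QMA

/-! ### Polynomial-time computation: structured programs over finitely many stacks of bits -/

/-- Programs of a multi-stack machine.  Registers are stacks of bits; a program mentions only
finitely many of them.  (This is a multi-tape Turing machine with structured control.) -/
inductive Cmd : Type
  | skip : Cmd
  | push (r : ℕ) (b : Bool) : Cmd
  | pop (r : ℕ) : Cmd
  | seq (c d : Cmd) : Cmd
  /-- Branch on register `r`: empty, top bit `false`, top bit `true`. -/
  | branch (r : ℕ) (cEmpty cFalse cTrue : Cmd) : Cmd
  /-- While register `r` is nonempty, execute `c`. -/
  | loop (r : ℕ) (c : Cmd) : Cmd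

/-- The contents of all registers; the head of a list is the top of the stack. -/
abbrev Store : Type := ℕ → List Bool

/-- `Runs c s s' T`: program `c`, started in store `s`, halts in store `s'` after exactly
`T` elementary steps (pushes, pops, tests and no-ops). -/
inductive Runs : Cmd → Store → Store → ℕ → Prop
  | skip (s : Store) : Runs Cmd.skip s s 1
  | push (r : ℕ) (b : Bool) (s : Store) :
      Runs (Cmd.push r b) s (Function.update s r (b :: s r)) 1
  | pop (r : ℕ) (s : Store) :
      Runs (Cmd.pop r) s (Function.update s r (s r).tail) 1
  | seq {c d : Cmd} {s s₁ s₂ : Store} {T₁ T₂ : ℕ}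
      (h₁ : Runs c s s₁ T₁) (h₂ : Runs d s₁ s₂ T₂) :
      Runs (Cmd.seq c d) s s₂ (T₁ + T₂)
  | branch_empty {r : ℕ} {c₀ c₁ c₂ : Cmd} {s s₁ : Store} {T : ℕ}
      (hr : s r = []) (h : Runs c₀ s s₁ T) :
      Runs (Cmd.branch r c₀ c₁ c₂) s s₁ (T + 1)
  | branch_false {r : ℕ} {c₀ c₁ c₂ : Cmd} {s s₁ : Store} {T : ℕ}
      (hr : (s r).head? = some false) (h : Runs c₁ s s₁ T) :
      Runs (Cmd.branch r c₀ c₁ c₂) s s₁ (T + 1)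
  | branch_true {r : ℕ} {c₀ c₁ c₂ : Cmd} {s s₁ : Store} {T : ℕ}
      (hr : (s r).head? = some true) (h : Runs c₂ s s₁ T) :
      Runs (Cmd.branch r c₀ c₁ c₂) s s₁ (T + 1)
  | loop_done {r : ℕ} {c : Cmd} {s : Store} (hr : s r = []) :
      Runs (Cmd.loop r c) s s 1
  | loop_step {r : ℕ} {c : Cmd} {s s₁ s₂ : Store} {T₁ T₂ : ℕ} (hr : s r ≠ [])
      (h₁ : Runs c s s₁ T₁) (h₂ : Runs (Cmd.loop r c) s₁ s₂ T₂) :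
      Runs (Cmd.loop r c) s s₂ (T₁ + T₂ + 1)

/-- The store holding the input `x` in register `0` and nothing elsewhere. -/
def inputStore (x : List Bool) : Store := fun r => if r = 0 then x else []

/-- `f` is computable in time polynomial in the length of its input
(input and output in register `0`). -/
def PolyTime (f : List Bool → List Bool) : Prop :=
  ∃ (c : Cmd) (p : Polynomial ℕ), ∀ x : List Bool,
    ∃ (s : Store) (T : ℕ), Runs c (inputStore x) s T ∧ T ≤ p.eval x.length ∧ s 0 = f x

/-! ### Quantum circuits -/

/-- Elementary gates on `N` qubits: NOT, Hadamard, the phase gates `diag(1, e^{2πi/2^k})` for all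
`k` together with their inverses, CNOT and Toffoli. -/
inductive Gate (N : ℕ) : Type
  | not (i : Fin N) : Gate N
  | had (i : Fin N) : Gate N
  | phase (k : ℕ) (inverse : Bool) (i : Fin N) : Gate N
  | cnot (c i : Fin N) (hci : c ≠ i) : Gate N
  | toffoli (c d i : Fin N) (hcd : c ≠ d) (hci : c ≠ i) (hdi : d ≠ i) : Gate N

/-- Vectors of amplitudes in the computational basis of `N` qubits. -/
abbrev Amplitudes (N : ℕ) : Type := (Fin N → Bool) → ℂ

/-- The unitary action of a gate. -/
def Gate.apply {N : ℕ} : Gate N → Amplitudes N → Amplitudes N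
  | .not i, ψ => fun z => ψ (Function.update z i (!z i))
  | .had i, ψ => fun z =>
      ((1 / Real.sqrt 2 : ℝ) : ℂ) *
        (ψ (Function.update z i false) +
          (if z i then -1 else 1) * ψ (Function.update z i true))
  | .phase k inverse i, ψ => fun z =>
      (if z i then
        Complex.exp ((if inverse then -1 else 1) * (2 * Real.pi * Complex.I / 2 ^ k))
      else 1) * ψ z
  | .cnot c i _, ψ => fun z => ψ (Function.update z i (xor (z i) (z c)))
  | .toffoli c d i _ _ _, ψ => fun z => ψ (Function.update z i (xor (z i) (z c && z d)))

/-- A verifier circuit: `witness` qubits for the witness, followed by `ancilla` qubits prepared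
in `|0⟩`, an output qubit, and a list of gates (the head is applied first). -/
structure Circuit : Type where
  witness : ℕ
  ancilla : ℕ
  output : Fin (witness + ancilla)
  gates : List (Gate (witness + ancilla))

namespace Circuit

/-- The joint initial state `|ψ⟩|0⟩^{⊗ m}`. -/
def startState (V : Circuit) (ψ : Amplitudes V.witness) : Amplitudes (V.witness + V.ancilla) :=
  fun z => if ∀ j : Fin V.ancilla, z (Fin.natAdd V.witness j) = false then
    ψ (fun i => z (Fin.castAdd V.ancilla i)) else 0

/-- The state after all gates have been applied to `|ψ⟩|0⟩^{⊗ m}`. -/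
def finalState (V : Circuit) (ψ : Amplitudes V.witness) : Amplitudes (V.witness + V.ancilla) :=
  V.gates.foldl (fun φ g => g.apply φ) (V.startState ψ)

/-- The probability that measuring the output qubit of `V` on `|ψ⟩|0⟩^{⊗ m}` gives `1`. -/
def acceptProb (V : Circuit) (ψ : Amplitudes V.witness) : ℝ :=
  ∑ z : Fin (V.witness + V.ancilla) → Bool,
    if z V.output then ‖V.finalState ψ z‖ ^ 2 else 0

/-- Normalized witness states. -/
def IsState {N : ℕ} (ψ : Amplitudes N) : Prop := ∑ y, ‖ψ y‖ ^ 2 = 1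

/-- The highest acceptance probability over all witness states. -/
def maxAcceptProb (V : Circuit) : ℝ :=
  sSup {p : ℝ | ∃ ψ : Amplitudes V.witness, IsState ψ ∧ p = V.acceptProb ψ}

/-- The phase `φ_min = (1/π) arccos √p_max`. -/
def minPhase (V : Circuit) : ℝ := Real.arccos (Real.sqrt V.maxAcceptProb) / Real.pi

end Circuit

/-! ### Bit-string descriptions -/

/-- Self-delimiting unary code of a natural number. -/
def unary (k : ℕ) : List Bool := List.replicate k true ++ [false]

/-- Self-delimiting binary code of a natural number. -/
def binary (k : ℕ) : List Bool := k.bits.flatMap (fun b => [true, b]) ++ [false]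

/-- Binary code of a (nonnegative) rational number. -/
def encodeRat (q : ℚ) : List Bool := binary q.num.natAbs ++ binary q.den

/-- Bit-string description of a gate. -/
def Gate.encode {N : ℕ} : Gate N → List Bool
  | .not i => unary 0 ++ unary i
  | .had i => unary 1 ++ unary i
  | .phase k inverse i => unary 2 ++ unary k ++ [inverse] ++ unary i
  | .cnot c i _ => unary 3 ++ unary c ++ unary i
  | .toffoli c d i _ _ _ => unary 4 ++ unary c ++ unary d ++ unary i

/-- Bit-string description of a circuit. -/
def Circuit.encode (V : Circuit) : List Bool :=
  unary V.witness ++ unary V.ancilla ++ unary V.output ++ V.gates.flatMap Gate.encode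

/-- A family of circuits, one for each instance `x`, is (polynomial-time) uniform if the
description of the circuit for `x` is computable from `x` in polynomial time.  In particular its
numbers of witness qubits, ancillae and gates are polynomially bounded in `|x|`. -/
def Uniform (V : List Bool → Circuit) : Prop := PolyTime fun x => (V x).encode

/-! ### The classes -/

/-- A promise problem `L = L_yes ∪ L_no`. -/
structure PromiseProblem : Type where
  yes : Set (List Bool)
  no : Set (List Bool)
  disj : Disjoint yes no

/-- `V` is a QMA verifier for `L` with promise bounds `a`, `b` (functions of the input length,
computable in polynomial time and separated by an inverse polynomial). -/
structure IsVerifier (L : PromiseProblem) (V : List Bool → Circuit) (a b : ℕ → ℚ) : Prop where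
  uniform : Uniform V
  computable_a : PolyTime fun x => encodeRat (a x.length)
  computable_b : PolyTime fun x => encodeRat (b x.length)
  b_nonneg : ∀ l, 0 ≤ b l
  a_le_one : ∀ l, a l ≤ 1
  gap : ∃ q : Polynomial ℕ, ∀ l, 0 < q.eval l ∧ 1 / ((q.eval l : ℕ) : ℚ) ≤ a l - b l
  complete : ∀ x ∈ L.yes, ∃ ψ : Amplitudes (V x).witness,
    Circuit.IsState ψ ∧ (a x.length : ℝ) ≤ (V x).acceptProb ψ
  sound : ∀ x ∈ L.no, ∀ ψ : Amplitudes (V x).witness,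
    Circuit.IsState ψ → (V x).acceptProb ψ ≤ (b x.length : ℝ)

/-- `QMA₁`: the problems with a QMA verifier for which `a = 1` exactly. -/
def QMA₁ : Set PromiseProblem :=
  {L | ∃ (V : List Bool → Circuit) (b : ℕ → ℚ), IsVerifier L V (fun _ => 1) b}

/-- `t = polylog`. -/
def IsPolylog (t : ℕ → ℕ) : Prop := ∃ c : ℕ, ∀ l, t l ≤ c * Nat.log 2 l ^ c + c

/-- In every yes-instance `x` the phase `φ_min` of `V x` is a `t(|x|)`-bit binary fraction. -/
def HasExactPhase (L : PromiseProblem) (V : List Bool → Circuit) (t : ℕ → ℕ) : Prop :=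
  ∀ x ∈ L.yes, ∃ k : ℕ, k < 2 ^ t x.length ∧ (V x).minPhase = (k : ℝ) / 2 ^ t x.length

/-- The subclass of QMA of the problems with a verifier whose phase `φ_min` in the yes case is
exactly expressible by polylogarithmically many bits. -/
def QMAExactPhase : Set PromiseProblem :=
  {L | ∃ (V : List Bool → Circuit) (a b : ℕ → ℚ) (t : ℕ → ℕ),
    IsVerifier L V a b ∧ IsPolylog t ∧ HasExactPhase L V t}

end QMA

end

/-!
# Perfect completeness for verifiers whose phase is exactly expressible

Let `V` be a circuit with `n` witness qubits and `m` ancillae and let `t` be a number of digits.  The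
witness of the amplified circuit consists of the digits of a number `k < 2 ^ t` and a witness of `V`.
The circuit compares the acceptance probability of `V` with `cos² (π k / 2 ^ t)`.

*The test.*  After a run of `V` a coin is tossed.  With one outcome the output qubit of `V` is taken
as the result, with the other one a qubit that is `1` with probability `sin² (π k / 2 ^ t)`; the
latter is prepared exactly by phase gates controlled by the digits of `k`.  If `V` accepts with
probability `p`, then the test succeeds with probability `1 / 2 + (p - cos² (π k / 2 ^ t)) / 2`
(`norm_proj_test`).

*The reflections.*  Let `R₁` be the reflection that changes the sign of the states with all ancillae
zero, `R₂` the reflection that changes the sign of the states for which the test succeeds, and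
`C = R₁ R₂ + R₂ R₁`.  The operator `C` maps the states with ancillae zero to themselves, does not
change `k`, and `⟨v, C v⟩` is the mean of `2 (p - cos² (π k / 2 ^ t))` (`Params.re_inner_cosOp`).  In
a round, a control qubit interferes the states `v` and `(R₁ R₂)² v`; the result `1` corresponds to
the operator `(1 - (R₁ R₂)²) / 2` (`proj_opL_round`).  The amplified circuit makes `N` rounds and
accepts if all of them give `1` and `k` is at most a threshold `κ`.

*Completeness.*  If `k / 2 ^ t` is the phase of `V`, then `cos² (π k / 2 ^ t)` is the maximum of `p`.
Hence the form `⟨v, C v⟩` is nonpositive on the states with this `k`, and it vanishes at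
`v = |k⟩|ψ⟩` for an optimal witness `ψ`.  Therefore `C v = 0`, which means `(R₁ R₂)² v = -v`, so that
all rounds give `1` with certainty (`passOp_eq_self`, `Params.exists_norm_proj_circuit_eq`).

*Soundness.*  The threshold `κ` belongs to the bound `a`: it is at least `k` if `k / 2 ^ t` is the
phase of a circuit with acceptance probability at least `a`, and `cos² (π k / 2 ^ t)` exceeds `b` by
at least `g = 1 / (2 q)` for all `k ≤ κ`, if `a - b ≥ 1 / q`.  In a no-instance, `C` is then at most
`-2 g` on the states with `k ≤ κ` and ancillae zero, and since `((1 - (R₁ R₂)²) / 2)² = -(R₁ R₂)² (1 - C² / 4)` the norm squared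
contracts by the factor `1 - g²` in each pair of rounds (`norm_passOp_iterate_le`).  Hence
`8 q² r` rounds bring the acceptance probability below `e ^ (-r)`.

*Uniformity.*  The class `PolyFun` of polynomial-time functions between types that are encoded by bit
strings contains the elementary functions on lists and unary numbers, and it is closed under
composition, pairing, case distinctions and recursions over lists whose intermediate results stay
polynomially small.  This suffices to parse the description of `V`, to compute `κ` by doubling the
angle repeatedly (`angleStep`, on binary numbers), and to write the description of the amplified
circuit.

*The two classes.*  A verifier with `a = 1` has the phase zero in the yes-instances.  Conversely, a
polylogarithmic number of digits can be replaced by a larger one that is a polynomial of the length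
and hence easy to compute, and the amplified verifier has `a = 1`.
-/

set_option linter.unusedSectionVars false

namespace QMA

/-! ### Programs: frame properties, renaming of registers, elementary macros -/

/-- `c`, started in `s`, halts in `s'` within `B` steps. -/
def Halts (c : Cmd) (s s' : Store) (B : ℕ) : Prop := ∃ T ≤ B, Runs c s s' T

namespace Halts

theorem mono {c : Cmd} {s s' : Store} {B B' : ℕ} (h : Halts c s s' B) (hB : B ≤ B') :
    Halts c s s' B' := by
  obtain ⟨T, hT, hr⟩ := h
  exact ⟨T, hT.trans hB, hr⟩

theorem cast {c : Cmd} {s s₁ s' : Store} {B B' : ℕ} (h : Halts c s s₁ B) (hB : B ≤ B')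
    (hs : s₁ = s') : Halts c s s' B' := hs ▸ h.mono hB

theorem skip (s : Store) : Halts Cmd.skip s s 1 := ⟨1, le_rfl, Runs.skip s⟩

theorem push (r : ℕ) (b : Bool) (s : Store) :
    Halts (Cmd.push r b) s (Function.update s r (b :: s r)) 1 := ⟨1, le_rfl, Runs.push r b s⟩

theorem pop (r : ℕ) (s : Store) :
    Halts (Cmd.pop r) s (Function.update s r (s r).tail) 1 := ⟨1, le_rfl, Runs.pop r s⟩

theorem seq {c d : Cmd} {s s₁ s₂ : Store} {B₁ B₂ : ℕ} (h₁ : Halts c s s₁ B₁)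
    (h₂ : Halts d s₁ s₂ B₂) : Halts (Cmd.seq c d) s s₂ (B₁ + B₂) := by
  obtain ⟨T₁, hT₁, hr₁⟩ := h₁
  obtain ⟨T₂, hT₂, hr₂⟩ := h₂
  exact ⟨_, by omega, Runs.seq hr₁ hr₂⟩

theorem branch_empty {r : ℕ} {c₀ c₁ c₂ : Cmd} {s s₁ : Store} {B : ℕ} (hr : s r = [])
    (h : Halts c₀ s s₁ B) : Halts (Cmd.branch r c₀ c₁ c₂) s s₁ (B + 1) := by
  obtain ⟨T, hT, h⟩ := h
  exact ⟨_, by omega, Runs.branch_empty hr h⟩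

theorem branch_false {r : ℕ} {c₀ c₁ c₂ : Cmd} {s s₁ : Store} {B : ℕ} {l : List Bool}
    (hr : s r = false :: l) (h : Halts c₁ s s₁ B) :
    Halts (Cmd.branch r c₀ c₁ c₂) s s₁ (B + 1) := by
  obtain ⟨T, hT, h⟩ := h
  exact ⟨_, by omega, Runs.branch_false (by simp [hr]) h⟩

theorem branch_true {r : ℕ} {c₀ c₁ c₂ : Cmd} {s s₁ : Store} {B : ℕ} {l : List Bool}
    (hr : s r = true :: l) (h : Halts c₂ s s₁ B) :
    Halts (Cmd.branch r c₀ c₁ c₂) s s₁ (B + 1) := by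
  obtain ⟨T, hT, h⟩ := h
  exact ⟨_, by omega, Runs.branch_true (by simp [hr]) h⟩

theorem loop_done {r : ℕ} {c : Cmd} {s : Store} (hr : s r = []) : Halts (Cmd.loop r c) s s 1 :=
  ⟨1, le_rfl, Runs.loop_done hr⟩

theorem loop_step {r : ℕ} {c : Cmd} {s s₁ s₂ : Store} {B₁ B₂ : ℕ} (hr : s r ≠ [])
    (h₁ : Halts c s s₁ B₁) (h₂ : Halts (Cmd.loop r c) s₁ s₂ B₂) :
    Halts (Cmd.loop r c) s s₂ (B₁ + B₂ + 1) := by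
  obtain ⟨T₁, hT₁, hr₁⟩ := h₁
  obtain ⟨T₂, hT₂, hr₂⟩ := h₂
  exact ⟨_, by omega, Runs.loop_step hr hr₁ hr₂⟩

end Halts

/-- A strict upper bound for the registers that a program mentions. -/
def Cmd.bound : Cmd → ℕ
  | .skip => 0
  | .push r _ => r + 1
  | .pop r => r + 1
  | .seq c d => max c.bound d.bound
  | .branch r c d e => max (r + 1) (max c.bound (max d.bound e.bound))
  | .loop r c => max (r + 1) c.bound

theorem Runs.frame {c : Cmd} {s s' : Store} {T : ℕ} (h : Runs c s s' T) :
    ∀ r, c.bound ≤ r → s' r = s r := by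
  induction h with
  | skip s => intros; rfl
  | push r b s =>
    intro q hq
    exact Function.update_of_ne (by simp only [Cmd.bound] at hq; omega) _ _
  | pop r s =>
    intro q hq
    exact Function.update_of_ne (by simp only [Cmd.bound] at hq; omega) _ _
  | seq _ _ ih₁ ih₂ =>
    intro q hq
    simp only [Cmd.bound, max_le_iff] at hq
    rw [ih₂ q hq.2, ih₁ q hq.1]
  | branch_empty _ _ ih | branch_false _ _ ih | branch_true _ _ ih =>
    intro q hq
    simp only [Cmd.bound, max_le_iff] at hq
    exact ih q (by tauto)
  | loop_done _ => intros; rfl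
  | loop_step _ _ _ ih₁ ih₂ =>
    intro q hq
    rw [ih₂ q hq, ih₁ q (by simp only [Cmd.bound, max_le_iff] at hq; exact hq.2)]

theorem Runs.length_le {c : Cmd} {s s' : Store} {T : ℕ} (h : Runs c s s' T) :
    ∀ r, (s' r).length ≤ (s r).length + T := by
  induction h with
  | skip s => intros; omega
  | push r b s =>
    intro q
    by_cases hq : q = r
    · subst hq; simp
    · simp [Function.update_of_ne hq]
  | pop r s =>
    intro q
    by_cases hq : q = r
    · subst hq; simp; omega
    · simp [Function.update_of_ne hq]
  | seq _ _ ih₁ ih₂ =>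
    intro q
    have := ih₁ q; have := ih₂ q; omega
  | branch_empty _ _ ih | branch_false _ _ ih | branch_true _ _ ih =>
    intro q
    have := ih q; omega
  | loop_done _ => intros; omega
  | loop_step _ _ _ ih₁ ih₂ =>
    intro q
    have := ih₁ q; have := ih₂ q; omega

/-- Renaming the registers of a program. -/
def Cmd.rename (ρ : ℕ → ℕ) : Cmd → Cmd
  | .skip => .skip
  | .push r b => .push (ρ r) b
  | .pop r => .pop (ρ r)
  | .seq c d => .seq (c.rename ρ) (d.rename ρ)
  | .branch r c d e => .branch (ρ r) (c.rename ρ) (d.rename ρ) (e.rename ρ)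
  | .loop r c => .loop (ρ r) (c.rename ρ)

theorem Runs.rename {ρ : ℕ → ℕ} (hρ : Function.Injective ρ) {c : Cmd} {s s' : Store} {T : ℕ}
    (h : Runs c s s' T) : ∀ u : Store, (∀ r, u (ρ r) = s r) →
      ∃ u', Runs (c.rename ρ) u u' T ∧ (∀ r, u' (ρ r) = s' r) ∧
        ∀ q, q ∉ Set.range ρ → u' q = u q := by
  induction h with
  | skip s => exact fun u hu => ⟨u, Runs.skip u, hu, fun _ _ => rfl⟩
  | push r b s =>
    refine fun u hu => ⟨_, Runs.push (ρ r) b u, fun q => ?_, fun q hq => ?_⟩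
    · by_cases hq : q = r
      · subst hq; simp [hu]
      · rw [Function.update_of_ne hq, Function.update_of_ne (fun h => hq (hρ h)), hu]
    · exact Function.update_of_ne (fun h => hq ⟨r, h.symm⟩) _ _
  | pop r s =>
    refine fun u hu => ⟨_, Runs.pop (ρ r) u, fun q => ?_, fun q hq => ?_⟩
    · by_cases hq : q = r
      · subst hq; simp [hu]
      · rw [Function.update_of_ne hq, Function.update_of_ne (fun h => hq (hρ h)), hu]
    · exact Function.update_of_ne (fun h => hq ⟨r, h.symm⟩) _ _
  | seq _ _ ih₁ ih₂ =>
    intro u hu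
    obtain ⟨u₁, h₁, e₁, f₁⟩ := ih₁ u hu
    obtain ⟨u₂, h₂, e₂, f₂⟩ := ih₂ u₁ e₁
    exact ⟨u₂, Runs.seq h₁ h₂, e₂, fun q hq => (f₂ q hq).trans (f₁ q hq)⟩
  | branch_empty hr _ ih =>
    intro u hu
    obtain ⟨u₁, h₁, e₁, f₁⟩ := ih u hu
    exact ⟨u₁, Runs.branch_empty ((hu _).trans hr) h₁, e₁, f₁⟩
  | branch_false hr _ ih =>
    intro u hu
    obtain ⟨u₁, h₁, e₁, f₁⟩ := ih u hu
    exact ⟨u₁, Runs.branch_false (by rw [hu]; exact hr) h₁, e₁, f₁⟩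
  | branch_true hr _ ih =>
    intro u hu
    obtain ⟨u₁, h₁, e₁, f₁⟩ := ih u hu
    exact ⟨u₁, Runs.branch_true (by rw [hu]; exact hr) h₁, e₁, f₁⟩
  | loop_done hr => exact fun u hu => ⟨u, Runs.loop_done ((hu _).trans hr), hu, fun _ _ => rfl⟩
  | loop_step hr _ _ ih₁ ih₂ =>
    intro u hu
    obtain ⟨u₁, h₁, e₁, f₁⟩ := ih₁ u hu
    obtain ⟨u₂, h₂, e₂, f₂⟩ := ih₂ u₁ e₁
    exact ⟨u₂, Runs.loop_step (by rw [hu]; exact hr) h₁ h₂, e₂,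
      fun q hq => (f₂ q hq).trans (f₁ q hq)⟩

/-- The renaming that sends register `0` to `a` and the other registers to those above `D`. -/
def bank (a D : ℕ) : ℕ → ℕ
  | 0 => a
  | j + 1 => D + 1 + j

theorem bank_injective {a D : ℕ} (h : a ≤ D) : Function.Injective (bank a D) := by
  intro i j hij
  cases i <;> cases j <;> simp only [bank] at hij <;> omega

/-- A program that maps a store with a single nonempty register to such a store can be run inside
a larger store, with register `a` in the place of register `0` and scratch space above `D`. -/
theorem Runs.bank {c : Cmd} {x y : List Bool} {T a D : ℕ}
    (h : Runs c (inputStore x) (inputStore y) T) (haD : a ≤ D) (s : Store) (hs : s a = x)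
    (hD : ∀ r, D < r → s r = []) :
    Runs (c.rename (QMA.bank a D)) s (Function.update s a y) T := by
  obtain ⟨u, hu, e, f⟩ := h.rename (bank_injective haD) s (by
    intro r
    cases r with
    | zero => simpa [QMA.bank, inputStore] using hs
    | succ j => simpa [QMA.bank, inputStore] using hD _ (by omega))
  convert hu using 1
  funext r
  by_cases hr : r ∈ Set.range (QMA.bank a D)
  · obtain ⟨j, rfl⟩ := hr
    rw [e]
    cases j with
    | zero => simp [QMA.bank, inputStore]
    | succ j =>
      rw [Function.update_of_ne (by simp only [QMA.bank]; omega)]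
      simpa [QMA.bank, inputStore] using hD _ (by omega)
  · rw [f r hr, Function.update_of_ne (fun h => hr ⟨0, by simp [QMA.bank, h]⟩)]

theorem Halts.bank {c : Cmd} {x y : List Bool} {B a D : ℕ}
    (h : Halts c (inputStore x) (inputStore y) B) (haD : a ≤ D) (s : Store) (hs : s a = x)
    (hD : ∀ r, D < r → s r = []) :
    Halts (c.rename (QMA.bank a D)) s (Function.update s a y) B := by
  obtain ⟨T, hT, hr⟩ := h
  exact ⟨T, hT, hr.bank haD s hs hD⟩

namespace Cmd

/-- Empty register `r`. -/
def clear (r : ℕ) : Cmd := loop r (pop r)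

/-- Empty all registers `1, …, n`. -/
def clearUpTo : ℕ → Cmd
  | 0 => skip
  | n + 1 => seq (clear (n + 1)) (clearUpTo n)

/-- Move the contents of `r`, reversed, onto `d`. -/
def move (r d : ℕ) : Cmd :=
  loop r (branch r skip (seq (pop r) (push d false)) (seq (pop r) (push d true)))

/-- Move the contents of `r`, reversed, onto both `d` and `e`. -/
def move₂ (r d e : ℕ) : Cmd :=
  loop r (branch r skip (seq (pop r) (seq (push d false) (push e false)))
    (seq (pop r) (seq (push d true) (push e true))))

end Cmd

theorem halts_clear (r : ℕ) (s : Store) :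
    Halts (Cmd.clear r) s (Function.update s r []) (2 * (s r).length + 1) := by
  generalize hl : s r = l
  induction l generalizing s with
  | nil =>
    have : Function.update s r [] = s := by rw [← hl, Function.update_eq_self]
    rw [this]
    exact (Halts.loop_done hl).mono (by simp)
  | cons b l ih =>
    have := ih (Function.update s r l) (by simp)
    rw [Function.update_idem] at this
    have hp := Halts.pop r s
    rw [hl, List.tail_cons] at hp
    exact (Halts.loop_step (by simp [hl]) hp this).mono (by simp; omega)

theorem halts_clearUpTo (n : ℕ) (s : Store) (B : ℕ) (hB : ∀ r, (s r).length ≤ B) :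
    Halts (Cmd.clearUpTo n) s (fun r => if 1 ≤ r ∧ r ≤ n then [] else s r)
      (n * (2 * B + 1) + 1) := by
  induction n generalizing s with
  | zero =>
    have : (fun r => if 1 ≤ r ∧ r ≤ 0 then [] else s r) = s := by
      funext r; rw [if_neg (by omega)]
    rw [this]
    exact (Halts.skip s).mono (by omega)
  | succ n ih =>
    have h₂ := ih (Function.update s (n + 1) []) (by
      intro r
      by_cases hr : r = n + 1
      · subst hr; simp
      · rw [Function.update_of_ne hr]; exact hB r)
    refine ((halts_clear (n + 1) s).seq h₂).cast (by have := hB (n + 1); nlinarith) ?_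
    funext r
    by_cases hr : r = n + 1
    · subst hr; simp
    · rw [Function.update_of_ne hr]
      congr 1
      simp only [eq_iff_iff]
      omega

theorem halts_move {r d : ℕ} (hrd : r ≠ d) (s : Store) :
    Halts (Cmd.move r d) s
      (Function.update (Function.update s d ((s r).reverse ++ s d)) r [])
      (4 * (s r).length + 1) := by
  generalize hl : s r = l
  induction l generalizing s with
  | nil =>
    have : Function.update (Function.update s d ([].reverse ++ s d)) r [] = s := by
      funext q
      by_cases hq : q = r
      · subst hq; simp [hl]
      · rw [Function.update_of_ne hq]; simp
    rw [this]
    exact (Halts.loop_done hl).mono (by simp)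
  | cons b l ih =>
    have h₁ := ih (Function.update (Function.update s r l) d (b :: s d))
      (by simp [Function.update_of_ne hrd])
    have hbody : Halts (Cmd.branch r Cmd.skip (Cmd.seq (Cmd.pop r) (Cmd.push d false))
        (Cmd.seq (Cmd.pop r) (Cmd.push d true))) s
        (Function.update (Function.update s r l) d (b :: s d)) 3 := by
      have key := (Halts.pop r s).seq (Halts.push d b _)
      rw [hl, List.tail_cons, Function.update_of_ne hrd.symm] at key
      cases b
      · exact Halts.branch_false hl key
      · exact Halts.branch_true hl key
    refine (Halts.loop_step (by simp [hl]) hbody h₁).cast (by simp; omega) ?_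
    funext q
    by_cases hq : q = r
    · subst hq; simp
    · by_cases hq' : q = d
      · subst hq'; simp [Function.update_of_ne hq]
      · simp [Function.update_of_ne hq, Function.update_of_ne hq']

theorem halts_move₂ {r d e : ℕ} (hrd : r ≠ d) (hre : r ≠ e) (hde : d ≠ e) (s : Store) :
    Halts (Cmd.move₂ r d e) s
      (Function.update (Function.update (Function.update s d ((s r).reverse ++ s d))
        e ((s r).reverse ++ s e)) r [])
      (5 * (s r).length + 1) := by
  generalize hl : s r = l
  induction l generalizing s with
  | nil =>
    have : Function.update (Function.update (Function.update s d ([].reverse ++ s d))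
        e ([].reverse ++ s e)) r [] = s := by
      funext q
      by_cases hq : q = r
      · subst hq; simp [hl]
      · rw [Function.update_of_ne hq]; simp
    rw [this]
    exact (Halts.loop_done hl).mono (by simp)
  | cons b l ih =>
    have h₁ := ih (Function.update (Function.update (Function.update s r l) d (b :: s d))
      e (b :: s e)) (by simp [Function.update_of_ne hrd, Function.update_of_ne hre])
    have hbody : Halts (Cmd.branch r Cmd.skip
        (Cmd.seq (Cmd.pop r) (Cmd.seq (Cmd.push d false) (Cmd.push e false)))
        (Cmd.seq (Cmd.pop r) (Cmd.seq (Cmd.push d true) (Cmd.push e true)))) s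
        (Function.update (Function.update (Function.update s r l) d (b :: s d))
          e (b :: s e)) 4 := by
      have key := (Halts.pop r s).seq ((Halts.push d b _).seq (Halts.push e b _))
      rw [hl, List.tail_cons, Function.update_of_ne hrd.symm,
        Function.update_of_ne hde.symm, Function.update_of_ne hre.symm] at key
      cases b
      · exact Halts.branch_false hl key
      · exact Halts.branch_true hl key
    refine (Halts.loop_step (by simp [hl]) hbody h₁).cast (by simp; omega) ?_
    funext q
    by_cases hq : q = r
    · subst hq; simp
    · by_cases hq' : q = d
      · subst hq'; simp [Function.update_of_ne hq, Function.update_of_ne hde]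
      · by_cases hq'' : q = e
        · subst hq''; simp [Function.update_of_ne hq]
        · simp [Function.update_of_ne hq, Function.update_of_ne hq', Function.update_of_ne hq'']

/-! ### Polynomial-time functions between encoded types -/

/-- The pairing of bit strings: the bits of `u`, each preceded by `true`, then `false`,
then `v`. -/
def pairStr (u v : List Bool) : List Bool := u.flatMap (fun b => [true, b]) ++ false :: v

@[simp] theorem pairStr_nil (v : List Bool) : pairStr [] v = false :: v := rfl

@[simp] theorem pairStr_cons (b : Bool) (u v : List Bool) :
    pairStr (b :: u) v = true :: b :: pairStr u v := rfl

@[simp] theorem length_pairStr (u v : List Bool) :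
    (pairStr u v).length = 2 * u.length + v.length + 1 := by
  induction u with
  | nil => simp
  | cons b u ih => simp [ih]; omega

/-- Types whose elements are represented by bit strings. -/
class Code (α : Type*) where
  enc : α → List Bool

open Code

/-- A bit string represented by itself; the type `List Bool` carries the representation of lists,
which delimits the entries. -/
structure Str where
  bits : List Bool

instance : Code Str := ⟨Str.bits⟩

instance : Code Bool := ⟨fun b => [b]⟩

/-- Natural numbers are represented in unary. -/
instance : Code ℕ := ⟨fun n => List.replicate n true⟩

instance {α β : Type*} [Code α] [Code β] : Code (α × β) := ⟨fun a => pairStr (enc a.1) (enc a.2)⟩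

/-- The code of a nonempty list is the code of the pair of its head and its tail. -/
instance {α : Type*} [Code α] : Code (List α) :=
  ⟨fun l => l.foldr (fun a s => pairStr (enc a) s) []⟩

instance {α : Type*} [Code α] (p : α → Prop) : Code {a // p a} := ⟨fun a => enc a.1⟩

/-- The length of the code. -/
def size {α : Type*} [Code α] (a : α) : ℕ := (enc a).length

section
variable {α β γ : Type*} [Code α] [Code β] [Code γ]

theorem enc_pair (a : α) (b : β) : enc (a, b) = pairStr (enc a) (enc b) := rfl
@[simp] theorem enc_nil : enc ([] : List α) = [] := rfl
theorem enc_cons (a : α) (l : List α) : enc (a :: l) = pairStr (enc a) (enc l) := rfl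
@[simp] theorem enc_bool (b : Bool) : enc b = [b] := rfl
theorem enc_nat (n : ℕ) : enc n = List.replicate n true := rfl
@[simp] theorem enc_str (s : Str) : enc s = s.bits := rfl

@[simp] theorem size_pair (a : α) (b : β) : size (a, b) = 2 * size a + size b + 1 := by
  simp [size, enc_pair]
@[simp] theorem size_nil : size ([] : List α) = 0 := rfl
@[simp] theorem size_cons (a : α) (l : List α) : size (a :: l) = 2 * size a + size l + 1 := by
  simp [size, enc_cons]
@[simp] theorem size_bool (b : Bool) : size b = 1 := rfl
@[simp] theorem size_nat (n : ℕ) : size n = n := by simp [size, enc_nat]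
@[simp] theorem size_str (s : Str) : size s = s.bits.length := rfl

theorem size_append (l l' : List α) : size (l ++ l') = size l + size l' := by
  induction l with
  | nil => simp
  | cons a l ih => simp [ih]; omega

theorem size_reverse (l : List α) : size l.reverse = size l := by
  induction l with
  | nil => simp
  | cons a l ih => simp [size_append, ih]; omega

theorem length_le_size (l : List α) : l.length ≤ size l := by
  induction l with
  | nil => simp
  | cons a l ih => simp; omega

theorem size_le_of_mem {a : α} {l : List α} (h : a ∈ l) : size a ≤ size l := by
  induction l with
  | nil => simp at h
  | cons b l ih =>
    rcases List.mem_cons.1 h with rfl | h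
    · simp; omega
    · have := ih h; simp; omega

theorem size_listBool (l : List Bool) : size l = 3 * l.length := by
  induction l with
  | nil => simp
  | cons b l ih => simp [ih]; omega

end

/-- Monotonicity of polynomials with natural coefficients. -/
theorem eval_mono (p : Polynomial ℕ) {m n : ℕ} (h : m ≤ n) : p.eval m ≤ p.eval n := by
  rw [Polynomial.eval_eq_sum, Polynomial.eval_eq_sum]
  exact Finset.sum_le_sum fun i _ => Nat.mul_le_mul_left _ (Nat.pow_le_pow_left h i)

/-- `f` is bounded by a polynomial in the size of the argument. -/
def PolyBdd {α : Type*} [Code α] (f : α → ℕ) : Prop :=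
  ∃ p : Polynomial ℕ, ∀ a, f a ≤ p.eval (size a)

namespace PolyBdd

variable {α β : Type*} [Code α] [Code β] {f g : α → ℕ}

theorem mono (hg : PolyBdd g) (h : ∀ a, f a ≤ g a) : PolyBdd f := by
  obtain ⟨p, hp⟩ := hg
  exact ⟨p, fun a => (h a).trans (hp a)⟩

theorem const (n : ℕ) : PolyBdd (fun _ : α => n) := ⟨Polynomial.C n, fun a => by simp⟩

theorem size : PolyBdd (fun a : α => size a) := ⟨Polynomial.X, fun a => by simp⟩

theorem add (hf : PolyBdd f) (hg : PolyBdd g) : PolyBdd (fun a => f a + g a) := by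
  obtain ⟨p, hp⟩ := hf
  obtain ⟨q, hq⟩ := hg
  exact ⟨p + q, fun a => by simpa using add_le_add (hp a) (hq a)⟩

theorem mul (hf : PolyBdd f) (hg : PolyBdd g) : PolyBdd (fun a => f a * g a) := by
  obtain ⟨p, hp⟩ := hf
  obtain ⟨q, hq⟩ := hg
  exact ⟨p * q, fun a => by simpa using Nat.mul_le_mul (hp a) (hq a)⟩

theorem eval (p : Polynomial ℕ) (hf : PolyBdd f) : PolyBdd (fun a => p.eval (f a)) := by
  obtain ⟨q, hq⟩ := hf
  exact ⟨p.comp q, fun a => by simpa using eval_mono p (hq a)⟩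

theorem comp {g : β → ℕ} {k : α → β} (hg : PolyBdd g) (hk : PolyBdd fun a => QMA.size (k a)) :
    PolyBdd (fun a => g (k a)) := by
  obtain ⟨p, hp⟩ := hg
  exact (hk.eval p).mono fun a => hp _

end PolyBdd

/-- `f` is computable in polynomial time, by a program that leaves no garbage. -/
@[fun_prop]
def PolyFun {α β : Type*} [Code α] [Code β] (f : α → β) : Prop :=
  ∃ (c : Cmd) (B : α → ℕ), PolyBdd B ∧
    ∀ a, Halts c (inputStore (enc a)) (inputStore (enc (f a))) (B a)

namespace PolyFun

variable {α β γ : Type*} [Code α] [Code β] [Code γ]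

/-- Garbage can be removed at the end. -/
theorem of_program {f : α → β} (c : Cmd) {B : α → ℕ} (hB : PolyBdd B)
    (h : ∀ a, ∃ s, Halts c (inputStore (enc a)) s (B a) ∧ s 0 = enc (f a)) : PolyFun f := by
  refine ⟨Cmd.seq c (Cmd.clearUpTo c.bound),
    fun a => B a + (c.bound * (2 * (size a + B a) + 1) + 1), ?_, fun a => ?_⟩
  · exact hB.add ((((PolyBdd.const _).mul ((((PolyBdd.const 2).mul
      (PolyBdd.size.add hB))).add (PolyBdd.const 1)))).add (PolyBdd.const 1))
  · obtain ⟨s, ⟨T, hT, hr⟩, hs⟩ := h a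
    have h1 : Halts c (inputStore (enc a)) s (B a) := ⟨T, hT, hr⟩
    refine (h1.seq
      (halts_clearUpTo c.bound s (size a + B a) fun r => ?_)).cast le_rfl ?_
    · have := hr.length_le r
      have h0 : (inputStore (enc a) r).length ≤ size a := by
        unfold inputStore; split_ifs <;> simp [size]
      omega
    · funext r
      by_cases hr0 : r = 0
      · subst hr0; simp [hs, inputStore]
      · by_cases hrb : r ≤ c.bound
        · rw [if_pos (by omega)]; simp [inputStore, hr0]
        · rw [if_neg (by omega), hr.frame r (by omega)]; simp [inputStore, hr0]

theorem size_bdd {f : α → β} (hf : PolyFun f) : PolyBdd fun a => size (f a) := by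
  obtain ⟨c, B, hB, h⟩ := hf
  refine (PolyBdd.size.add hB).mono fun a => ?_
  obtain ⟨T, hT, hr⟩ := h a
  have := hr.length_le 0
  simp only [inputStore, if_true] at this
  simp only [size]
  omega

/-- Computability only depends on the codes of the values. -/
theorem of_enc {f : α → β} {g : α → γ} (hg : PolyFun g) (h : ∀ a, enc (f a) = enc (g a)) :
    PolyFun f := by
  obtain ⟨c, B, hB, hc⟩ := hg
  exact ⟨c, B, hB, fun a => by rw [h]; exact hc a⟩

/-- Computability only depends on the codes of the arguments. -/
theorem comp_enc {f : β → γ} (hf : PolyFun f) (k : α → β) (hk : ∀ a, enc (k a) = enc a) :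
    PolyFun fun a => f (k a) := by
  obtain ⟨c, B, hB, hc⟩ := hf
  refine ⟨c, fun a => B (k a), hB.comp (PolyBdd.size.mono fun a => ?_), fun a => ?_⟩
  · simp [size, hk]
  · rw [← hk]; exact hc (k a)

@[fun_prop]
theorem id' : PolyFun fun a : α => a :=
  of_program Cmd.skip (PolyBdd.const 1) fun a => ⟨_, Halts.skip _, by simp [inputStore]⟩

@[fun_prop]
theorem comp {f : β → γ} {g : α → β} (hf : PolyFun f) (hg : PolyFun g) :
    PolyFun fun a => f (g a) := by
  have hs := hg.size_bdd
  obtain ⟨c, B, hB, hc⟩ := hf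
  obtain ⟨d, D, hD, hd⟩ := hg
  exact ⟨Cmd.seq d c, fun a => D a + B (g a), hD.add (hB.comp hs), fun a => (hd a).seq (hc _)⟩

/-- Push the bits of `l` onto register `0`. -/
def pushAll : List Bool → Cmd
  | [] => Cmd.skip
  | b :: l => Cmd.seq (pushAll l) (Cmd.push 0 b)

theorem halts_pushAll (l : List Bool) (x : List Bool) :
    Halts (pushAll l) (inputStore x) (inputStore (l ++ x)) (l.length + 1) := by
  induction l with
  | nil => exact Halts.skip _
  | cons b l ih =>
    refine (ih.seq (Halts.push 0 b _)).cast (by simp) ?_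
    funext r
    by_cases hr : r = 0
    · subst hr; simp [inputStore]
    · simp [inputStore, hr]

theorem halts_clear_input (x : List Bool) :
    Halts (Cmd.clear 0) (inputStore x) (inputStore []) (2 * x.length + 1) := by
  refine (halts_clear 0 _).cast (by simp [inputStore]) ?_
  funext r
  by_cases hr : r = 0
  · subst hr; simp [inputStore]
  · simp [inputStore, hr]

@[fun_prop]
theorem const (b : β) : PolyFun fun _ : α => b := by
  refine ⟨Cmd.seq (Cmd.clear 0) (pushAll (enc b)), fun a => 2 * size a + 1 + (size b + 1), ?_,
    fun a => ?_⟩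
  · exact (((PolyBdd.const 2).mul PolyBdd.size).add (PolyBdd.const 1)).add (PolyBdd.const _)
  · exact ((halts_clear_input _).seq (halts_pushAll _ _)).cast le_rfl (by simp)

/-- Copy register `0` to register `1`. -/
def copyCmd : Cmd := Cmd.seq (Cmd.move 0 2) (Cmd.move₂ 2 0 1)

/-- A store given by the first three registers. -/
def store₃ (x y z : List Bool) : Store := fun r =>
  if r = 0 then x else if r = 1 then y else if r = 2 then z else []

theorem inputStore_eq (x : List Bool) : inputStore x = store₃ x [] [] := by
  funext r
  rcases r with _ | _ | _ | r <;> simp [inputStore, store₃]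

theorem halts_copyCmd (x : List Bool) :
    Halts copyCmd (inputStore x) (store₃ x x []) (9 * x.length + 2) := by
  refine ((halts_move (by decide) _).seq
    (halts_move₂ (by decide) (by decide) (by decide) _)).cast ?_ ?_
  · simp [inputStore]; omega
  · funext r
    rcases r with _ | _ | _ | r <;> simp [inputStore, store₃]

/-- Replace registers `0` and `1` by the pair of their contents, in register `0`. -/
def pairCmd : Cmd :=
  Cmd.seq (Cmd.push 1 false) (Cmd.seq (Cmd.move 0 2) (Cmd.seq
    (Cmd.loop 2 (Cmd.branch 2 Cmd.skip
      (Cmd.seq (Cmd.pop 2) (Cmd.seq (Cmd.push 1 false) (Cmd.push 1 true)))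
      (Cmd.seq (Cmd.pop 2) (Cmd.seq (Cmd.push 1 true) (Cmd.push 1 true)))))
    (Cmd.seq (Cmd.move 1 2) (Cmd.move 2 0))))

theorem halts_pairCmd_loop (u v : List Bool) :
    Halts (Cmd.loop 2 (Cmd.branch 2 Cmd.skip
      (Cmd.seq (Cmd.pop 2) (Cmd.seq (Cmd.push 1 false) (Cmd.push 1 true)))
      (Cmd.seq (Cmd.pop 2) (Cmd.seq (Cmd.push 1 true) (Cmd.push 1 true)))))
      (store₃ [] v u) (store₃ [] (u.reverse.flatMap (fun b => [true, b]) ++ v) [])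
      (5 * u.length + 1) := by
  induction u generalizing v with
  | nil => exact (Halts.loop_done (by simp [store₃])).cast (by simp) (by simp)
  | cons b u ih =>
    have hbody : Halts (Cmd.branch 2 Cmd.skip
        (Cmd.seq (Cmd.pop 2) (Cmd.seq (Cmd.push 1 false) (Cmd.push 1 true)))
        (Cmd.seq (Cmd.pop 2) (Cmd.seq (Cmd.push 1 true) (Cmd.push 1 true))))
        (store₃ [] v (b :: u)) (store₃ [] (true :: b :: v) u) 4 := by
      have key := (Halts.pop 2 (store₃ [] v (b :: u))).seq
        ((Halts.push 1 b _).seq (Halts.push 1 true _))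
      have h : Function.update (Function.update (Function.update (store₃ [] v (b :: u)) 2
          (store₃ [] v (b :: u) 2).tail) 1 (b :: Function.update (store₃ [] v (b :: u)) 2
          (store₃ [] v (b :: u) 2).tail 1)) 1 (true :: Function.update (Function.update
          (store₃ [] v (b :: u)) 2 (store₃ [] v (b :: u) 2).tail) 1
          (b :: Function.update (store₃ [] v (b :: u)) 2 (store₃ [] v (b :: u) 2).tail 1) 1)
          = store₃ [] (true :: b :: v) u := by
        funext r
        rcases r with _ | _ | _ | r <;> simp [store₃]
      rw [h] at key
      cases b
      · exact Halts.branch_false rfl key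
      · exact Halts.branch_true rfl key
    refine (Halts.loop_step (by simp [store₃]) hbody (ih _)).cast (by simp; omega) ?_
    simp

theorem halts_pairCmd (u v : List Bool) :
    Halts pairCmd (store₃ u v []) (inputStore (pairStr u v))
      (30 * u.length + 30 * v.length + 30) := by
  have h1 : Halts (Cmd.push 1 false) (store₃ u v []) (store₃ u (false :: v) []) 1 :=
    (Halts.push 1 false _).cast le_rfl (by
      funext r; rcases r with _ | _ | _ | r <;> simp [store₃])
  have h2 : Halts (Cmd.move 0 2) (store₃ u (false :: v) []) (store₃ [] (false :: v) u.reverse)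
      (4 * u.length + 1) :=
    (halts_move (by decide) _).cast (by simp [store₃]) (by
      funext r; rcases r with _ | _ | _ | r <;> simp [store₃])
  have h3 := halts_pairCmd_loop u.reverse (false :: v)
  rw [List.reverse_reverse] at h3
  change Halts _ _ (store₃ [] (pairStr u v) []) _ at h3
  have h4 : Halts (Cmd.move 1 2) (store₃ [] (pairStr u v) [])
      (store₃ [] [] (pairStr u v).reverse) (4 * (pairStr u v).length + 1) :=
    (halts_move (by decide) _).cast (by simp [store₃]) (by
      funext r; rcases r with _ | _ | _ | r <;> simp [store₃])
  have h5 : Halts (Cmd.move 2 0) (store₃ [] [] (pairStr u v).reverse)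
      (inputStore (pairStr u v)) (4 * (pairStr u v).length + 1) :=
    (halts_move (by decide) _).cast (by simp [store₃]) (by
      rw [inputStore_eq]
      funext r; rcases r with _ | _ | _ | r <;> simp [store₃])
  refine (h1.seq (h2.seq (h3.seq (h4.seq h5)))).mono ?_
  simp
  omega

@[fun_prop]
theorem mk {f : α → β} {g : α → γ} (hf : PolyFun f) (hg : PolyFun g) :
    PolyFun fun a => (f a, g a) := by
  have hfs := hf.size_bdd
  have hgs := hg.size_bdd
  obtain ⟨c, B, hB, hc⟩ := hf
  obtain ⟨d, D, hD, hd⟩ := hg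
  refine ⟨Cmd.seq copyCmd (Cmd.seq (c.rename (bank 0 1)) (Cmd.seq (d.rename (bank 1 1)) pairCmd)),
    fun a => (9 * size a + 2) + (B a + (D a + (30 * size (f a) + 30 * size (g a) + 30))), ?_,
    fun a => ?_⟩
  · exact (((PolyBdd.const 9).mul PolyBdd.size).add (PolyBdd.const 2)).add (hB.add (hD.add
      ((((PolyBdd.const 30).mul hfs).add ((PolyBdd.const 30).mul hgs)).add (PolyBdd.const 30))))
  · have h2 : Halts (c.rename (bank 0 1)) (store₃ (enc a) (enc a) [])
        (store₃ (enc (f a)) (enc a) []) (B a) := by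
      refine ((hc a).bank (by omega) _ (by simp [store₃]) fun r hr => ?_).cast le_rfl ?_
      · rcases r with _ | _ | _ | r <;> simp [store₃] at *
      · funext r; rcases r with _ | _ | _ | r <;> simp [store₃]
    have h3 : Halts (d.rename (bank 1 1)) (store₃ (enc (f a)) (enc a) [])
        (store₃ (enc (f a)) (enc (g a)) []) (D a) := by
      refine ((hd a).bank (by omega) _ (by simp [store₃]) fun r hr => ?_).cast le_rfl ?_
      · rcases r with _ | _ | _ | r <;> simp [store₃] at *
      · funext r; rcases r with _ | _ | _ | r <;> simp [store₃]
    exact (halts_copyCmd _).seq (h2.seq (h3.seq (halts_pairCmd _ _)))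

/-- Split the pair in register `0`: the first component goes to register `1`, the second one
stays in register `0`. -/
def unpairCmd : Cmd :=
  Cmd.seq (Cmd.push 3 true) (Cmd.seq
    (Cmd.loop 3 (Cmd.branch 0 (Cmd.pop 3) (Cmd.seq (Cmd.pop 0) (Cmd.pop 3))
      (Cmd.seq (Cmd.pop 0) (Cmd.branch 0 (Cmd.pop 3)
        (Cmd.seq (Cmd.pop 0) (Cmd.push 2 false)) (Cmd.seq (Cmd.pop 0) (Cmd.push 2 true))))))
    (Cmd.move 2 1))

/-- A store given by the first four registers. -/
def store₄ (x y z w : List Bool) : Store := fun r =>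
  if r = 0 then x else if r = 1 then y else if r = 2 then z else if r = 3 then w else []

theorem inputStore_eq₄ (x : List Bool) : inputStore x = store₄ x [] [] [] := by
  funext r
  rcases r with _ | _ | _ | _ | r <;> simp [inputStore, store₄]

theorem halts_unpairCmd_loop (u v z : List Bool) :
    Halts (Cmd.loop 3 (Cmd.branch 0 (Cmd.pop 3) (Cmd.seq (Cmd.pop 0) (Cmd.pop 3))
      (Cmd.seq (Cmd.pop 0) (Cmd.branch 0 (Cmd.pop 3)
        (Cmd.seq (Cmd.pop 0) (Cmd.push 2 false)) (Cmd.seq (Cmd.pop 0) (Cmd.push 2 true))))))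
      (store₄ (pairStr u v) [] z [true]) (store₄ v [] (u.reverse ++ z) [])
      (6 * u.length + 5) := by
  induction u generalizing z with
  | nil =>
    have h := (Halts.pop 0 (store₄ (pairStr [] v) [] z [true])).seq (Halts.pop 3 _)
    refine (Halts.loop_step (by simp [store₄]) (Halts.branch_false (l := v) rfl h)
      (Halts.loop_done (by simp [store₄]))).cast (by simp) ?_
    funext r; rcases r with _ | _ | _ | _ | r <;> simp [store₄]
  | cons b u ih =>
    have hbody : Halts (Cmd.branch 0 (Cmd.pop 3) (Cmd.seq (Cmd.pop 0) (Cmd.pop 3))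
        (Cmd.seq (Cmd.pop 0) (Cmd.branch 0 (Cmd.pop 3)
        (Cmd.seq (Cmd.pop 0) (Cmd.push 2 false)) (Cmd.seq (Cmd.pop 0) (Cmd.push 2 true)))))
        (store₄ (pairStr (b :: u) v) [] z [true]) (store₄ (pairStr u v) [] (b :: z) [true]) 5 := by
      have h1 : Halts (Cmd.pop 0) (store₄ (pairStr (b :: u) v) [] z [true])
          (store₄ (b :: pairStr u v) [] z [true]) 1 :=
        (Halts.pop 0 _).cast le_rfl (by
          funext r; rcases r with _ | _ | _ | _ | r <;> simp [store₄])
      have h2 : Halts (Cmd.seq (Cmd.pop 0) (Cmd.push 2 b)) (store₄ (b :: pairStr u v) [] z [true])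
          (store₄ (pairStr u v) [] (b :: z) [true]) 2 :=
        ((Halts.pop 0 _).seq (Halts.push 2 b _)).cast le_rfl (by
          funext r; rcases r with _ | _ | _ | _ | r <;> simp [store₄])
      refine Halts.branch_true rfl (h1.seq (B₂ := 3) ?_)
      cases b
      · exact Halts.branch_false rfl h2
      · exact Halts.branch_true rfl h2
    exact (Halts.loop_step (by simp [store₄]) hbody (ih _)).cast (by simp; omega) (by simp)

theorem halts_unpairCmd (u v : List Bool) :
    Halts unpairCmd (inputStore (pairStr u v)) (store₄ v u [] []) (10 * u.length + 10) := by
  have h1 : Halts (Cmd.push 3 true) (inputStore (pairStr u v))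
      (store₄ (pairStr u v) [] [] [true]) 1 :=
    (Halts.push 3 true _).cast le_rfl (by
      rw [inputStore_eq₄]
      funext r; rcases r with _ | _ | _ | _ | r <;> simp [store₄])
  have h2 := halts_unpairCmd_loop u v []
  refine (h1.seq (h2.seq (halts_move (by decide) _))).cast (by simp [store₄]; omega) ?_
  funext r; rcases r with _ | _ | _ | _ | r <;> simp [store₄]

theorem prod_fst : PolyFun fun a : α × β => a.1 := by
  refine of_program (Cmd.seq unpairCmd (Cmd.seq (Cmd.clear 0) (Cmd.seq (Cmd.move 1 2)
    (Cmd.move 2 0)))) (B := fun a => 30 * size a + 30)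
    (((PolyBdd.const 30).mul PolyBdd.size).add (PolyBdd.const 30)) fun a => ?_
  refine ⟨_, ((halts_unpairCmd (enc a.1) (enc a.2)).seq ((halts_clear 0 _).seq
    ((halts_move (by decide) _).seq (halts_move (by decide) _)))).mono ?_, ?_⟩
  · obtain ⟨a, b⟩ := a
    simp only [size_pair]
    simp [store₄, ← size.eq_1]
    omega
  · simp [store₄]

theorem prod_snd : PolyFun fun a : α × β => a.2 := by
  refine of_program unpairCmd (B := fun a => 30 * size a + 30)
    (((PolyBdd.const 30).mul PolyBdd.size).add (PolyBdd.const 30)) fun a => ?_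
  refine ⟨_, (halts_unpairCmd (enc a.1) (enc a.2)).mono ?_, ?_⟩
  · obtain ⟨a, b⟩ := a
    simp only [size_pair, ← size.eq_1]
    omega
  · simp [store₄]

@[fun_prop]
theorem fst {f : α → β × γ} (hf : PolyFun f) : PolyFun fun a => (f a).1 := prod_fst.comp hf

@[fun_prop]
theorem snd {f : α → β × γ} (hf : PolyFun f) : PolyFun fun a => (f a).2 := prod_snd.comp hf

/-- Definition by cases; each branch need only be computable on its own domain. -/
theorem cases {f : α → Bool} {g : α → β} (hf : PolyFun f)
    (h₁ : PolyFun fun a : {a // f a = true} => g a)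
    (h₂ : PolyFun fun a : {a // f a = false} => g a) : PolyFun g := by
  obtain ⟨c, B, hB, hc⟩ := hf
  obtain ⟨c₁, B₁, hB₁, hc₁⟩ := h₁
  obtain ⟨c₂, B₂, hB₂, hc₂⟩ := h₂
  classical
  refine ⟨Cmd.seq copyCmd (Cmd.seq (c.rename (bank 1 1)) (Cmd.branch 1 Cmd.skip
    (Cmd.seq (Cmd.pop 1) c₂) (Cmd.seq (Cmd.pop 1) c₁))), fun a => (9 * size a + 2) + (B a +
    (1 + ((if h : f a = true then B₁ ⟨a, h⟩ else 0) +
      (if h : f a = false then B₂ ⟨a, h⟩ else 0)) + 1)), ?_, fun a => ?_⟩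
  · have hB₁' : PolyBdd fun a => if h : f a = true then B₁ ⟨a, h⟩ else 0 := by
      obtain ⟨p, hp⟩ := hB₁
      refine ⟨p, fun a => ?_⟩
      dsimp only
      split_ifs with h
      · exact hp _
      · omega
    have hB₂' : PolyBdd fun a => if h : f a = false then B₂ ⟨a, h⟩ else 0 := by
      obtain ⟨p, hp⟩ := hB₂
      refine ⟨p, fun a => ?_⟩
      dsimp only
      split_ifs with h
      · exact hp _
      · omega
    exact (((PolyBdd.const 9).mul PolyBdd.size).add (PolyBdd.const 2)).add (hB.add
      (((PolyBdd.const 1).add (hB₁'.add hB₂')).add (PolyBdd.const 1)))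
  · have h2 : Halts (c.rename (bank 1 1)) (store₃ (enc a) (enc a) [])
        (store₃ (enc a) [f a] []) (B a) := by
      refine ((hc a).bank (by omega) _ (by simp [store₃]) fun r hr => ?_).cast le_rfl ?_
      · rcases r with _ | _ | _ | r <;> simp [store₃] at *
      · funext r; rcases r with _ | _ | _ | r <;> simp [store₃]
    have hpop : Halts (Cmd.pop 1) (store₃ (enc a) [f a] []) (inputStore (enc a)) 1 :=
      (Halts.pop 1 _).cast le_rfl (by
        rw [inputStore_eq]
        funext r; rcases r with _ | _ | _ | r <;> simp [store₃])
    refine ((halts_copyCmd _).seq (h2.seq ?_))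
    rcases Bool.eq_false_or_eq_true (f a) with hfa | hfa
    · exact (Halts.branch_true (l := []) (by simp [store₃, hfa])
        (hpop.seq (hc₁ ⟨a, hfa⟩))).mono (by simp [hfa])
    · exact (Halts.branch_false (l := []) (by simp [store₃, hfa])
        (hpop.seq (hc₂ ⟨a, hfa⟩))).mono (by simp [hfa])

theorem val {p : α → Prop} {f : α → β} (hf : PolyFun f) : PolyFun fun a : {a // p a} => f a :=
  hf.comp_enc (fun a : {a // p a} => a.1) fun _ => rfl

@[fun_prop]
theorem cond {f : α → Bool} {g h : α → β} (hf : PolyFun f) (hg : PolyFun g) (hh : PolyFun h) :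
    PolyFun fun a => bif f a then g a else h a := by
  refine cases hf ?_ ?_
  · convert (val hg : PolyFun fun a : {a // f a = true} => g a) using 2 with a
    simp [a.2]
  · convert (val hh : PolyFun fun a : {a // f a = false} => h a) using 2 with a
    simp [a.2]

/-- Iteration of a polynomial-time function, as long as the iterates stay polynomially small. -/
theorem iterate {σ : Type*} [Code σ] {n : α → ℕ} {init : α → σ} {step : σ → σ}
    (hn : PolyFun n) (hi : PolyFun init) (hs : PolyFun step) {M : α → ℕ} (hM : PolyBdd M)
    (h : ∀ a, ∀ i ≤ n a, size (step^[i] (init a)) ≤ M a) :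
    PolyFun fun a => step^[n a] (init a) := by
  have hns := hn.size_bdd
  obtain ⟨c₀, B₀, hB₀, hc₀⟩ := hn.mk hi
  obtain ⟨c, B, ⟨p, hp⟩, hc⟩ := hs
  have loop : ∀ (k : ℕ) (s : σ) (N : ℕ), (∀ i ≤ k, size (step^[i] s) ≤ N) →
      Halts (Cmd.loop 1 (Cmd.seq (Cmd.pop 1) (c.rename (bank 0 1))))
        (store₄ (enc s) (enc k) [] []) (inputStore (enc (step^[k] s)))
        (k * (p.eval N + 2) + 1) := by
    intro k
    induction k with
    | zero =>
      intro s N _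
      refine (Halts.loop_done rfl).cast (by omega) ?_
      rw [inputStore_eq₄]; rfl
    | succ k ih =>
      intro s N hN
      have h1 : Halts (Cmd.pop 1) (store₄ (enc s) (enc (k + 1)) [] [])
          (store₄ (enc s) (enc k) [] []) 1 :=
        (Halts.pop 1 _).cast le_rfl (by
          funext r; rcases r with _ | _ | _ | _ | r <;>
            simp [store₄, enc_nat])
      have h2 : Halts (c.rename (bank 0 1)) (store₄ (enc s) (enc k) [] [])
          (store₄ (enc (step s)) (enc k) [] []) (p.eval N) := by
        refine ((hc s).bank (by omega) _ (by simp [store₄]) fun r hr => ?_).cast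
          ((hp s).trans (eval_mono p (hN 0 (by omega)))) ?_
        · rcases r with _ | _ | _ | _ | r <;> simp [store₄] at *
        · funext r; rcases r with _ | _ | _ | _ | r <;> simp [store₄]
      have h3 := ih (step s) N fun i hi => by
        rw [← Function.iterate_succ_apply]; exact hN _ (by omega)
      refine (Halts.loop_step ?_ (h1.seq h2) h3).cast ?_ ?_
      · simp [store₄, enc_nat, List.replicate_succ]
      · rw [add_mul]; omega
      · rw [Function.iterate_succ_apply]
  refine ⟨Cmd.seq c₀ (Cmd.seq unpairCmd
    (Cmd.loop 1 (Cmd.seq (Cmd.pop 1) (c.rename (bank 0 1))))),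
    fun a => B₀ a + ((10 * n a + 10) + (n a * (p.eval (M a) + 2) + 1)), ?_, fun a => ?_⟩
  · simp only [size_nat] at hns
    exact hB₀.add ((((PolyBdd.const 10).mul hns).add (PolyBdd.const 10)).add
      ((hns.mul ((hM.eval p).add (PolyBdd.const 2))).add (PolyBdd.const 1)))
  · have h1 := halts_unpairCmd (enc (n a)) (enc (init a))
    have h2 := loop (n a) (init a) (M a) (h a)
    exact ((hc₀ a).seq (h1.seq h2)).mono (by simp [enc_nat])

end PolyFun

theorem polyTime_iff (f : List Bool → List Bool) :
    PolyTime f ↔ PolyFun fun x : Str => (⟨f x.bits⟩ : Str) := by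
  constructor
  · rintro ⟨c, p, h⟩
    refine PolyFun.of_program c (B := fun a => p.eval (size a)) (PolyBdd.size.eval p) fun a => ?_
    obtain ⟨s, T, hr, hT, hs⟩ := h a.bits
    exact ⟨s, ⟨T, hT, hr⟩, hs⟩
  · rintro ⟨c, B, ⟨p, hp⟩, h⟩
    refine ⟨c, p, fun x => ?_⟩
    obtain ⟨T, hT, hr⟩ := h ⟨x⟩
    exact ⟨_, T, hr, hT.trans (hp _), by simp [inputStore]⟩

open Code

namespace PolyFun

variable {α β γ σ : Type*} [Code α] [Code β] [Code γ] [Code σ]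

/-! ### Booleans, unary numbers, lists -/

@[fun_prop]
theorem not {f : α → Bool} (hf : PolyFun f) : PolyFun fun a => !f a := by
  have h := hf.cond (const false) (const true)
  refine h.of_enc fun a => ?_
  cases f a <;> rfl

@[fun_prop]
theorem and {f g : α → Bool} (hf : PolyFun f) (hg : PolyFun g) : PolyFun fun a => f a && g a := by
  refine (hf.cond hg (const false)).of_enc fun a => ?_
  cases f a <;> rfl

@[fun_prop]
theorem or {f g : α → Bool} (hf : PolyFun f) (hg : PolyFun g) : PolyFun fun a => f a || g a := by
  refine (hf.cond (const true) hg).of_enc fun a => ?_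
  cases f a <;> rfl

@[fun_prop]
theorem xor {f g : α → Bool} (hf : PolyFun f) (hg : PolyFun g) :
    PolyFun fun a => Bool.xor (f a) (g a) := by
  refine (hf.cond hg.not hg).of_enc fun a => ?_
  cases f a <;> cases g a <;> rfl

theorem isEmpty_enc : PolyFun fun a : α => (enc a).isEmpty := by
  refine of_program (Cmd.branch 0 (Cmd.push 0 true)
    (Cmd.seq (Cmd.clear 0) (Cmd.push 0 false)) (Cmd.seq (Cmd.clear 0) (Cmd.push 0 false)))
    (B := fun a => 2 * size a + 3)
    (((PolyBdd.const 2).mul PolyBdd.size).add (PolyBdd.const 3)) fun a => ?_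
  have hne : Halts (Cmd.seq (Cmd.clear 0) (Cmd.push 0 false)) (inputStore (enc a))
      (inputStore [false]) (2 * size a + 2) :=
    ((halts_clear_input _).seq (Halts.push 0 false _)).cast (by simp [size]) (by
      funext r; rcases r with _ | r <;> simp [inputStore])
  rcases h : enc a with _ | ⟨b, l⟩
  · exact ⟨_, (Halts.branch_empty rfl (Halts.push 0 true _)).mono (by omega),
      by simp [inputStore]⟩
  · rw [h] at hne
    refine ⟨inputStore [false], ?_, by simp [inputStore]⟩
    cases b
    · exact (Halts.branch_false rfl hne).mono (by omega)
    · exact (Halts.branch_true rfl hne).mono (by omega)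

@[fun_prop]
theorem list_isEmpty {l : α → List β} (hl : PolyFun l) : PolyFun fun a => (l a).isEmpty := by
  refine (isEmpty_enc.comp hl).of_enc fun a => ?_
  rcases l a with _ | ⟨b, t⟩
  · rfl
  · simp only [enc_cons, pairStr]
    rcases enc b with _ | ⟨c, u⟩ <;> rfl

@[fun_prop]
theorem list_cons {f : α → β} {l : α → List β} (hf : PolyFun f) (hl : PolyFun l) :
    PolyFun fun a => f a :: l a := (hf.mk hl).of_enc fun _ => rfl

theorem listCase {l : α → List β} {g : α → γ} {h : α → β → List β → γ} (hl : PolyFun l)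
    (hg : PolyFun g) (hh : PolyFun fun p : α × β × List β => h p.1 p.2.1 p.2.2) :
    PolyFun fun a => match l a with
      | [] => g a
      | b :: t => h a b t := by
  refine cases hl.list_isEmpty ?_ ?_
  · convert (val hg : PolyFun fun a : {a // (l a).isEmpty = true} => g a) using 2 with a
    have := a.2
    rw [List.isEmpty_iff] at this
    simp [this]
  · have hne : ∀ a : {a // (l a).isEmpty = false}, l a ≠ [] := fun a h => by
      have := a.2; simp [h] at this
    have hk : PolyFun fun a : {a // (l a).isEmpty = false} =>
        ((a : α), (l a).head (hne a), (l a).tail) := by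
      refine (val (id'.mk hl) : PolyFun fun a : {a // (l a).isEmpty = false} =>
        ((a : α), l a)).of_enc fun a => ?_
      rw [enc_pair, enc_pair, enc_pair, ← enc_cons, List.cons_head_tail]
    have key : ∀ (a : α) (t : List β) (ht : t ≠ []), (match (generalizing := false) t with
        | [] => g a
        | b :: t => h a b t) = h a (t.head ht) t.tail := by
      intro a t ht
      rcases t with _ | ⟨b, t⟩
      · exact absurd rfl ht
      · rfl
    convert hh.comp hk using 2 with a
    exact key _ _ _

@[fun_prop]
theorem list_tail {l : α → List β} (hl : PolyFun l) : PolyFun fun a => (l a).tail := by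
  refine (listCase (g := fun _ => []) (h := fun _ _ t => t) hl (by fun_prop)
    (by fun_prop)).of_enc fun a => ?_
  rcases l a with _ | ⟨b, t⟩ <;> rfl

@[fun_prop]
theorem list_headD {l : α → List β} {d : α → β} (hl : PolyFun l) (hd : PolyFun d) :
    PolyFun fun a => (l a).headD (d a) := by
  refine (listCase (g := d) (h := fun _ b _ => b) hl hd (by fun_prop)).of_enc fun a => ?_
  rcases l a with _ | ⟨b, t⟩ <;> rfl

theorem nat_succ : PolyFun fun n : ℕ => n + 1 :=
  of_program (Cmd.push 0 true) (PolyBdd.const 1) fun n =>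
    ⟨_, Halts.push 0 true _, by simp [inputStore, enc_nat, List.replicate_succ]⟩

@[fun_prop]
theorem nat_pred {n : α → ℕ} (hn : PolyFun n) : PolyFun fun a => (n a).pred := by
  refine comp (f := Nat.pred) (of_program (Cmd.pop 0) (PolyBdd.const 1) fun n =>
    ⟨_, Halts.pop 0 _, ?_⟩) hn
  simp [inputStore, enc_nat]

/-- The size of the code, in unary. -/
theorem size_fun : PolyFun fun a : α => QMA.size a := by
  refine of_program (Cmd.seq (Cmd.loop 0 (Cmd.seq (Cmd.pop 0) (Cmd.push 1 true))) (Cmd.move 1 0))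
    (B := fun a => 30 * size a + 30)
    (((PolyBdd.const 30).mul PolyBdd.size).add (PolyBdd.const 30)) fun a => ?_
  have loop : ∀ (u v : List Bool), Halts (Cmd.loop 0 (Cmd.seq (Cmd.pop 0) (Cmd.push 1 true)))
      (store₃ u v []) (store₃ [] (List.replicate u.length true ++ v) []) (3 * u.length + 1) := by
    intro u
    induction u with
    | nil => exact fun v => (Halts.loop_done rfl).cast (by simp) (by simp)
    | cons b u ih =>
      intro v
      have hb : Halts (Cmd.seq (Cmd.pop 0) (Cmd.push 1 true)) (store₃ (b :: u) v [])
          (store₃ u (true :: v) []) 2 :=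
        ((Halts.pop 0 _).seq (Halts.push 1 true _)).cast le_rfl (by
          funext r; rcases r with _ | _ | _ | r <;> simp [store₃])
      refine (Halts.loop_step (by simp [store₃]) hb (ih _)).cast (by simp; omega) ?_
      rw [List.length_cons, List.replicate_succ', List.append_assoc]
      rfl
  have h := loop (enc a) []
  rw [← inputStore_eq] at h
  refine ⟨_, (h.seq (halts_move (by decide) _)).mono ?_, ?_⟩
  · simp [store₃, size]; omega
  · simp [store₃, enc_nat, size]

/-- Iteration with a parameter. -/
theorem iterate' {n : α → ℕ} {init : α → σ} {f : α → σ → σ} (hn : PolyFun n) (hi : PolyFun init)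
    (hf : PolyFun fun p : α × σ => f p.1 p.2) {M : α → ℕ} (hM : PolyBdd M)
    (h : ∀ a, ∀ i ≤ n a, size ((f a)^[i] (init a)) ≤ M a) :
    PolyFun fun a => (f a)^[n a] (init a) := by
  have key : ∀ a i, (fun p : α × σ => (p.1, f p.1 p.2))^[i] (a, init a)
      = (a, (f a)^[i] (init a)) := by
    intro a i
    induction i with
    | zero => rfl
    | succ i ih => rw [Function.iterate_succ_apply', ih, Function.iterate_succ_apply']
  have := iterate (σ := α × σ) (step := fun p => (p.1, f p.1 p.2)) hn (id'.mk hi)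
    (prod_fst.mk hf) (M := fun a => 2 * size a + M a + 1)
    ((((PolyBdd.const 2).mul PolyBdd.size).add hM).add (PolyBdd.const 1)) (by
      intro a i hi
      rw [key, size_pair]
      have := h a i hi
      omega)
  simp only [key] at this
  exact this.snd

/-- Recursion over a list, as long as the intermediate results stay polynomially small. -/
theorem foldl {l : α → List β} {init : α → σ} {f : α → σ → β → σ} (hl : PolyFun l)
    (hi : PolyFun init) (hf : PolyFun fun p : α × σ × β => f p.1 p.2.1 p.2.2)
    {M : α → ℕ} (hM : PolyBdd M)
    (h : ∀ a i, size (((l a).take i).foldl (f a) (init a)) ≤ M a) :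
    PolyFun fun a => (l a).foldl (f a) (init a) := by
  let step : α → List β × σ → List β × σ := fun a p => match p.1 with
    | [] => p
    | b :: t => (t, f a p.2 b)
  have hstep : PolyFun fun p : α × List β × σ => step p.1 p.2 :=
    listCase (l := fun p : α × List β × σ => p.2.1) (g := fun p => p.2)
      (h := fun p b t => (t, f p.1 p.2.2 b)) (by fun_prop) (by fun_prop)
      ((snd (snd id')).mk
        (hf.comp (g := fun q : (α × List β × σ) × β × List β => (q.1.1, q.1.2.2, q.2.1))
          (by fun_prop)))
  have key : ∀ a i (t : List β) (s : σ),
      (step a)^[i] (t, s) = (t.drop i, (t.take i).foldl (f a) s) := by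
    intro a i
    induction i with
    | zero => intro t s; simp
    | succ i ih =>
      intro t s
      rw [Function.iterate_succ_apply]
      rcases t with _ | ⟨b, t⟩
      · change (step a)^[i] ([], s) = _
        rw [ih]; simp
      · change (step a)^[i] (t, f a s b) = _
        rw [ih]; simp
  have hsz := hl.size_bdd
  have := iterate' (σ := List β × σ) (f := step) (size_fun.comp hl) (hl.mk hi) hstep
    (M := fun a => 2 * size (l a) + M a + 1)
    ((((PolyBdd.const 2).mul hsz).add hM).add (PolyBdd.const 1)) (by
      intro a i _
      rw [key, size_pair]
      have h1 := h a i
      have h2 : size (l a) = size ((l a).take i) + size ((l a).drop i) := by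
        rw [← size_append, List.take_append_drop]
      omega)
  refine this.snd.of_enc fun a => ?_
  rw [key, List.take_of_length_le (length_le_size _)]

omit [Code β] in
theorem size_foldl_le {f : σ → β → σ} {l : List β} {s : σ} {B : ℕ}
    (h : ∀ s, ∀ b ∈ l, size (f s b) ≤ size s + B) :
    size (l.foldl f s) ≤ size s + l.length * B := by
  induction l generalizing s with
  | nil => simp
  | cons b l ih =>
    have h1 := ih (s := f s b) fun s c hc => h s c (List.mem_cons_of_mem _ hc)
    have h2 := h s b List.mem_cons_self
    simp only [List.foldl_cons, List.length_cons, add_mul]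
    omega

/-- Recursion over a list whose steps increase the size by a bounded amount. -/
theorem foldl_of_growth {l : α → List β} {init : α → σ} {f : α → σ → β → σ} (hl : PolyFun l)
    (hi : PolyFun init) (hf : PolyFun fun p : α × σ × β => f p.1 p.2.1 p.2.2)
    {B : α → ℕ} (hB : PolyBdd B) (h : ∀ a s, ∀ b ∈ l a, size (f a s b) ≤ size s + B a) :
    PolyFun fun a => (l a).foldl (f a) (init a) := by
  refine foldl hl hi hf (M := fun a => size (init a) + size (l a) * B a)
    (hi.size_bdd.add (hl.size_bdd.mul hB)) fun a i => ?_
  refine (size_foldl_le fun s b hb => h a s b (List.mem_of_mem_take hb)).trans ?_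
  have : ((l a).take i).length ≤ size (l a) := by
    have := length_le_size (l a)
    simp; omega
  gcongr

theorem iterate_of_growth {n : α → ℕ} {init : α → σ} {f : α → σ → σ} (hn : PolyFun n)
    (hi : PolyFun init) (hf : PolyFun fun p : α × σ => f p.1 p.2) {B : α → ℕ} (hB : PolyBdd B)
    (h : ∀ a s, size (f a s) ≤ size s + B a) :
    PolyFun fun a => (f a)^[n a] (init a) := by
  have key : ∀ a i, size ((f a)^[i] (init a)) ≤ size (init a) + i * B a := by
    intro a i
    induction i with
    | zero => simp
    | succ i ih =>
      rw [Function.iterate_succ_apply']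
      have := h a ((f a)^[i] (init a))
      rw [add_mul]
      omega
  have hns := hn.size_bdd
  simp only [size_nat] at hns
  refine iterate' hn hi hf (M := fun a => size (init a) + n a * B a)
    (hi.size_bdd.add (hns.mul hB)) fun a i hi => (key a i).trans ?_
  gcongr

@[fun_prop]
theorem list_reverse {l : α → List β} (hl : PolyFun l) : PolyFun fun a => (l a).reverse := by
  have hs := hl.size_bdd
  have := foldl_of_growth (init := fun _ => ([] : List β)) (f := fun _ s b => b :: s) hl
    (by fun_prop) (by fun_prop) (B := fun a => 2 * size (l a) + 1)
    (((PolyBdd.const 2).mul hs).add (PolyBdd.const 1)) (by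
      intro a s b hb
      have := size_le_of_mem hb
      simp only [size_cons]
      omega)
  refine this.of_enc fun a => ?_
  congr 1
  rw [List.foldl_flip_cons_eq_append', List.append_nil]

@[fun_prop]
theorem list_append {l l' : α → List β} (hl : PolyFun l) (hl' : PolyFun l') :
    PolyFun fun a => l a ++ l' a := by
  have hs := hl.size_bdd
  have := foldl_of_growth (init := l') (f := fun _ s b => b :: s) hl.list_reverse hl'
    (by fun_prop) (B := fun a => 2 * size (l a) + 1)
    (((PolyBdd.const 2).mul hs).add (PolyBdd.const 1)) (by
      intro a s b hb
      have := size_le_of_mem (List.mem_reverse.1 hb)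
      simp only [size_cons]
      omega)
  refine this.of_enc fun a => ?_
  congr 1
  rw [List.foldl_flip_cons_eq_append', List.reverse_reverse]

theorem size_bdd₂ {f : α → β → γ} {l : α → List β} (hf : PolyFun fun p : α × β => f p.1 p.2)
    (hl : PolyFun l) : ∃ B : α → ℕ, PolyBdd B ∧ ∀ a, ∀ b ∈ l a, size (f a b) ≤ B a := by
  obtain ⟨q, hq⟩ := hf.size_bdd
  refine ⟨fun a => q.eval (2 * size a + size (l a) + 1), ((((PolyBdd.const 2).mul
    PolyBdd.size).add hl.size_bdd).add (PolyBdd.const 1)).eval q, fun a b hb => ?_⟩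
  refine (hq (a, b)).trans (eval_mono q ?_)
  have := size_le_of_mem hb
  rw [size_pair]; omega

theorem list_flatMap {f : α → β → List γ} {l : α → List β} (hl : PolyFun l)
    (hf : PolyFun fun p : α × β => f p.1 p.2) : PolyFun fun a => (l a).flatMap (f a) := by
  obtain ⟨B, hB, h⟩ := size_bdd₂ hf hl
  have := foldl_of_growth (init := fun _ => ([] : List γ)) (f := fun a s b => s ++ f a b) hl
    (by fun_prop) ((fst (snd id')).list_append (hf.comp
      (g := fun p : α × List γ × β => (p.1, p.2.2)) (by fun_prop))) hB (by
      intro a s b hb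
      rw [size_append]
      have := h a b hb
      omega)
  refine this.of_enc fun a => ?_
  congr 1
  have : ∀ (t : List β) (s : List γ),
      t.foldl (fun s b => s ++ f a b) s = s ++ t.flatMap (f a) := by
    intro t
    induction t with
    | nil => simp
    | cons b t ih => intro s; simp [ih]
  simp [this]

theorem list_map {f : α → β → γ} {l : α → List β} (hl : PolyFun l)
    (hf : PolyFun fun p : α × β => f p.1 p.2) : PolyFun fun a => (l a).map (f a) := by
  have := list_flatMap (f := fun a b => [f a b]) hl (hf.list_cons (const []))
  refine this.of_enc fun a => ?_
  rw [← List.map_eq_flatMap]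

@[fun_prop]
theorem nat_add {m n : α → ℕ} (hm : PolyFun m) (hn : PolyFun n) :
    PolyFun fun a => m a + n a := by
  have := iterate_of_growth (f := fun _ k => k + 1) hn hm (nat_succ.comp (snd id'))
    (PolyBdd.const 1) (by intro a s; simp)
  refine this.of_enc fun a => ?_
  simp

@[fun_prop]
theorem nat_sub {m n : α → ℕ} (hm : PolyFun m) (hn : PolyFun n) :
    PolyFun fun a => m a - n a := by
  have := iterate_of_growth (f := fun _ k => k.pred) hn hm (by fun_prop)
    (PolyBdd.const 1) (by intro a s; simp; omega)
  refine this.of_enc fun a => ?_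
  rw [Nat.pred_iterate]

@[fun_prop]
theorem nat_mul {m n : α → ℕ} (hm : PolyFun m) (hn : PolyFun n) :
    PolyFun fun a => m a * n a := by
  have hms := hm.size_bdd
  have := iterate_of_growth (f := fun a k => k + m a) hn (const 0) (by fun_prop)
    hms (by intro a s; simp)
  refine this.of_enc fun a => ?_
  congr 1
  have : ∀ k, (fun k => k + m a)^[k] 0 = m a * k := by
    intro k
    induction k with
    | zero => simp
    | succ k ih => rw [Function.iterate_succ_apply', ih]; ring
  simpa using (this (n a)).symm

@[fun_prop]
theorem nat_isZero {n : α → ℕ} (hn : PolyFun n) : PolyFun fun a => (n a).beq 0 := by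
  refine (isEmpty_enc.comp hn).of_enc fun a => ?_
  rcases n a with _ | k <;> rfl

@[fun_prop]
theorem nat_ble {m n : α → ℕ} (hm : PolyFun m) (hn : PolyFun n) :
    PolyFun fun a => (m a).ble (n a) := by
  refine (hm.nat_sub hn).nat_isZero.of_enc fun a => ?_
  congr 1
  rw [Bool.eq_iff_iff]
  simp only [Nat.ble_eq, Nat.beq_eq]
  omega

@[fun_prop]
theorem nat_beq {m n : α → ℕ} (hm : PolyFun m) (hn : PolyFun n) :
    PolyFun fun a => (m a).beq (n a) := by
  refine ((hm.nat_ble hn).and (hn.nat_ble hm)).of_enc fun a => ?_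
  congr 1
  rw [Bool.eq_iff_iff]
  simp only [Nat.ble_eq, Nat.beq_eq, Bool.and_eq_true]
  omega

theorem nat_pow {m : α → ℕ} (hm : PolyFun m) (k : ℕ) : PolyFun fun a => m a ^ k := by
  induction k with
  | zero => simpa using const 1
  | succ k ih => simpa only [pow_succ] using ih.nat_mul hm

theorem poly_eval (p : Polynomial ℕ) {m : α → ℕ} (hm : PolyFun m) :
    PolyFun fun a => p.eval (m a) := by
  induction p using Polynomial.induction_on' with
  | add p q hp hq => simpa using hp.nat_add hq
  | monomial k c => simpa using (const c).nat_mul (hm.nat_pow k)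

@[fun_prop]
theorem list_length {l : α → List β} (hl : PolyFun l) : PolyFun fun a => (l a).length := by
  have := foldl_of_growth (init := fun _ => 0) (f := fun _ s _ => s + 1) hl
    (by fun_prop) (by fun_prop) (PolyBdd.const 1) (by intro a s b hb; simp)
  refine this.of_enc fun a => ?_
  simp

@[fun_prop]
theorem list_replicate {n : α → ℕ} {b : α → β} (hn : PolyFun n) (hb : PolyFun b) :
    PolyFun fun a => List.replicate (n a) (b a) := by
  have hbs := hb.size_bdd
  have := iterate_of_growth (f := fun a l => b a :: l) hn (const []) (by fun_prop)
    (((PolyBdd.const 2).mul hbs).add (PolyBdd.const 1))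
    (by intro a s; simp; omega)
  refine this.of_enc fun a => ?_
  congr 1
  have : ∀ k, (fun l => b a :: l)^[k] [] = List.replicate k (b a) := by
    intro k
    induction k with
    | zero => simp
    | succ k ih => rw [Function.iterate_succ_apply', ih]; rfl
  exact (this _).symm

@[fun_prop]
theorem list_range {n : α → ℕ} (hn : PolyFun n) : PolyFun fun a => List.range (n a) := by
  have key : ∀ k, (fun l : List ℕ => l ++ [l.length])^[k] [] = List.range k := by
    intro k
    induction k with
    | zero => rfl
    | succ k ih => rw [Function.iterate_succ_apply', ih, List.range_succ]; simp
  have hsz : ∀ k, size (List.range k) ≤ k * (2 * k + 1) := by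
    intro k
    induction k with
    | zero => simp
    | succ k ih =>
      rw [List.range_succ, size_append]
      simp
      nlinarith
  have hns := hn.size_bdd
  simp only [size_nat] at hns
  have := iterate' (f := fun (_ : α) (l : List ℕ) => l ++ [l.length]) hn (const []) (by fun_prop)
    (M := fun a => n a * (2 * n a + 1))
    (hns.mul (((PolyBdd.const 2).mul hns).add (PolyBdd.const 1)))
    (by
      intro a i hi
      rw [key]
      refine (hsz i).trans ?_
      gcongr)
  refine this.of_enc fun a => ?_
  rw [key]

@[fun_prop]
theorem list_drop {l : α → List β} {n : α → ℕ} (hl : PolyFun l) (hn : PolyFun n) :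
    PolyFun fun a => (l a).drop (n a) := by
  have := iterate_of_growth (f := fun (_ : α) (l : List β) => l.tail) hn hl (by fun_prop)
    (PolyBdd.const 0) (by intro a s; rcases s with _ | ⟨b, t⟩ <;> simp; omega)
  refine this.of_enc fun a => ?_
  congr 1
  have : ∀ k (t : List β), List.tail^[k] t = t.drop k := by
    intro k
    induction k with
    | zero => simp
    | succ k ih => intro t; rw [Function.iterate_succ_apply, ih, List.drop_tail]
  exact (this _ _).symm

/-! ### Conversions between bit strings and lists of bits -/

theorem str_cons : PolyFun fun p : Bool × Str => (⟨p.1 :: p.2.bits⟩ : Str) := by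
  refine of_program (Cmd.seq (Cmd.pop 0) (Cmd.branch 0 Cmd.skip
    (Cmd.seq (Cmd.pop 0) (Cmd.seq (Cmd.pop 0) (Cmd.push 0 false)))
    (Cmd.seq (Cmd.pop 0) (Cmd.seq (Cmd.pop 0) (Cmd.push 0 true)))))
    (PolyBdd.const 5) fun p => ?_
  obtain ⟨b, s⟩ := p
  have h1 : Halts (Cmd.pop 0) (inputStore (enc (b, s))) (inputStore (b :: false :: s.bits)) 1 :=
    (Halts.pop 0 _).cast le_rfl (by
      funext r; rcases r with _ | r <;> simp [inputStore, enc_pair])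
  have h2 : Halts (Cmd.seq (Cmd.pop 0) (Cmd.seq (Cmd.pop 0) (Cmd.push 0 b)))
      (inputStore (b :: false :: s.bits)) (inputStore (b :: s.bits)) 3 :=
    ((Halts.pop 0 _).seq ((Halts.pop 0 _).seq (Halts.push 0 b _))).cast le_rfl (by
      funext r; rcases r with _ | r <;> simp [inputStore])
  refine ⟨inputStore (b :: s.bits), h1.seq (B₂ := 4) ?_, by simp [inputStore]⟩
  cases b
  · exact Halts.branch_false rfl h2
  · exact Halts.branch_true rfl h2

theorem str_tail : PolyFun fun s : Str => (⟨s.bits.tail⟩ : Str) :=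
  of_program (Cmd.pop 0) (PolyBdd.const 1) fun s =>
    ⟨_, Halts.pop 0 _, by simp [inputStore]⟩

theorem str_head : PolyFun fun s : Str => s.bits.headD false := by
  refine of_program (Cmd.branch 0 (Cmd.push 0 false)
    (Cmd.seq (Cmd.clear 0) (Cmd.push 0 false)) (Cmd.seq (Cmd.clear 0) (Cmd.push 0 true)))
    (B := fun a => 2 * size a + 3)
    (((PolyBdd.const 2).mul PolyBdd.size).add (PolyBdd.const 3)) fun a => ?_
  have hne : ∀ b, Halts (Cmd.seq (Cmd.clear 0) (Cmd.push 0 b)) (inputStore (enc a))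
      (inputStore [b]) (2 * size a + 2) := fun b =>
    ((halts_clear_input _).seq (Halts.push 0 b _)).cast (by simp) (by
      funext r; rcases r with _ | r <;> simp [inputStore])
  rcases h : enc a with _ | ⟨b, l⟩
  · refine ⟨_, (Halts.branch_empty rfl (Halts.push 0 false _)).mono (by omega), ?_⟩
    rw [enc_str] at h
    simp [inputStore, h]
  · have hb := hne b
    rw [h] at hb
    rw [enc_str] at h
    refine ⟨inputStore [b], ?_, by simp [inputStore, h]⟩
    cases b
    · exact (Halts.branch_false rfl hb).mono (by omega)
    · exact (Halts.branch_true rfl hb).mono (by omega)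

theorem str_ofList : PolyFun fun l : List Bool => (⟨l⟩ : Str) := by
  have := foldl_of_growth (l := fun l : List Bool => l.reverse) (init := fun _ => (⟨[]⟩ : Str))
    (f := fun _ s b => ⟨b :: s.bits⟩) (by fun_prop) (by fun_prop)
    (str_cons.comp ((snd (snd id')).mk (fst (snd id')))) (PolyBdd.const 1) (by
      intro a s b hb; simp)
  refine this.of_enc fun l => ?_
  have : ∀ (l l' : List Bool), l.foldl (fun (s : Str) b => (⟨b :: s.bits⟩ : Str)) ⟨l'⟩
      = ⟨l.reverse ++ l'⟩ := by
    intro l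
    induction l with
    | nil => simp
    | cons b l ih => intro l'; simp [ih]
  rw [this]
  simp

theorem str_toList : PolyFun fun s : Str => s.bits := by
  have := iterate' (n := fun s : Str => size s) (init := fun s => (s, ([] : List Bool)))
    (f := fun _ p => ((⟨p.1.bits.tail⟩ : Str), p.1.bits.headD false :: p.2))
    size_fun (by fun_prop) ((str_tail.comp (fst (snd id'))).mk
      ((str_head.comp (fst (snd id'))).list_cons (snd (snd id'))))
    (M := fun s => 5 * size s + 1)
    (((PolyBdd.const 5).mul PolyBdd.size).add (PolyBdd.const 1)) (by
      intro a i
      suffices h : ∀ i (p : Str × List Bool), i ≤ size p.1 →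
          size ((fun p : Str × List Bool =>
            ((⟨p.1.bits.tail⟩ : Str), p.1.bits.headD false :: p.2))^[i] p) ≤ size p + 3 * i by
        intro hi
        have := h i (a, []) hi
        simp only [size_pair, size_nil] at this ⊢
        omega
      intro i
      induction i with
      | zero => intro p; simp
      | succ i ih =>
        rintro ⟨⟨_ | ⟨b, s⟩⟩, t⟩ hp
        · simp at hp
        · rw [Function.iterate_succ_apply]
          have := ih (⟨s⟩, b :: t) (by simpa using hp)
          simp at this ⊢
          omega)
  refine this.snd.list_reverse.of_enc fun s => ?_
  congr 1
  have : ∀ (l t : List Bool), ((fun p : Str × List Bool =>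
      ((⟨p.1.bits.tail⟩ : Str), p.1.bits.headD false :: p.2))^[l.length] (⟨l⟩, t)).2
      = l.reverse ++ t := by
    intro l
    induction l with
    | nil => simp
    | cons b l ih =>
      intro t
      rw [List.length_cons, Function.iterate_succ_apply]
      exact (ih _).trans (by simp)
  rw [size_str, this]
  simp

@[fun_prop]
theorem bits {f : α → Str} (hf : PolyFun f) : PolyFun fun a => (f a).bits := str_toList.comp hf

@[fun_prop]
theorem strMk {f : α → List Bool} (hf : PolyFun f) : PolyFun fun a => (⟨f a⟩ : Str) :=
  str_ofList.comp hf

end PolyFun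

theorem polyTime_iff' (f : List Bool → List Bool) :
    PolyTime f ↔ PolyFun fun x : Str => f x.bits := by
  rw [polyTime_iff]
  exact ⟨fun h => h.bits, fun h => h.strMk⟩

open Code

/-! ### Binary arithmetic -/

/-- The value of a list of binary digits, least significant digit first. -/
def bval : List Bool → ℕ
  | [] => 0
  | b :: l => b.toNat + 2 * bval l

theorem bval_append (l l' : List Bool) : bval (l ++ l') = bval l + 2 ^ l.length * bval l' := by
  induction l with
  | nil => simp [bval]
  | cons b l ih => simp [bval, ih, pow_succ]; ring

theorem bval_lt (l : List Bool) : bval l < 2 ^ l.length := by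
  induction l with
  | nil => simp [bval]
  | cons b l ih => cases b <;> simp [bval, pow_succ] <;> omega

theorem bval_replicate_true (n : ℕ) : bval (List.replicate n true) + 1 = 2 ^ n := by
  induction n with
  | zero => simp [bval]
  | succ n ih => simp [List.replicate_succ, bval, pow_succ]; omega

theorem bval_bits (n : ℕ) : bval n.bits = n := by
  induction n using Nat.binaryRec' with
  | zero => simp [bval]
  | bit b n h ih =>
    rw [Nat.bits_append_bit n b h, bval, ih, Nat.bit_val]
    omega

theorem bval_drop (l : List Bool) (k : ℕ) : bval (l.drop k) = bval l / 2 ^ k := by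
  induction k generalizing l with
  | zero => simp
  | succ k ih =>
    rcases l with _ | ⟨b, l⟩
    · simp [bval]
    · rw [List.drop_succ_cons, ih, pow_succ', ← Nat.div_div_eq_div_mul]
      congr 1
      cases b <;> simp [bval]; omega

/-- Digitwise processing of two numbers with a carry; `δ` maps two digits and the incoming carry
to a digit and the outgoing carry.  Missing digits are `0`. -/
def ripple (δ : Bool → Bool → Bool → Bool × Bool) :
    ℕ → List Bool → List Bool → Bool → List Bool × Bool
  | 0, _, _, c => ([], c)
  | k + 1, u, v, c =>
    let r := δ (u.headD false) (v.headD false) c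
    let p := ripple δ k u.tail v.tail r.2
    (r.1 :: p.1, p.2)

theorem length_ripple (δ : Bool → Bool → Bool → Bool × Bool) (k : ℕ) (u v : List Bool) (c : Bool) :
    (ripple δ k u v c).1.length = k := by
  induction k generalizing u v c with
  | zero => rfl
  | succ k ih => simp [ripple, ih]

theorem PolyFun.ripple {α : Type*} [Code α] {δ : Bool → Bool → Bool → Bool × Bool}
    (hδ : PolyFun fun p : Bool × Bool × Bool => δ p.1 p.2.1 p.2.2) {k : α → ℕ}
    {u v : α → List Bool} (hk : PolyFun k) (hu : PolyFun u) (hv : PolyFun v) :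
    PolyFun fun a => QMA.ripple δ (k a) (u a) (v a) false := by
  let step : List Bool × List Bool × Bool × List Bool → List Bool × List Bool × Bool × List Bool :=
    fun p => (p.1.tail, p.2.1.tail,
      (δ (p.1.headD false) (p.2.1.headD false) p.2.2.1).2,
      (δ (p.1.headD false) (p.2.1.headD false) p.2.2.1).1 :: p.2.2.2)
  have hδ' : PolyFun fun p : List Bool × List Bool × Bool × List Bool =>
      δ (p.1.headD false) (p.2.1.headD false) p.2.2.1 :=
    hδ.comp (g := fun p : List Bool × List Bool × Bool × List Bool =>
      (p.1.headD false, p.2.1.headD false, p.2.2.1)) (by fun_prop)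
  have hstep : PolyFun step := by
    change PolyFun fun p : List Bool × List Bool × Bool × List Bool => (p.1.tail, p.2.1.tail,
      (δ (p.1.headD false) (p.2.1.headD false) p.2.2.1).2,
      (δ (p.1.headD false) (p.2.1.headD false) p.2.2.1).1 :: p.2.2.2)
    have h1 := hδ'.fst
    have h2 := hδ'.snd
    fun_prop
  have h := PolyFun.iterate_of_growth (n := k) (init := fun a => (u a, v a, false, ([] : List Bool)))
    (f := fun _ => step) hk (by fun_prop) (hstep.comp (by fun_prop)) (PolyBdd.const 3) (by
      rintro _ ⟨_ | ⟨b, u⟩, _ | ⟨b', v⟩, c, out⟩ <;> simp [step] <;> omega)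
  have key : ∀ (k : ℕ) (u v : List Bool) (c : Bool) (out : List Bool),
      (step^[k] (u, v, c, out)).2.2
        = ((QMA.ripple δ k u v c).2, (QMA.ripple δ k u v c).1.reverse ++ out) := by
    intro k
    induction k with
    | zero => intros; rfl
    | succ k ih =>
      intro u v c out
      rw [Function.iterate_succ_apply]
      exact (ih _ _ _ _).trans (by simp [QMA.ripple])
  have h2 := h.snd.snd
  refine (h2.snd.list_reverse.mk h2.fst).of_enc fun a => ?_
  rw [key]
  simp

/-- A full adder. -/
def addDigit (a b c : Bool) : Bool × Bool :=
  (Bool.xor (Bool.xor a b) c, (a && b) || (c && Bool.xor a b))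

/-- A full subtractor. -/
def subDigit (a b c : Bool) : Bool × Bool :=
  (Bool.xor (Bool.xor a b) c, (!a && (b || c)) || (b && c))

theorem bval_headD_tail (u : List Bool) : bval u = (u.headD false).toNat + 2 * bval u.tail := by
  rcases u with _ | ⟨b, u⟩ <;> simp [bval]

theorem ripple_add (k : ℕ) (u v : List Bool) (c : Bool) (hu : u.length ≤ k) (hv : v.length ≤ k) :
    bval (ripple addDigit k u v c).1 + 2 ^ k * (ripple addDigit k u v c).2.toNat
      = bval u + bval v + c.toNat := by
  induction k generalizing u v c with
  | zero =>
    obtain rfl := List.length_eq_zero_iff.1 (Nat.le_zero.1 hu)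
    obtain rfl := List.length_eq_zero_iff.1 (Nat.le_zero.1 hv)
    simp [ripple, bval]
  | succ k ih =>
    have h := ih u.tail v.tail (addDigit (u.headD false) (v.headD false) c).2
      (by simp; omega) (by simp; omega)
    rw [bval_headD_tail u, bval_headD_tail v]
    simp only [ripple, bval, pow_succ]
    generalize u.headD false = a at *
    generalize v.headD false = b at *
    have : (addDigit a b c).1.toNat + 2 * (addDigit a b c).2.toNat
        = a.toNat + b.toNat + c.toNat := by
      cases a <;> cases b <;> cases c <;> rfl
    nlinarith

theorem ripple_sub (k : ℕ) (u v : List Bool) (c : Bool) (hu : u.length ≤ k) (hv : v.length ≤ k) :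
    bval (ripple subDigit k u v c).1 + bval v + c.toNat
      = bval u + 2 ^ k * (ripple subDigit k u v c).2.toNat := by
  induction k generalizing u v c with
  | zero =>
    obtain rfl := List.length_eq_zero_iff.1 (Nat.le_zero.1 hu)
    obtain rfl := List.length_eq_zero_iff.1 (Nat.le_zero.1 hv)
    simp [ripple, bval]
  | succ k ih =>
    have h := ih u.tail v.tail (subDigit (u.headD false) (v.headD false) c).2
      (by simp; omega) (by simp; omega)
    rw [bval_headD_tail u, bval_headD_tail v]
    simp only [ripple, bval, pow_succ]
    generalize u.headD false = a at *
    generalize v.headD false = b at *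
    have : (subDigit a b c).1.toNat + b.toNat + c.toNat
        = a.toNat + 2 * (subDigit a b c).2.toNat := by
      cases a <;> cases b <;> cases c <;> rfl
    nlinarith

/-- A common number of digits: the maximum of the two lengths. -/
def commonLength (u v : List Bool) : ℕ := u.length + (v.length - u.length)

/-- Addition of binary numbers. -/
def addBin (u v : List Bool) : List Bool :=
  (ripple addDigit (commonLength u v) u v false).1
    ++ [(ripple addDigit (commonLength u v) u v false).2]

/-- Comparison of binary numbers. -/
def ltBin (u v : List Bool) : Bool := (ripple subDigit (commonLength u v) u v false).2

/-- Subtraction of binary numbers (meaningful if the result is nonnegative). -/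
def subBin (u v : List Bool) : List Bool := (ripple subDigit (commonLength u v) u v false).1

/-- The absolute difference of binary numbers. -/
def distBin (u v : List Bool) : List Bool := bif ltBin u v then subBin v u else subBin u v

/-- Multiplication of binary numbers. -/
def mulBin (u v : List Bool) : List Bool :=
  u.reverse.foldl (fun acc b => bif b then addBin (false :: acc) v else false :: acc) []

theorem bval_addBin (u v : List Bool) : bval (addBin u v) = bval u + bval v := by
  have h := ripple_add (commonLength u v) u v false (by simp [commonLength])
    (by simp only [commonLength]; omega)
  rw [addBin, bval_append, length_ripple]
  simpa [bval] using h

theorem length_addBin (u v : List Bool) : (addBin u v).length = max u.length v.length + 1 := by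
  simp only [addBin, List.length_append, length_ripple, commonLength, List.length_singleton]
  omega

theorem ltBin_iff (u v : List Bool) : ltBin u v = true ↔ bval u < bval v := by
  have h := ripple_sub (commonLength u v) u v false (by simp [commonLength])
    (by simp only [commonLength]; omega)
  have hl := bval_lt (ripple subDigit (commonLength u v) u v false).1
  rw [length_ripple] at hl
  simp only [ltBin]
  cases hc : (ripple subDigit (commonLength u v) u v false).2
  · simp [hc] at h ⊢; omega
  · simp [hc] at h ⊢; omega

theorem bval_subBin {u v : List Bool} (huv : bval v ≤ bval u) :
    bval (subBin u v) = bval u - bval v := by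
  have h := ripple_sub (commonLength u v) u v false (by simp [commonLength])
    (by simp only [commonLength]; omega)
  have hn : (ripple subDigit (commonLength u v) u v false).2 = false := by
    have := (ltBin_iff u v).not.2 (by omega)
    simpa [ltBin] using this
  simp only [hn, Bool.toNat_false] at h
  simp only [subBin]
  omega

theorem length_subBin (u v : List Bool) : (subBin u v).length = max u.length v.length := by
  simp only [subBin, length_ripple, commonLength]
  omega

theorem bval_distBin (u v : List Bool) :
    (bval (distBin u v) : ℤ) = |(bval u : ℤ) - bval v| := by
  unfold distBin
  cases h : ltBin u v
  · have h' : bval v ≤ bval u := by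
      by_contra hlt
      rw [(ltBin_iff u v).2 (by omega)] at h
      cases h
    rw [cond_false, bval_subBin h', abs_of_nonneg (by omega)]
    omega
  · have h' := (ltBin_iff u v).1 h
    rw [cond_true, bval_subBin h'.le, abs_of_neg (by omega)]
    omega

theorem length_distBin (u v : List Bool) : (distBin u v).length = max u.length v.length := by
  unfold distBin
  cases ltBin u v <;> simp [length_subBin, max_comm]

theorem bval_mulBin (u v : List Bool) : bval (mulBin u v) = bval u * bval v := by
  induction u with
  | nil => simp [mulBin, bval]
  | cons b u ih =>
    have : mulBin (b :: u) v = bif b then addBin (false :: mulBin u v) v else false :: mulBin u v := by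
      simp [mulBin]
    rw [this]
    cases b
    · simp [bval, ih]; ring
    · simp [bval_addBin, bval, ih]; ring

theorem length_mul_fold (w v acc : List Bool) (n : ℕ) (h : acc.length ≤ v.length + n) :
    (w.foldl (fun acc b => bif b then addBin (false :: acc) v else false :: acc) acc).length
      ≤ v.length + (n + 2 * w.length) := by
  induction w generalizing acc n with
  | nil => simpa using h
  | cons b w ih =>
    have := ih (bif b then addBin (false :: acc) v else false :: acc) (n + 2) (by
      cases b
      · simp; omega
      · simp [length_addBin]; omega)
    simp only [List.foldl_cons, List.length_cons]
    omega

theorem length_mulBin (u v : List Bool) : (mulBin u v).length ≤ v.length + 2 * u.length := by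
  simpa [mulBin] using length_mul_fold u.reverse v [] 0 (by simp)

namespace PolyFun

variable {α : Type*} [Code α] {u v : α → List Bool}

theorem addDigit_fun : PolyFun fun p : Bool × Bool × Bool => addDigit p.1 p.2.1 p.2.2 := by
  unfold addDigit; fun_prop

theorem subDigit_fun : PolyFun fun p : Bool × Bool × Bool => subDigit p.1 p.2.1 p.2.2 := by
  unfold subDigit; fun_prop

@[fun_prop]
theorem commonLength_fun (hu : PolyFun u) (hv : PolyFun v) :
    PolyFun fun a => commonLength (u a) (v a) := by
  unfold commonLength; fun_prop

@[fun_prop]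
theorem addBin_fun (hu : PolyFun u) (hv : PolyFun v) : PolyFun fun a => addBin (u a) (v a) := by
  have h := ripple addDigit_fun (hu.commonLength_fun hv) hu hv
  unfold addBin; fun_prop

@[fun_prop]
theorem ltBin_fun (hu : PolyFun u) (hv : PolyFun v) : PolyFun fun a => ltBin (u a) (v a) :=
  (ripple subDigit_fun (hu.commonLength_fun hv) hu hv).snd

@[fun_prop]
theorem subBin_fun (hu : PolyFun u) (hv : PolyFun v) : PolyFun fun a => subBin (u a) (v a) :=
  (ripple subDigit_fun (hu.commonLength_fun hv) hu hv).fst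

@[fun_prop]
theorem distBin_fun (hu : PolyFun u) (hv : PolyFun v) : PolyFun fun a => distBin (u a) (v a) := by
  unfold distBin; fun_prop

@[fun_prop]
theorem mulBin_fun (hu : PolyFun u) (hv : PolyFun v) : PolyFun fun a => mulBin (u a) (v a) := by
  have hus := hu.size_bdd
  have hvs := hv.size_bdd
  refine foldl (f := fun a acc b => bif b then addBin (false :: acc) (v a) else false :: acc)
    (by fun_prop) (by fun_prop) (by fun_prop) (M := fun a => 3 * (size (v a) + 2 * size (u a)))
    ((PolyBdd.const 3).mul (hvs.add ((PolyBdd.const 2).mul hus))) fun a i => ?_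
  rw [size_listBool, size_listBool, size_listBool]
  have := length_mul_fold ((u a).reverse.take i) (v a) [] 0 (by simp)
  have h2 : ((u a).reverse.take i).length ≤ (u a).length := by simp
  omega

/-- The unary binary logarithm: the pair of the largest `i` with `2 ^ i ≤ n` and `2 ^ i`. -/
def logStep (n : ℕ) (p : ℕ × ℕ) : ℕ × ℕ := bif (p.2 + p.2).ble n then (p.1 + 1, p.2 + p.2) else p

end PolyFun

theorem logStep_iterate (n : ℕ) (hn : 1 ≤ n) (i : ℕ) :
    (PolyFun.logStep n)^[i] (0, 1) = (min i (Nat.log 2 n), 2 ^ min i (Nat.log 2 n)) := by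
  induction i with
  | zero => simp
  | succ i ih =>
    rw [Function.iterate_succ_apply', ih, PolyFun.logStep]
    have h1 : Nat.ble (2 ^ min i (Nat.log 2 n) + 2 ^ min i (Nat.log 2 n)) n
        = decide (i < Nat.log 2 n) := by
      rw [Bool.eq_iff_iff, Nat.ble_eq, decide_eq_true_iff, ← two_mul, ← pow_succ',
        ← Nat.le_log_iff_pow_le (by norm_num) (by omega)]
      omega
    simp only [h1]
    by_cases h : i < Nat.log 2 n
    · rw [decide_eq_true h, cond_true, min_eq_left h.le, min_eq_left h, ← two_mul, ← pow_succ']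
    · rw [decide_eq_false h, cond_false, min_eq_right (by omega), min_eq_right (by omega)]

theorem PolyFun.nat_log {α : Type*} [Code α] {n : α → ℕ} (hn : PolyFun n) (h1 : ∀ a, 1 ≤ n a) :
    PolyFun fun a => Nat.log 2 (n a) := by
  have hns := hn.size_bdd
  simp only [size_nat] at hns
  have hle : ∀ a i, 2 ^ min i (Nat.log 2 (n a)) ≤ n a := fun a i =>
    (Nat.pow_le_pow_right (by norm_num) (min_le_right _ _)).trans
      (Nat.pow_log_le_self 2 (by have := h1 a; omega))
  have hlog : ∀ a, Nat.log 2 (n a) ≤ n a := fun a => Nat.log_le_self _ _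
  have := iterate' (f := fun a => logStep (n a)) hn (const (0, 1)) (by unfold logStep; fun_prop)
    (M := fun a => 3 * n a + 1) (((PolyBdd.const 3).mul hns).add (PolyBdd.const 1)) (by
      intro a i _
      rw [logStep_iterate _ (h1 a)]
      have := hle a i
      have := hlog a
      simp only [size_pair, size_nat]
      omega)
  refine this.fst.of_enc fun a => ?_
  rw [logStep_iterate _ (h1 a), min_eq_right (hlog a)]

/-! ### Reading rational numbers -/

/-- One step of reading a sequence of binary codes: the state consists of a flag that says whether
a digit is expected, the digits of the current number, and the list of the numbers read. -/
def readBinStep (s : Bool × List Bool × List (List Bool)) (c : Bool) :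
    Bool × List Bool × List (List Bool) :=
  bif s.1 then (false, c :: s.2.1, s.2.2)
  else bif c then (true, s.2) else (false, [], s.2.1.reverse :: s.2.2)

/-- The numbers (lists of digits) in a sequence of binary codes, in reverse order. -/
def readBin (l : List Bool) : List (List Bool) := (l.foldl readBinStep (false, [], [])).2.2

theorem foldl_readBinStep (u cur : List Bool) (ls : List (List Bool)) (k : List Bool) :
    (u.flatMap (fun b => [true, b]) ++ [false] ++ k).foldl readBinStep (false, cur, ls)
      = k.foldl readBinStep (false, [], (cur.reverse ++ u) :: ls) := by
  induction u generalizing cur with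
  | nil => simp [readBinStep]
  | cons b u ih =>
    exact (ih (b :: cur)).trans (by simp)

theorem readBin_encodeRat (q : ℚ) : readBin (encodeRat q) = [q.den.bits, q.num.natAbs.bits] := by
  unfold readBin encodeRat binary
  rw [foldl_readBinStep, ← List.append_nil (List.flatMap _ _ ++ [false]), foldl_readBinStep]
  simp

theorem PolyFun.readBin_fun : PolyFun readBin := by
  unfold readBin
  have := foldl_of_growth (l := fun l : List Bool => l)
    (init := fun _ => (false, ([] : List Bool), ([] : List (List Bool))))
    (f := fun _ => readBinStep) (by fun_prop) (by fun_prop)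
    (by unfold readBinStep; fun_prop) (PolyBdd.const 7) (by
      rintro _ ⟨e, cur, ls⟩ c _
      cases e <;> cases c <;> simp [readBinStep, size_reverse] <;> omega)
  exact this.snd.snd

open Code

/-! ### The binary digits of an angle from the square of its cosine -/

/-- One step of the digit computation: from `cos² (π x)` as a fraction `N / D` and the digits of
`x` found so far (least significant first), compute `cos² (2 π x) = (2 N - D)² / D²` and the
next digit.  The state is `(N, D, digits)`.  The next digit differs from the last one if and only
if `cos² (π x) < 1 / 2`, or `cos² (π x) = 1 / 2` and the last digit is `0`. -/
def angleStep (s : List Bool × List Bool × List Bool) : List Bool × List Bool × List Bool :=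
  (mulBin (distBin (false :: s.1) s.2.1) (distBin (false :: s.1) s.2.1), mulBin s.2.1 s.2.1,
    Bool.xor (s.2.2.headD false) (ltBin (false :: s.1) s.2.1 ||
      (!ltBin s.2.1 (false :: s.1) && !s.2.2.headD false)) :: s.2.2)

/-- The first `n + 1` binary digits of `arccos √(N / D) / π`. -/
def angleDigits (n : ℕ) (N D : List Bool) : List Bool := (angleStep^[n] (N, D, [false])).2.2

/-- The threshold for `t`-bit phases: the digits of the angle, cut to `t` digits or extended
by digits `1`. -/
def threshold (t n : ℕ) (N D : List Bool) : List Bool :=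
  (List.replicate t true ++ angleDigits n N D).drop (angleDigits n N D).length

theorem length_angleStep (s : List Bool × List Bool × List Bool) (L : ℕ)
    (h₁ : s.1.length + 1 ≤ L) (h₂ : s.2.1.length + 1 ≤ L) :
    (angleStep s).1.length + 1 ≤ 4 * L ∧ (angleStep s).2.1.length + 1 ≤ 4 * L ∧
      (angleStep s).2.2.length = s.2.2.length + 1 := by
  have hd := length_distBin (false :: s.1) s.2.1
  have h3 := length_mulBin (distBin (false :: s.1) s.2.1) (distBin (false :: s.1) s.2.1)
  have h4 := length_mulBin s.2.1 s.2.1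
  rw [List.length_cons] at hd
  refine ⟨?_, ?_, by simp [angleStep]⟩ <;> simp only [angleStep] <;> omega

theorem length_angleStep_iterate (n : ℕ) (N D : List Bool) :
    (angleStep^[n] (N, D, [false])).1.length + 1 ≤ 4 ^ n * (N.length + D.length + 1) ∧
    (angleStep^[n] (N, D, [false])).2.1.length + 1 ≤ 4 ^ n * (N.length + D.length + 1) ∧
    (angleStep^[n] (N, D, [false])).2.2.length = n + 1 := by
  induction n with
  | zero => simp
  | succ n ih =>
    rw [Function.iterate_succ_apply', pow_succ', mul_assoc, ← ih.2.2]
    exact length_angleStep _ _ ih.1 ih.2.1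

theorem length_angleDigits (n : ℕ) (N D : List Bool) : (angleDigits n N D).length = n + 1 :=
  (length_angleStep_iterate n N D).2.2

theorem length_threshold (t n : ℕ) (N D : List Bool) : (threshold t n N D).length = t := by
  simp [threshold]

theorem PolyFun.threshold_fun {α : Type*} [Code α] {t n : α → ℕ} {N D : α → List Bool}
    (ht : PolyFun t) (hn : PolyFun n) (hN : PolyFun N) (hD : PolyFun D)
    (h2 : PolyBdd fun a => 2 ^ n a) : PolyFun fun a => threshold (t a) (n a) (N a) (D a) := by
  have hNs := hN.size_bdd
  have hDs := hD.size_bdd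
  have hns := hn.size_bdd
  simp only [size_nat] at hns
  have hA : PolyFun fun a => angleDigits (n a) (N a) (D a) := by
    refine PolyFun.snd (PolyFun.snd (iterate (step := angleStep) hn
      (init := fun a => (N a, D a, [false])) (by fun_prop) (by unfold angleStep; fun_prop)
      (M := fun a => 12 * (2 ^ n a * 2 ^ n a * (size (N a) + size (D a) + 1)) + 3 * (n a + 1) + 2)
      ?_ fun a i hi => ?_))
    · exact (((PolyBdd.const 12).mul ((h2.mul h2).mul ((hNs.add hDs).add (PolyBdd.const 1)))).add
        ((PolyBdd.const 3).mul (hns.add (PolyBdd.const 1)))).add (PolyBdd.const 2)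
    · obtain ⟨h1, h2, h3⟩ := length_angleStep_iterate i (N a) (D a)
      have h4 : 4 ^ i * ((N a).length + (D a).length + 1)
          ≤ 2 ^ n a * 2 ^ n a * (size (N a) + size (D a) + 1) := by
        have : 4 ^ i ≤ 2 ^ n a * 2 ^ n a := by
          rw [← mul_pow]; exact Nat.pow_le_pow_right (by norm_num) hi
        refine Nat.mul_le_mul this ?_
        have := length_le_size (N a)
        have := length_le_size (D a)
        omega
      rcases hs : angleStep^[i] (N a, D a, [false]) with ⟨x, y, z⟩
      rw [hs] at h1 h2 h3
      simp only [size_pair, size_listBool] at *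
      omega
  unfold threshold; fun_prop

section
open Real

/-- The squared cosine of half the angle `π (F + δ)` depends on the integer `F` only through its
parity. -/
theorem cos_sq_half_add (F : ℕ) (δ : ℝ) :
    cos (π * ((F + δ) / 2)) ^ 2 = if F % 2 = 0 then cos (π * (δ / 2)) ^ 2
      else 1 - cos (π * (δ / 2)) ^ 2 := by
  have h2 : ∀ x : ℝ, cos x ^ 2 = 1 / 2 + cos (2 * x) / 2 := Real.cos_sq
  rw [h2, h2 (π * (δ / 2))]
  have e1 : 2 * (π * ((F + δ) / 2)) = π * δ + F * π := by ring
  have e2 : 2 * (π * (δ / 2)) = π * δ := by ring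
  rw [e1, e2]
  rcases Nat.even_or_odd F with h | h
  · rw [if_pos (Nat.even_iff.1 h), Real.cos_add_nat_mul_pi, h.neg_one_pow]; ring
  · rw [if_neg (by rw [Nat.odd_iff] at h; omega), Real.cos_add_nat_mul_pi, h.neg_one_pow]; ring

theorem cos_sq_le_half_iff {δ : ℝ} (h0 : 0 ≤ δ) (h1 : δ < 1) :
    (cos (π * (δ / 2)) ^ 2 ≤ 1 / 2 ↔ 1 / 2 ≤ δ) ∧ (cos (π * (δ / 2)) ^ 2 < 1 / 2 ↔ 1 / 2 < δ) := by
  have e : cos (π * (δ / 2)) ^ 2 = 1 / 2 + cos (π * δ) / 2 := by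
    rw [Real.cos_sq]; congr 3; ring
  have hpi := Real.pi_pos
  have hneg : 1 / 2 < δ → cos (π * δ) < 0 := fun h =>
    Real.cos_neg_of_pi_div_two_lt_of_lt (by nlinarith) (by nlinarith)
  have hpos : δ < 1 / 2 → 0 < cos (π * δ) := fun h =>
    Real.cos_pos_of_mem_Ioo ⟨by nlinarith, by nlinarith⟩
  have heq : δ = 1 / 2 → cos (π * δ) = 0 := fun h => by
    rw [h, mul_one_div, Real.cos_pi_div_two]
  rw [e]
  rcases lt_trichotomy δ (1 / 2) with h | h | h
  · have := hpos h
    constructor <;> constructor <;> intro <;> linarith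
  · have := heq h
    constructor <;> constructor <;> intro <;> linarith
  · have := hneg h
    constructor <;> constructor <;> intro <;> linarith

/-- The computed digits are those of the angle: after `n` steps the digits represent
`⌊2 ^ (n + 1) φ⌋`. -/
theorem angleStep_spec (φ : ℝ) (h0 : 0 ≤ φ) (h1 : φ < 1 / 2) (N D : List Bool)
    (hD : 0 < bval D) (hφ : cos (π * φ) ^ 2 = bval N / bval D) (n : ℕ) :
    let s := angleStep^[n] (N, D, [false])
    0 < bval s.2.1 ∧ cos (π * (2 ^ n * φ)) ^ 2 = bval s.1 / bval s.2.1 ∧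
      (bval s.2.2 : ℝ) ≤ 2 ^ (n + 1) * φ ∧ 2 ^ (n + 1) * φ < bval s.2.2 + 1 := by
  induction n with
  | zero =>
    refine ⟨hD, by simpa using hφ, ?_, ?_⟩
    · simp [bval]; linarith
    · simp [bval]; linarith
  | succ n ih =>
    simp only [Function.iterate_succ_apply'] at ih ⊢
    generalize angleStep^[n] (N, D, [false]) = s at *
    obtain ⟨N', D', l⟩ := s
    obtain ⟨hD', hc, hl, hu⟩ := ih
    dsimp only at *
    have hDr : (0 : ℝ) < bval D' := by exact_mod_cast hD'
    have hdist : (bval (distBin (false :: N') D') : ℝ) = |2 * (bval N' : ℝ) - bval D'| := by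
      have := bval_distBin (false :: N') D'
      have h' : ((bval (distBin (false :: N') D') : ℤ) : ℝ)
          = ((|(bval (false :: N') : ℤ) - bval D'| : ℤ) : ℝ) := by rw [this]
      simpa [bval] using h'
    refine ⟨by simp only [angleStep, bval_mulBin]; positivity, ?_, ?_⟩
    · simp only [angleStep, bval_mulBin, Nat.cast_mul, hdist]
      rw [abs_mul_abs_self]
      have e : π * (2 ^ (n + 1) * φ) = 2 * (π * (2 ^ n * φ)) := by ring
      rw [e, Real.cos_two_mul, hc]
      field_simp
    · obtain ⟨δ, hδ⟩ : ∃ δ : ℝ, 2 ^ (n + 1) * φ = bval l + δ := ⟨_, (add_sub_cancel _ _).symm⟩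
      have hδ0 : 0 ≤ δ := by linarith
      have hδ1 : δ < 1 := by linarith
      have e : (2 : ℝ) ^ n * φ = (bval l + δ) / 2 := by rw [← hδ]; ring
      rw [e, cos_sq_half_add] at hc
      obtain ⟨k1, k2⟩ := cos_sq_le_half_iff hδ0 hδ1
      have hlt : ltBin (false :: N') D' = true ↔ (bval N' : ℝ) / bval D' < 1 / 2 := by
        rw [ltBin_iff, div_lt_div_iff₀ hDr (by norm_num), bval]
        simp only [Bool.toNat_false, zero_add, one_mul]
        rw [← @Nat.cast_lt ℝ]
        push_cast
        rw [mul_comm]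
      have hgt : ltBin D' (false :: N') = true ↔ (1 : ℝ) / 2 < (bval N' : ℝ) / bval D' := by
        rw [ltBin_iff, div_lt_div_iff₀ (by norm_num) hDr, bval]
        simp only [Bool.toNat_false, zero_add, one_mul]
        rw [← @Nat.cast_lt ℝ]
        push_cast
        rw [mul_comm (2 : ℝ)]
      have hdigit : (Bool.xor (l.headD false) (ltBin (false :: N') D' ||
          (!ltBin D' (false :: N') && !l.headD false))) = decide (1 / 2 ≤ δ) := by
        have hmod : (bval l % 2 = 0) ↔ l.headD false = false := by
          rw [bval_headD_tail l]
          cases l.headD false <;> simp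
        rw [← hc] at hlt hgt
        cases hb : l.headD false
        · rw [if_pos (hmod.2 hb)] at hlt hgt
          rw [Bool.eq_iff_iff]
          simp only [Bool.false_xor, Bool.or_eq_true, Bool.and_eq_true, Bool.not_eq_true',
            decide_eq_true_eq, Bool.not_false, and_true]
          rw [← Bool.not_eq_true, hlt, hgt, ← k1, not_lt]
          constructor
          · rintro (h | h)
            · exact h.le
            · exact h
          · exact Or.inr
        · rw [if_neg (by rw [hmod, hb]; simp)] at hlt hgt
          rw [Bool.eq_iff_iff]
          simp only [Bool.true_xor, Bool.not_true, Bool.and_false, Bool.or_false,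
            Bool.not_eq_true', decide_eq_true_eq]
          rw [← Bool.not_eq_true, hlt, ← k1]
          constructor <;> intro h <;> linarith
      have hval : bval (angleStep (N', D', l)).2.2
          = (decide (1 / 2 ≤ δ)).toNat + 2 * bval l := by
        simp only [angleStep, hdigit, bval]
      have e' : (2 : ℝ) ^ (n + 1 + 1) * φ = 2 * bval l + 2 * δ := by
        rw [pow_succ', mul_assoc, hδ]; ring
      rw [hval, e']
      by_cases h : 1 / 2 ≤ δ
      · simp only [h, decide_true, Bool.toNat_true]
        push_cast
        constructor <;> linarith
      · simp only [h, decide_false, Bool.toNat_false]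
        push_cast
        constructor <;> linarith

/-- The angle `arccos √p / π`. -/
noncomputable def angle (p : ℝ) : ℝ := arccos (√p) / π

theorem angle_nonneg (p : ℝ) : 0 ≤ angle p := div_nonneg (arccos_nonneg _) pi_pos.le

theorem angle_le_half (p : ℝ) : angle p ≤ 1 / 2 := by
  rw [angle, div_le_iff₀ pi_pos]
  have := arccos_le_pi_div_two.2 (sqrt_nonneg p)
  linarith

theorem angle_lt_half {p : ℝ} (hp : 0 < p) : angle p < 1 / 2 := by
  rw [angle, div_lt_iff₀ pi_pos]
  have := arccos_lt_pi_div_two.2 (sqrt_pos.2 hp)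
  linarith

theorem angle_anti {p q : ℝ} (h : p ≤ q) : angle q ≤ angle p := by
  unfold angle
  gcongr

theorem cos_sq_angle {p : ℝ} (h0 : 0 ≤ p) (h1 : p ≤ 1) : cos (π * angle p) ^ 2 = p := by
  rw [angle, mul_div_cancel₀ _ pi_ne_zero, cos_arccos (by have := sqrt_nonneg p; linarith)
    (sqrt_le_one.2 h1), sq_sqrt h0]

theorem bval_threshold (t n : ℕ) (N D : List Bool) :
    bval (threshold t n N D) = if t ≤ n + 1
      then bval (angleDigits n N D) / 2 ^ (n + 1 - t)
      else 2 ^ (t - (n + 1)) * (bval (angleDigits n N D) + 1) - 1 := by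
  have hl := length_angleDigits n N D
  rw [threshold, hl]
  split_ifs with h
  · rw [List.drop_append, List.drop_of_length_le (by simpa using h), List.nil_append,
      List.length_replicate, bval_drop]
  · rw [List.drop_append_of_le_length (by simp; omega), List.drop_replicate, bval_append,
      List.length_replicate, mul_add, mul_one]
    have := bval_replicate_true (t - (n + 1))
    omega

theorem angleDigits_spec {a : ℝ} (ha0 : 0 < a) (ha1 : a ≤ 1) (N D : List Bool)
    (hD : 0 < bval D) (ha : a = bval N / bval D) (n : ℕ) :
    (bval (angleDigits n N D) : ℝ) ≤ 2 ^ (n + 1) * angle a ∧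
      2 ^ (n + 1) * angle a < bval (angleDigits n N D) + 1 :=
  (angleStep_spec (angle a) (angle_nonneg a) (angle_lt_half ha0) N D hD
    (by rw [cos_sq_angle ha0.le ha1, ha]) n).2.2

/-- The phases that belong to probabilities at least `a` do not exceed the threshold. -/
theorem le_threshold {a : ℝ} (ha0 : 0 < a) (ha1 : a ≤ 1) (N D : List Bool)
    (hD : 0 < bval D) (ha : a = bval N / bval D) (n t k : ℕ) (hk : (k : ℝ) / 2 ^ t ≤ angle a) :
    k ≤ bval (threshold t n N D) := by
  obtain ⟨-, h2⟩ := angleDigits_spec ha0 ha1 N D hD ha n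
  rw [div_le_iff₀ (by positivity)] at hk
  rw [bval_threshold]
  split_ifs with h
  · rw [Nat.le_div_iff_mul_le (by positivity)]
    have : ((k * 2 ^ (n + 1 - t) : ℕ) : ℝ) < ((bval (angleDigits n N D) + 1 : ℕ) : ℝ) := by
      push_cast
      calc (k : ℝ) * 2 ^ (n + 1 - t) ≤ angle a * 2 ^ t * 2 ^ (n + 1 - t) := by gcongr
        _ = 2 ^ (n + 1) * angle a := by
          rw [mul_assoc, ← pow_add, Nat.add_sub_cancel' h, mul_comm]
        _ < _ := h2
    have := Nat.cast_lt.1 this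
    omega
  · have : (k : ℝ) < ((2 ^ (t - (n + 1)) * (bval (angleDigits n N D) + 1) : ℕ) : ℝ) := by
      push_cast
      calc (k : ℝ) ≤ angle a * 2 ^ t := hk
        _ = 2 ^ (t - (n + 1)) * (2 ^ (n + 1) * angle a) := by
          rw [← mul_assoc, ← pow_add, Nat.sub_add_cancel (by omega), mul_comm]
        _ < _ := by gcongr
    have := Nat.cast_lt.1 this
    omega

/-- The phases up to the threshold exceed the angle of `a` only by the precision of the computation. -/
theorem le_of_le_threshold {a : ℝ} (ha0 : 0 < a) (ha1 : a ≤ 1) (N D : List Bool)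
    (hD : 0 < bval D) (ha : a = bval N / bval D) (n t k : ℕ)
    (hk : k ≤ bval (threshold t n N D)) : (k : ℝ) / 2 ^ t ≤ angle a + 1 / 2 ^ (n + 1) := by
  obtain ⟨h1, -⟩ := angleDigits_spec ha0 ha1 N D hD ha n
  rw [bval_threshold] at hk
  rw [div_le_iff₀ (by positivity)]
  split_ifs at hk with h
  · rw [Nat.le_div_iff_mul_le (by positivity)] at hk
    have hk' : (k : ℝ) * 2 ^ (n + 1 - t) ≤ bval (angleDigits n N D) := by exact_mod_cast hk
    have h3 : (k : ℝ) * 2 ^ (n + 1 - t) ≤ (angle a * 2 ^ t) * 2 ^ (n + 1 - t) := by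
      rw [mul_assoc, ← pow_add, Nat.add_sub_cancel' h, mul_comm (angle a)]
      linarith
    have h4 := le_of_mul_le_mul_right h3 (by positivity)
    have : (0 : ℝ) ≤ 1 / 2 ^ (n + 1) * 2 ^ t := by positivity
    nlinarith
  · have hk' : (k : ℝ) ≤ 2 ^ (t - (n + 1)) * (bval (angleDigits n N D) + 1) := by
      have : k ≤ 2 ^ (t - (n + 1)) * (bval (angleDigits n N D) + 1) := by omega
      exact_mod_cast this
    have e : (2 : ℝ) ^ t = 2 ^ (t - (n + 1)) * 2 ^ (n + 1) := by
      rw [← pow_add, Nat.sub_add_cancel (by omega)]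
    calc (k : ℝ) ≤ 2 ^ (t - (n + 1)) * (bval (angleDigits n N D) + 1) := hk'
      _ ≤ 2 ^ (t - (n + 1)) * (2 ^ (n + 1) * angle a + 1) := by gcongr
      _ = _ := by rw [e]; field_simp

/-- The squared cosine of an angle that exceeds `π * angle a` by at most `π η` is not much smaller
than `a`; the constant `4` is a bound for `π`. -/
theorem cos_sq_ge_of_le {a : ℝ} (ha0 : 0 ≤ a) (ha1 : a ≤ 1) {x η : ℝ} (hx : 0 ≤ x)
    (hη : 0 ≤ η) (h : x ≤ angle a + η) : a - 4 * η ≤ cos (π * x) ^ 2 := by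
  have hpi := pi_pos
  have ha := cos_sq_angle ha0 ha1
  rcases le_total x (angle a) with h' | h'
  · have hh := angle_le_half a
    have h1 : cos (π * angle a) ≤ cos (π * x) :=
      cos_le_cos_of_nonneg_of_le_pi (by positivity) (by nlinarith) (by gcongr)
    have h2 : 0 ≤ cos (π * angle a) :=
      cos_nonneg_of_mem_Icc ⟨by nlinarith [angle_nonneg a], by nlinarith⟩
    nlinarith
  · have hpi4 : π ≤ 4 := pi_le_four
    have h1 := Real.abs_cos_sub_cos_le (2 * (π * x)) (2 * (π * angle a))
    rw [abs_of_nonneg (by nlinarith : 0 ≤ 2 * (π * x) - 2 * (π * angle a))] at h1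
    have h2 := (abs_le.1 h1).1
    have h3 := Real.cos_sq (π * x)
    have h4 := Real.cos_sq (π * angle a)
    nlinarith

end

/-! ### Gates on an arbitrary register of qubits -/

/-- Gates on qubits labelled by `J`, without the requirement that the labels are distinct. -/
inductive QGate (J : Type) : Type
  | not (i : J) : QGate J
  | had (i : J) : QGate J
  | phase (k : ℕ) (inverse : Bool) (i : J) : QGate J
  | cnot (c i : J) : QGate J
  | toffoli (c d i : J) : QGate J

/-- State vectors of the qubits labelled by `ι`. -/
abbrev State (ι : Type) [Fintype ι] : Type := EuclideanSpace ℂ (ι → Bool)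

namespace QGate

/-- Relabelling of qubits. -/
def map {J J' : Type} (e : J → J') : QGate J → QGate J'
  | .not i => .not (e i)
  | .had i => .had (e i)
  | .phase k b i => .phase k b (e i)
  | .cnot c i => .cnot (e c) (e i)
  | .toffoli c d i => .toffoli (e c) (e d) (e i)

/-- The inverse gate. -/
def inv {J : Type} : QGate J → QGate J
  | .phase k b i => .phase k (!b) i
  | g => g

/-- The qubits of a gate are distinct. -/
def Distinct {J : Type} : QGate J → Prop
  | .cnot c i => c ≠ i
  | .toffoli c d i => c ≠ d ∧ c ≠ i ∧ d ≠ i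
  | _ => True

/-- `i` is the qubit that the gate changes in the computational basis. -/
def IsTarget {J : Type} (i : J) : QGate J → Prop
  | .not j => i = j
  | .had j => i = j
  | .phase _ _ _ => False
  | .cnot _ j => i = j
  | .toffoli _ _ j => i = j

/-- The gate acts on qubit `i`. -/
def Touches {J : Type} (i : J) : QGate J → Prop
  | .not j => i = j
  | .had j => i = j
  | .phase _ _ j => i = j
  | .cnot c j => i = c ∨ i = j
  | .toffoli c d j => i = c ∨ i = d ∨ i = j

/-- The gate permutes the computational basis. -/
def IsClassical {J : Type} : QGate J → Prop
  | .had _ => False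
  | .phase _ _ _ => False
  | _ => True

section
variable {J J' : Type}

theorem isTarget_inv (i : J) (g : QGate J) : g.inv.IsTarget i ↔ g.IsTarget i := by
  cases g <;> rfl

theorem touches_inv (i : J) (g : QGate J) : g.inv.Touches i ↔ g.Touches i := by
  cases g <;> rfl

theorem distinct_inv (g : QGate J) : g.inv.Distinct ↔ g.Distinct := by
  cases g <;> rfl

theorem distinct_map {e : J → J'} (he : Function.Injective e) {g : QGate J} (hg : g.Distinct) :
    (g.map e).Distinct := by
  cases g <;> simp_all [Distinct, map, he.eq_iff]

end

/-- The phase factor of a phase gate. -/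
noncomputable def phaseFactor (k : ℕ) (inverse : Bool) : ℂ :=
  Complex.exp ((if inverse then -1 else 1) * (2 * Real.pi * Complex.I / 2 ^ k))

theorem norm_phaseFactor (k : ℕ) (b : Bool) : ‖phaseFactor k b‖ = 1 := by
  have h : (if b then -1 else 1 : ℂ) * (2 * Real.pi * Complex.I / 2 ^ k)
      = (((if b then -1 else 1) * (2 * Real.pi / 2 ^ k) : ℝ) : ℂ) * Complex.I := by
    cases b <;> push_cast <;> simp <;> ring
  rw [phaseFactor, h, Complex.norm_exp_ofReal_mul_I]

theorem phaseFactor_mul (k : ℕ) (b : Bool) : phaseFactor k (!b) * phaseFactor k b = 1 := by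
  rw [phaseFactor, phaseFactor, ← Complex.exp_add]
  cases b <;> simp

variable {ι : Type} [Fintype ι] [DecidableEq ι]

/-- The action of a gate on amplitudes. -/
noncomputable def act {ι : Type} [DecidableEq ι] :
    QGate ι → ((ι → Bool) → ℂ) → (ι → Bool) → ℂ
  | .not i, ψ => fun z => ψ (Function.update z i (!z i))
  | .had i, ψ => fun z => ((1 / Real.sqrt 2 : ℝ) : ℂ) *
      (ψ (Function.update z i false) + (if z i then -1 else 1) * ψ (Function.update z i true))
  | .phase k b i, ψ => fun z => (if z i then phaseFactor k b else 1) * ψ z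
  | .cnot c i, ψ => fun z => ψ (Function.update z i (xor (z i) (z c)))
  | .toffoli c d i, ψ => fun z => ψ (Function.update z i (xor (z i) (z c && z d)))

theorem act_add (g : QGate ι) (φ ψ : (ι → Bool) → ℂ) : g.act (φ + ψ) = g.act φ + g.act ψ := by
  cases g <;> funext z <;> simp only [act, Pi.add_apply] <;> ring

theorem act_smul (g : QGate ι) (a : ℂ) (ψ : (ι → Bool) → ℂ) : g.act (a • ψ) = a • g.act ψ := by
  cases g <;> funext z <;> simp only [act, Pi.smul_apply, smul_eq_mul] <;> ring

theorem sqrt_half_sq : ((1 / Real.sqrt 2 : ℝ) : ℂ) * ((1 / Real.sqrt 2 : ℝ) : ℂ) = 1 / 2 := by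
  rw [← Complex.ofReal_mul, div_mul_div_comm, Real.mul_self_sqrt (by norm_num)]
  norm_num

theorem act_inv_act (g : QGate ι) (hg : g.Distinct) (ψ : (ι → Bool) → ℂ) :
    g.inv.act (g.act ψ) = ψ := by
  funext z
  cases g with
  | not i => simp [inv, act]
  | had i =>
    have hs := sqrt_half_sq
    have hu : Function.update z i (z i) = z := Function.update_eq_self i z
    simp only [inv, act, Function.update_self, Function.update_idem]
    generalize ((1 / Real.sqrt 2 : ℝ) : ℂ) = s at *
    cases hz : z i <;> rw [hz] at hu <;>
      simp only [hu, Bool.false_eq_true, if_false, if_true]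
    · linear_combination (2 * ψ z) * hs
    · linear_combination (2 * ψ z) * hs
  | phase k b i =>
    have hm := phaseFactor_mul k b
    simp only [inv, act]
    split_ifs
    · rw [← mul_assoc, hm, one_mul]
    · rw [one_mul, one_mul]
  | cnot c i =>
    have h : c ≠ i := hg
    simp [inv, act, Function.update_of_ne h]
  | toffoli c d i =>
    simp [inv, act, Function.update_of_ne hg.2.1, Function.update_of_ne hg.2.2]

end QGate

section
variable {ι : Type} [Fintype ι] [DecidableEq ι]

theorem isometry_mul_apply {E : Type*} [NormedAddCommGroup E] [InnerProductSpace ℂ E]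
    (f g : E ≃ₗᵢ[ℂ] E) (v : E) : (f * g) v = f (g v) := rfl

/-- Summation over a bit of the configuration. -/
theorem sum_split {A : Type*} [AddCommMonoid A] (i : ι) (F : (ι → Bool) → A) :
    ∑ z, F z = ∑ z, if z i then 0 else F z + F (Function.update z i true) := by
  have h1 : ∀ z : ι → Bool, (if z i then 0 else F z + F (Function.update z i true))
      = (if z i = false then F z else 0)
        + if z i = false then F (Function.update z i true) else 0 := fun z => by
    cases z i <;> simp
  have h2 : ∑ z : ι → Bool, (if z i = false then F (Function.update z i true) else 0)
      = ∑ z : ι → Bool, if z i = true then F z else 0 := by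
    have hinv : Function.Involutive fun z : ι → Bool => Function.update z i (!z i) := fun z => by
      simp
    rw [← Equiv.sum_comp hinv.toPerm]
    refine Finset.sum_congr rfl fun z _ => ?_
    cases hz : z i
    · simp [hz]
    · have hu : Function.update z i true = z := by rw [← hz, Function.update_eq_self]
      simp [hz, hu]
  rw [Finset.sum_congr rfl fun z _ => h1 z, Finset.sum_add_distrib, h2, ← Finset.sum_add_distrib]
  refine Finset.sum_congr rfl fun z _ => ?_
  cases z i <;> simp

theorem half_parallelogram (a b : ℂ) :
    1 / 2 * ‖a + b‖ ^ 2 + 1 / 2 * ‖a - b‖ ^ 2 = ‖a‖ ^ 2 + ‖b‖ ^ 2 := by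
  have := parallelogram_law_with_norm ℝ a b
  linarith

namespace QGate

theorem norm_act (g : QGate ι) (hg : g.Distinct) (ψ : (ι → Bool) → ℂ) :
    ∑ z, ‖g.act ψ z‖ ^ 2 = ∑ z, ‖ψ z‖ ^ 2 := by
  -- the gates other than the Hadamard gate permute the configurations or multiply by phases
  have perm : ∀ f : (ι → Bool) → (ι → Bool), Function.Involutive f →
      ∑ z, ‖ψ (f z)‖ ^ 2 = ∑ z, ‖ψ z‖ ^ 2 := fun f hf =>
    Equiv.sum_comp hf.toPerm fun z => ‖ψ z‖ ^ 2
  cases g with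
  | not i => exact perm _ fun z => by simp
  | had i =>
    have hs : ‖((1 / Real.sqrt 2 : ℝ) : ℂ)‖ ^ 2 = 1 / 2 := by
      rw [Complex.norm_real, Real.norm_eq_abs, sq_abs, div_pow, one_pow, Real.sq_sqrt (by norm_num)]
    rw [sum_split i, sum_split i fun z => ‖ψ z‖ ^ 2]
    refine Finset.sum_congr rfl fun z _ => ?_
    have hu : Function.update z i (z i) = z := Function.update_eq_self i z
    cases hz : z i <;> rw [hz] at hu
    · simp only [act, hz, hu, Bool.false_eq_true, if_false, if_true, Function.update_self,
        Function.update_idem, norm_mul, mul_pow, hs, one_mul, neg_one_mul, ← sub_eq_add_neg]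
      exact half_parallelogram _ _
    · rfl
  | phase k b i =>
    refine Finset.sum_congr rfl fun z _ => ?_
    rw [act, norm_mul]
    split_ifs
    · rw [norm_phaseFactor, one_mul]
    · rw [norm_one, one_mul]
  | cnot c i =>
    have h : c ≠ i := hg
    exact perm _ fun z => by simp [Function.update_of_ne h]
  | toffoli c d i =>
    exact perm _ fun z => by simp [Function.update_of_ne hg.2.1, Function.update_of_ne hg.2.2]

/-- The gate as a linear map. -/
noncomputable def lin (g : QGate ι) : State ι →ₗ[ℂ] State ι where
  toFun ψ := WithLp.toLp 2 (g.act ψ.ofLp)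
  map_add' φ ψ := by rw [WithLp.ofLp_add, act_add, WithLp.toLp_add]
  map_smul' a ψ := by rw [WithLp.ofLp_smul, act_smul, WithLp.toLp_smul, RingHom.id_apply]

open Classical in
/-- The unitary operator of a gate (the identity if the qubits of the gate are not distinct). -/
noncomputable def op (g : QGate ι) : State ι ≃ₗᵢ[ℂ] State ι :=
  if hg : g.Distinct then
    LinearIsometry.toLinearIsometryEquiv
      { toLinearMap := g.lin
        norm_map' := fun ψ => by
          rw [← sq_eq_sq₀ (norm_nonneg _) (norm_nonneg _), EuclideanSpace.norm_sq_eq,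
            EuclideanSpace.norm_sq_eq]
          exact g.norm_act hg ψ.ofLp } rfl
  else LinearIsometryEquiv.refl ℂ (State ι)

theorem op_apply {g : QGate ι} (hg : g.Distinct) (ψ : State ι) (z : ι → Bool) :
    g.op ψ z = g.act ψ.ofLp z := by
  rw [op, dif_pos hg]; rfl

theorem op_inv (g : QGate ι) : g.inv.op = g.op⁻¹ := by
  by_cases hg : g.Distinct
  · refine eq_inv_of_mul_eq_one_left (LinearIsometryEquiv.ext fun ψ => ?_)
    ext z
    have h : (g.op ψ).ofLp = g.act ψ.ofLp := funext fun z => op_apply hg ψ z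
    rw [isometry_mul_apply, op_apply ((distinct_inv g).2 hg), h, act_inv_act g hg]
    rfl
  · rw [op, dif_neg (fun h => hg ((distinct_inv g).1 h)), op, dif_neg hg]
    rfl

end QGate

/-- The unitary operator of a list of gates (the head is applied first). -/
noncomputable def opL : List (QGate ι) → State ι ≃ₗᵢ[ℂ] State ι
  | [] => 1
  | g :: L => opL L * g.op

@[simp] theorem opL_nil : opL ([] : List (QGate ι)) = 1 := rfl

@[simp] theorem opL_cons (g : QGate ι) (L : List (QGate ι)) : opL (g :: L) = opL L * g.op := rfl

theorem opL_append (L L' : List (QGate ι)) : opL (L ++ L') = opL L' * opL L := by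
  induction L with
  | nil => rw [List.nil_append, opL_nil, mul_one]
  | cons g L ih => rw [List.cons_append, opL_cons, opL_cons, ih, mul_assoc]

/-- The inverse circuit. -/
def invL {J : Type} (L : List (QGate J)) : List (QGate J) := (L.map QGate.inv).reverse

theorem opL_invL (L : List (QGate ι)) : opL (invL L) = (opL L)⁻¹ := by
  induction L with
  | nil => exact inv_one.symm
  | cons g L ih =>
    have h : invL (g :: L) = invL L ++ [g.inv] := by simp [invL]
    rw [h, opL_append, ih, opL_cons, opL_cons, opL_nil, one_mul, QGate.op_inv, mul_inv_rev]

/-! ### Measurements -/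

open Classical in
/-- The projection onto the span of the basis states that satisfy `p`. -/
noncomputable def proj {ι : Type} [Fintype ι] (p : (ι → Bool) → Prop) : State ι →ₗ[ℂ] State ι where
  toFun ψ := WithLp.toLp 2 fun z => if p z then ψ z else 0
  map_add' φ ψ := by ext z; simp only [PiLp.add_apply]; split_ifs <;> simp
  map_smul' a ψ := by ext z; simp

open Classical in
theorem proj_apply (p : (ι → Bool) → Prop) (ψ : State ι) (z : ι → Bool) :
    proj p ψ z = if p z then ψ z else 0 := rfl

theorem proj_proj (p q : (ι → Bool) → Prop) (ψ : State ι) :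
    proj p (proj q ψ) = proj (fun z => p z ∧ q z) ψ := by
  ext z
  simp only [proj_apply]
  split_ifs <;> simp_all

theorem proj_eq_self_iff {p : (ι → Bool) → Prop} {ψ : State ι} :
    proj p ψ = ψ ↔ ∀ z, ¬ p z → ψ z = 0 := by
  constructor
  · intro h z hz
    rw [← h, proj_apply, if_neg hz]
  · intro h
    ext z
    rw [proj_apply]
    split_ifs with hz
    · rfl
    · exact (h z hz).symm

/-- The subspace spanned by the basis states that satisfy `p`. -/
noncomputable def supp {ι : Type} [Fintype ι] (p : (ι → Bool) → Prop) : Submodule ℂ (State ι) where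
  carrier := {ψ | proj p ψ = ψ}
  add_mem' {φ ψ} hφ hψ := by
    rw [Set.mem_ofPred_eq] at *
    rw [map_add, hφ, hψ]
  zero_mem' := map_zero _
  smul_mem' a ψ hψ := by
    rw [Set.mem_ofPred_eq] at *
    rw [map_smul, hψ]

theorem mem_supp {p : (ι → Bool) → Prop} {ψ : State ι} : ψ ∈ supp p ↔ proj p ψ = ψ := Iff.rfl

theorem mem_supp_iff {p : (ι → Bool) → Prop} {ψ : State ι} :
    ψ ∈ supp p ↔ ∀ z, ¬ p z → ψ z = 0 := proj_eq_self_iff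

theorem supp_mono {p q : (ι → Bool) → Prop} (h : ∀ z, p z → q z) : supp p ≤ supp q := by
  intro ψ hψ
  rw [mem_supp_iff] at *
  exact fun z hz => hψ z fun hp => hz (h z hp)

theorem proj_mem_supp (p : (ι → Bool) → Prop) (ψ : State ι) : proj p ψ ∈ supp p :=
  mem_supp_iff.2 fun z hz => by rw [proj_apply, if_neg hz]

theorem mem_supp_and {p q : (ι → Bool) → Prop} {ψ : State ι} (hp : ψ ∈ supp p) (hq : ψ ∈ supp q) :
    ψ ∈ supp fun z => p z ∧ q z := by
  rw [mem_supp_iff] at *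
  intro z hz
  by_cases h : p z
  · exact hq z fun h' => hz ⟨h, h'⟩
  · exact hp z h

open Classical in
/-- On a state with support in `r`, only the configurations in `r` matter for a projection. -/
theorem proj_congr {p q r : (ι → Bool) → Prop} {ψ : State ι} (hψ : ψ ∈ supp r)
    (h : ∀ z, r z → (p z ↔ q z)) : proj p ψ = proj q ψ := by
  rw [mem_supp_iff] at hψ
  ext z
  rw [proj_apply, proj_apply]
  by_cases hz : r z
  · simp only [h z hz]
  · rw [hψ z hz, ite_self, ite_self]

open Classical in
theorem norm_proj_sq (p : (ι → Bool) → Prop) (ψ : State ι) :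
    ‖proj p ψ‖ ^ 2 = ∑ z, if p z then ‖ψ z‖ ^ 2 else 0 := by
  rw [EuclideanSpace.norm_sq_eq]
  refine Finset.sum_congr rfl fun z _ => ?_
  rw [proj_apply]
  split_ifs <;> simp

theorem norm_proj_le (p : (ι → Bool) → Prop) (v : State ι) : ‖proj p v‖ ^ 2 ≤ ‖v‖ ^ 2 := by
  rw [norm_proj_sq, EuclideanSpace.norm_sq_eq]
  refine Finset.sum_le_sum fun z _ => ?_
  split_ifs
  · exact le_rfl
  · exact sq_nonneg _

theorem inner_proj (p : (ι → Bool) → Prop) (φ ψ : State ι) :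
    inner ℂ φ (proj p ψ) = inner ℂ (proj p φ) ψ := by
  rw [PiLp.inner_apply, PiLp.inner_apply]
  refine Finset.sum_congr rfl fun z _ => ?_
  rw [proj_apply, proj_apply]
  split_ifs <;> simp

/-- The truth value of `p` does not depend on the target of the gate. -/
def QGate.Preserves {ι : Type} [DecidableEq ι] (g : QGate ι) (p : (ι → Bool) → Prop) : Prop :=
  ∀ i, g.IsTarget i → ∀ (z : ι → Bool) (b : Bool), p (Function.update z i b) ↔ p z

open Classical in
theorem QGate.proj_op {g : QGate ι} {p : (ι → Bool) → Prop} (h : g.Preserves p) (ψ : State ι) :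
    proj p (g.op ψ) = g.op (proj p ψ) := by
  by_cases hg : g.Distinct
  · ext z
    rw [proj_apply, QGate.op_apply hg, QGate.op_apply hg]
    cases g with
    | not i =>
      have h' := h i rfl
      simp only [QGate.act, proj_apply, h']
    | had i =>
      have h' := h i rfl
      simp only [QGate.act, proj_apply, h']
      split_ifs <;> simp only [mul_zero, add_zero]
    | phase k b i =>
      simp only [QGate.act, proj_apply]
      split_ifs <;> simp
    | cnot c i =>
      have h' := h i rfl
      simp only [QGate.act, proj_apply, h']
    | toffoli c d i =>
      have h' := h i rfl
      simp only [QGate.act, proj_apply, h']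
  · rw [QGate.op, dif_neg hg]
    rfl

theorem proj_opL {L : List (QGate ι)} {p : (ι → Bool) → Prop} (h : ∀ g ∈ L, g.Preserves p)
    (ψ : State ι) : proj p (opL L ψ) = opL L (proj p ψ) := by
  induction L generalizing ψ with
  | nil => rfl
  | cons g L ih =>
    rw [opL_cons, isometry_mul_apply, isometry_mul_apply,
      ih fun g hg => h g (List.mem_cons_of_mem _ hg), QGate.proj_op (h g List.mem_cons_self)]

theorem opL_mem_supp {L : List (QGate ι)} {p : (ι → Bool) → Prop} (h : ∀ g ∈ L, g.Preserves p)
    {ψ : State ι} (hψ : ψ ∈ supp p) : opL L ψ ∈ supp p := by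
  rw [mem_supp] at *
  rw [proj_opL h, hψ]

theorem preserves_invL {L : List (QGate ι)} {p : (ι → Bool) → Prop}
    (h : ∀ g ∈ L, g.Preserves p) : ∀ g ∈ invL L, g.Preserves p := by
  intro g hg i hi
  rw [invL, List.mem_reverse, List.mem_map] at hg
  obtain ⟨g, hg', rfl⟩ := hg
  exact h g hg' i ((QGate.isTarget_inv i g).1 hi)

theorem opL_inv_mem_supp {L : List (QGate ι)} {p : (ι → Bool) → Prop}
    (h : ∀ g ∈ L, g.Preserves p) {ψ : State ι} (hψ : ψ ∈ supp p) : (opL L)⁻¹ ψ ∈ supp p := by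
  rw [← opL_invL]
  exact opL_mem_supp (preserves_invL h) hψ

/-- A gate commutes with a NOT gate on a qubit on which it does not act. -/
theorem QGate.op_not_comm {g : QGate ι} {c : ι} (h : ¬ g.Touches c) (ψ : State ι) :
    g.op ((QGate.not c).op ψ) = (QGate.not c).op (g.op ψ) := by
  have hn : (QGate.not c).Distinct := trivial
  by_cases hg : g.Distinct
  · ext z
    have e1 : ((QGate.not c).op ψ).ofLp = (QGate.not c).act ψ.ofLp :=
      funext fun z => QGate.op_apply hn ψ z
    have e2 : (g.op ψ).ofLp = g.act ψ.ofLp := funext fun z => QGate.op_apply hg ψ z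
    rw [QGate.op_apply hg, QGate.op_apply hn, e1, e2]
    cases g with
    | not i =>
      have h1 : c ≠ i := h
      simp only [QGate.act, Function.update_of_ne h1, Function.update_of_ne h1.symm,
        Function.update_comm h1]
    | had i =>
      have h1 : c ≠ i := h
      simp only [QGate.act, Function.update_of_ne h1, Function.update_of_ne h1.symm,
        Function.update_comm h1]
    | phase k b i =>
      have h1 : c ≠ i := h
      simp only [QGate.act, Function.update_of_ne h1.symm]
    | cnot d i =>
      obtain ⟨h1, h2⟩ := not_or.1 h
      simp only [QGate.act, Function.update_of_ne h2, Function.update_of_ne (Ne.symm h1),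
        Function.update_of_ne (Ne.symm h2), Function.update_comm h2]
    | toffoli d d' i =>
      obtain ⟨h1, h2⟩ := not_or.1 h
      obtain ⟨h2, h3⟩ := not_or.1 h2
      simp only [QGate.act, Function.update_of_ne h3, Function.update_of_ne (Ne.symm h1),
        Function.update_of_ne (Ne.symm h2), Function.update_of_ne (Ne.symm h3),
        Function.update_comm h3]
  · have : g.op = LinearIsometryEquiv.refl ℂ (State ι) := by rw [QGate.op, dif_neg hg]
    rw [this]
    rfl

theorem opL_not_comm {L : List (QGate ι)} {c : ι} (h : ∀ g ∈ L, ¬ g.Touches c) (ψ : State ι) :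
    opL L ((QGate.not c).op ψ) = (QGate.not c).op (opL L ψ) := by
  induction L generalizing ψ with
  | nil => rfl
  | cons g L ih =>
    rw [opL_cons, isometry_mul_apply, isometry_mul_apply, QGate.op_not_comm (h g List.mem_cons_self),
      ih fun g hg => h g (List.mem_cons_of_mem _ hg)]

/-! ### Classical circuits -/

/-- The action of a classical gate on basis states. -/
def QGate.flip {ι : Type} [DecidableEq ι] : QGate ι → (ι → Bool) → ι → Bool
  | .not i, z => Function.update z i (!z i)
  | .cnot c i, z => Function.update z i (xor (z i) (z c))
  | .toffoli c d i, z => Function.update z i (xor (z i) (z c && z d))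
  | _, z => z

/-- The action of a classical circuit on basis states. -/
def run {ι : Type} [DecidableEq ι] : List (QGate ι) → (ι → Bool) → ι → Bool
  | [], z => z
  | g :: L, z => run L (g.flip z)

theorem run_append (L L' : List (QGate ι)) (z : ι → Bool) : run (L ++ L') z = run L' (run L z) := by
  induction L generalizing z with
  | nil => rfl
  | cons g L ih => exact ih _

theorem QGate.flip_flip {g : QGate ι} (hg : g.Distinct) (z : ι → Bool) :
    g.flip (g.flip z) = z := by
  cases g with
  | not i => simp [QGate.flip]
  | had i => rfl
  | phase k b i => rfl
  | cnot c i =>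
    have h : c ≠ i := hg
    simp [QGate.flip, Function.update_of_ne h]
  | toffoli c d i =>
    simp [QGate.flip, Function.update_of_ne hg.2.1, Function.update_of_ne hg.2.2]

theorem opL_run {L : List (QGate ι)} (h : ∀ g ∈ L, g.Distinct ∧ g.IsClassical) (ψ : State ι)
    (z : ι → Bool) : opL L ψ (run L z) = ψ z := by
  induction L generalizing ψ z with
  | nil => rfl
  | cons g L ih =>
    obtain ⟨h1, h2⟩ := h g List.mem_cons_self
    rw [opL_cons, isometry_mul_apply, run, ih fun g hg => h g (List.mem_cons_of_mem _ hg),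
      QGate.op_apply h1]
    have hact : ∀ w, g.act ψ.ofLp w = ψ (g.flip w) := by
      intro w
      cases g <;> first | rfl | exact h2.elim
    rw [hact, QGate.flip_flip h1]

theorem run_surjective {L : List (QGate ι)} (h : ∀ g ∈ L, g.Distinct) :
    Function.Surjective (run L) := by
  induction L with
  | nil => exact fun z => ⟨z, rfl⟩
  | cons g L ih =>
    intro z
    obtain ⟨w, hw⟩ := ih (fun g hg => h g (List.mem_cons_of_mem _ hg)) z
    exact ⟨g.flip w, by rw [run, QGate.flip_flip (h g List.mem_cons_self), hw]⟩

/-- Measuring after a classical circuit. -/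
theorem proj_opL_classical {L : List (QGate ι)} (h : ∀ g ∈ L, g.Distinct ∧ g.IsClassical)
    (p : (ι → Bool) → Prop) (ψ : State ι) :
    proj p (opL L ψ) = opL L (proj (fun z => p (run L z)) ψ) := by
  ext z
  obtain ⟨w, rfl⟩ := run_surjective (fun g hg => (h g hg).1) z
  rw [proj_apply, opL_run h, opL_run h, proj_apply]

/-! ### Circuits on a part of the qubits -/

theorem extend_update {κ : Type} [DecidableEq κ] {e : κ → ι} (he : Function.Injective e)
    (y : κ → Bool) (z : ι → Bool) (i : κ) (b : Bool) :
    Function.extend e (Function.update y i b) z = Function.update (Function.extend e y z) (e i) b := by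
  funext x
  by_cases hx : ∃ j, e j = x
  · obtain ⟨j, rfl⟩ := hx
    rw [he.extend_apply]
    by_cases hj : j = i
    · subst hj; simp
    · rw [Function.update_of_ne hj, Function.update_of_ne (he.ne hj), he.extend_apply]
  · rw [Function.extend_apply' _ _ _ hx, Function.update_of_ne (fun h => hx ⟨i, h.symm⟩),
      Function.extend_apply' _ _ _ hx]

/-- The state of the qubits in the range of `e`, for a given configuration of the others. -/
noncomputable def slice {κ : Type} [Fintype κ] (e : κ → ι) (ψ : State ι) (z : ι → Bool) :
    State κ := WithLp.toLp 2 fun y => ψ (Function.extend e y z)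

theorem opL_map {κ : Type} [Fintype κ] [DecidableEq κ] {e : κ → ι} (he : Function.Injective e)
    {L : List (QGate κ)} (hL : ∀ g ∈ L, g.Distinct) (ψ : State ι) (z : ι → Bool) (y : κ → Bool) :
    opL (L.map (QGate.map e)) ψ (Function.extend e y z) = opL L (slice e ψ z) y := by
  induction L generalizing ψ y with
  | nil => rfl
  | cons g L ih =>
    rw [List.map_cons, opL_cons, opL_cons, isometry_mul_apply,
      isometry_mul_apply, ih fun g hg => hL g (List.mem_cons_of_mem _ hg)]
    suffices h : slice e ((g.map e).op ψ) z = g.op (slice e ψ z) by rw [h]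
    ext y
    have hg := hL g List.mem_cons_self
    change ((g.map e).op ψ) (Function.extend e y z) = _
    rw [QGate.op_apply (QGate.distinct_map he hg), QGate.op_apply hg]
    cases g <;> simp [QGate.map, QGate.act, slice, extend_update he, he.extend_apply]

open Classical in
/-- Summation over the configurations of a part of the qubits; every configuration is counted
once for each configuration of this part. -/
theorem sum_extend {κ : Type} [Fintype κ] [DecidableEq κ] {e : κ → ι} (he : Function.Injective e)
    (F : (ι → Bool) → ℝ) :
    ∑ w : ι → Bool, ∑ y : κ → Bool, F (Function.extend e y w)
      = Fintype.card (κ → Bool) * ∑ z, F z := by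
  have hinv : Function.Involutive (fun p : (ι → Bool) × (κ → Bool) =>
      (Function.extend e p.2 p.1, p.1 ∘ e)) := by
    rintro ⟨w, y⟩
    refine Prod.ext ?_ ?_
    · funext x
      by_cases hx : ∃ j, e j = x
      · obtain ⟨j, rfl⟩ := hx
        simp [he.extend_apply]
      · simp [Function.extend_apply' _ _ _ hx]
    · funext j
      simp [he.extend_apply]
  have h := Equiv.sum_comp hinv.toPerm fun p : (ι → Bool) × (κ → Bool) => F p.1
  rw [Fintype.sum_prod_type, Fintype.sum_prod_type] at h
  simp only [Function.Involutive.coe_toPerm, Finset.sum_const, nsmul_eq_mul,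
    Finset.card_univ] at h
  rw [h, Finset.mul_sum]

end

/-! ### Two reflections -/

section
variable {E : Type*} [NormedAddCommGroup E] [InnerProductSpace ℂ E]

/-- The sum of the product of two reflections and its inverse. -/
def cosOp (R₁ R₂ : E ≃ₗᵢ[ℂ] E) : E →ₗ[ℂ] E where
  toFun v := R₁ (R₂ v) + R₂ (R₁ v)
  map_add' v w := by simp only [map_add]; abel
  map_smul' a v := by simp only [map_smul, smul_add, RingHom.id_apply]

/-- The operator `(1 - (R₁ R₂)²) / 2`. -/
noncomputable def passOp (R₁ R₂ : E ≃ₗᵢ[ℂ] E) : E →ₗ[ℂ] E where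
  toFun v := (1 / 2 : ℂ) • (v - R₁ (R₂ (R₁ (R₂ v))))
  map_add' v w := by simp only [map_add]; module
  map_smul' a v := by simp only [map_smul, RingHom.id_apply]; module

variable {R₁ R₂ : E ≃ₗᵢ[ℂ] E}

theorem cosOp_apply (v : E) : cosOp R₁ R₂ v = R₁ (R₂ v) + R₂ (R₁ v) := rfl

theorem passOp_apply (v : E) : passOp R₁ R₂ v = (1 / 2 : ℂ) • (v - R₁ (R₂ (R₁ (R₂ v)))) := rfl

theorem inner_reflection {R : E ≃ₗᵢ[ℂ] E} (h : ∀ v, R (R v) = v) (v w : E) :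
    inner ℂ (R v) w = inner ℂ v (R w) := by
  rw [← h w, LinearIsometryEquiv.inner_map_map, h]

theorem inner_cosOp (h₁ : ∀ v, R₁ (R₁ v) = v) (h₂ : ∀ v, R₂ (R₂ v) = v) (v w : E) :
    inner ℂ (cosOp R₁ R₂ v) w = inner ℂ v (cosOp R₁ R₂ w) := by
  rw [cosOp_apply, cosOp_apply, inner_add_left, inner_add_right, inner_reflection h₁,
    inner_reflection h₂, inner_reflection h₂, inner_reflection h₁, add_comm]

theorem norm_passOp_sq (h₁ : ∀ v, R₁ (R₁ v) = v) (h₂ : ∀ v, R₂ (R₂ v) = v) (v : E) :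
    ‖passOp R₁ R₂ v‖ ^ 2 = ‖v‖ ^ 2 - ‖cosOp R₁ R₂ v‖ ^ 2 / 4 := by
  have h := parallelogram_law_with_norm ℂ (R₂ (R₁ v)) (R₁ (R₂ v))
  have e : R₁ (R₂ (R₂ (R₁ v) - R₁ (R₂ v))) = v - R₁ (R₂ (R₁ (R₂ v))) := by
    rw [map_sub, map_sub, h₂, h₁]
  have e2 : ‖v - R₁ (R₂ (R₁ (R₂ v)))‖ = ‖R₂ (R₁ v) - R₁ (R₂ v)‖ := by
    rw [← e, LinearIsometryEquiv.norm_map, LinearIsometryEquiv.norm_map]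
  rw [passOp_apply, cosOp_apply, norm_smul, mul_pow, e2, add_comm (R₁ (R₂ v))]
  simp only [LinearIsometryEquiv.norm_map] at h
  have e3 : ‖(1 / 2 : ℂ)‖ = 1 / 2 := by simp
  rw [e3]
  nlinarith

theorem norm_passOp_le (h₁ : ∀ v, R₁ (R₁ v) = v) (h₂ : ∀ v, R₂ (R₂ v) = v) (v : E) :
    ‖passOp R₁ R₂ v‖ ≤ ‖v‖ := by
  have := norm_passOp_sq h₁ h₂ v
  rw [← sq_le_sq₀ (norm_nonneg _) (norm_nonneg _), this]
  have := sq_nonneg ‖cosOp R₁ R₂ v‖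
  linarith

/-- Two rounds amount, up to isometries that commute with further rounds, to `1 - C² / 4`. -/
theorem passOp_passOp (h₁ : ∀ v, R₁ (R₁ v) = v) (h₂ : ∀ v, R₂ (R₂ v) = v) (v : E) :
    passOp R₁ R₂ (passOp R₁ R₂ v) = -R₁ (R₂ (R₁ (R₂
      (v - (1 / 4 : ℂ) • cosOp R₁ R₂ (cosOp R₁ R₂ v))))) := by
  simp only [passOp_apply, cosOp_apply, map_sub, map_smul, map_add, h₁, h₂]
  module

theorem passOp_iterate_comm (v : E) (n : ℕ) :
    (passOp R₁ R₂)^[n] (R₁ (R₂ v)) = R₁ (R₂ ((passOp R₁ R₂)^[n] v)) := by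
  induction n generalizing v with
  | zero => rfl
  | succ n ih =>
    rw [Function.iterate_succ_apply, Function.iterate_succ_apply, ← ih]
    congr 1
    simp only [passOp_apply, map_sub, map_smul]

theorem passOp_iterate_neg (v : E) (n : ℕ) :
    (passOp R₁ R₂)^[n] (-v) = -(passOp R₁ R₂)^[n] v := by
  induction n generalizing v with
  | zero => rfl
  | succ n ih => rw [Function.iterate_succ_apply, Function.iterate_succ_apply, map_neg, ih]

/-- If `C = R₁ R₂ + R₂ R₁` is at most `- 2 g` on an invariant subspace, then `(1 - (R₁ R₂)²) / 2`
contracts it. -/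
theorem norm_passOp_iterate_le (h₁ : ∀ v, R₁ (R₁ v) = v) (h₂ : ∀ v, R₂ (R₂ v) = v)
    (S : Submodule ℂ E) (hS : ∀ v ∈ S, cosOp R₁ R₂ v ∈ S) {g : ℝ} (hg : 0 ≤ g)
    (h : ∀ v ∈ S, RCLike.re (inner ℂ v (cosOp R₁ R₂ v)) ≤ -(2 * g) * ‖v‖ ^ 2)
    (j : ℕ) (v : E) (hv : v ∈ S) :
    ‖(passOp R₁ R₂)^[2 * j] v‖ ^ 2 ≤ (1 - g ^ 2) ^ j * ‖v‖ ^ 2 := by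
  have hC : ∀ v ∈ S, 2 * g * ‖v‖ ≤ ‖cosOp R₁ R₂ v‖ := by
    intro v hv
    by_cases h0 : ‖v‖ = 0
    · rw [h0, mul_zero]; exact norm_nonneg _
    have h1 := h v hv
    have h2 := norm_inner_le_norm (𝕜 := ℂ) v (cosOp R₁ R₂ v)
    have h3 := RCLike.abs_re_le_norm (inner ℂ v (cosOp R₁ R₂ v))
    have h4 := neg_le_abs (RCLike.re (inner ℂ v (cosOp R₁ R₂ v)))
    have h5 : 0 < ‖v‖ := lt_of_le_of_ne (norm_nonneg _) (Ne.symm h0)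
    have h6 : ‖v‖ * (2 * g * ‖v‖) ≤ ‖v‖ * ‖cosOp R₁ R₂ v‖ := by nlinarith
    exact le_of_mul_le_mul_left h6 h5
  have hP : ∀ v ∈ S, ‖passOp R₁ R₂ v‖ ^ 2 ≤ (1 - g ^ 2) * ‖v‖ ^ 2 := by
    intro v hv
    rw [norm_passOp_sq h₁ h₂]
    have := hC v hv
    have := mul_self_le_mul_self (by positivity) this
    nlinarith
  induction j generalizing v with
  | zero => simp
  | succ j ih =>
    set w := v - (1 / 4 : ℂ) • cosOp R₁ R₂ (cosOp R₁ R₂ v) with hw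
    have hwS : w ∈ S := S.sub_mem hv (S.smul_mem _ (hS _ (hS _ hv)))
    have e : ‖(passOp R₁ R₂)^[2 * (j + 1)] v‖ = ‖(passOp R₁ R₂)^[2 * j] w‖ := by
      rw [show 2 * (j + 1) = 2 * j + 1 + 1 from rfl, Function.iterate_succ_apply,
        Function.iterate_succ_apply, passOp_passOp h₁ h₂, passOp_iterate_neg, norm_neg,
        passOp_iterate_comm, LinearIsometryEquiv.norm_map, LinearIsometryEquiv.norm_map,
        passOp_iterate_comm, LinearIsometryEquiv.norm_map, LinearIsometryEquiv.norm_map]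
    have e2 : ‖w‖ ^ 2 ≤ (1 - g ^ 2) * ‖v‖ ^ 2 := by
      have : ‖w‖ = ‖passOp R₁ R₂ (passOp R₁ R₂ v)‖ := by
        rw [passOp_passOp h₁ h₂, norm_neg]
        simp only [LinearIsometryEquiv.norm_map]
        rfl
      rw [this]
      refine le_trans ?_ (hP v hv)
      gcongr
      exact norm_passOp_le h₁ h₂ _
    rw [e]
    by_cases hv0 : ‖v‖ = 0
    · have hw0 : ‖w‖ ^ 2 ≤ 0 := by simpa [hv0] using e2
      have hw0' : w = 0 := by
        rw [← norm_eq_zero]; exact pow_eq_zero_iff (by norm_num) |>.1 (le_antisymm hw0 (sq_nonneg _))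
      have hz : ∀ n, (passOp R₁ R₂)^[n] (0 : E) = 0 := fun n => by
        induction n with
        | zero => rfl
        | succ n ih => rw [Function.iterate_succ_apply, map_zero, ih]
      rw [hw0', hz, hv0]; simp
    · have hg1 : 0 ≤ 1 - g ^ 2 := by
        have h3 := (sq_nonneg _).trans e2
        have h4 : 0 < ‖v‖ ^ 2 := by positivity
        exact nonneg_of_mul_nonneg_left h3 h4
      calc ‖(passOp R₁ R₂)^[2 * j] w‖ ^ 2 ≤ (1 - g ^ 2) ^ j * ‖w‖ ^ 2 := ih w hwS
        _ ≤ (1 - g ^ 2) ^ j * ((1 - g ^ 2) * ‖v‖ ^ 2) := by gcongr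
        _ = _ := by ring

/-- A vector at which the nonpositive form `⟨v, C v⟩` vanishes is fixed by
`(1 - (R₁ R₂)²) / 2`. -/
theorem passOp_eq_self (h₁ : ∀ v, R₁ (R₁ v) = v) (h₂ : ∀ v, R₂ (R₂ v) = v)
    (S : Submodule ℂ E) (hS : ∀ v ∈ S, cosOp R₁ R₂ v ∈ S)
    (h : ∀ v ∈ S, RCLike.re (inner ℂ v (cosOp R₁ R₂ v)) ≤ 0) (v : E) (hv : v ∈ S)
    (hv0 : RCLike.re (inner ℂ v (cosOp R₁ R₂ v)) = 0) : passOp R₁ R₂ v = v := by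
  have hC : cosOp R₁ R₂ v = 0 := by
    set u := cosOp R₁ R₂ v with hu
    -- the form at `v + ε u` is `2 ε ‖u‖² + ε² ⟨u, C u⟩`
    have key : ∀ ε : ℝ, 2 * ε * ‖u‖ ^ 2 + ε ^ 2 * RCLike.re (inner ℂ u (cosOp R₁ R₂ u)) ≤ 0 := by
      intro ε
      have h1 := h (v + (ε : ℂ) • u) (S.add_mem hv (S.smul_mem _ (hS v hv)))
      rw [map_add, map_smul, ← hu, inner_add_left, inner_add_right, inner_add_right,
        inner_smul_left, inner_smul_right, inner_smul_left, inner_smul_right,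
        ← inner_cosOp h₁ h₂ v u, ← hu, inner_self_eq_norm_sq_to_K, Complex.conj_ofReal] at h1
      simp only [map_add, hv0] at h1
      have e : ∀ (r : ℝ) (z : ℂ), RCLike.re ((r : ℂ) * z) = r * RCLike.re z := by
        intro r z; simp
      rw [e, e, e] at h1
      have e2 : RCLike.re ((RCLike.ofReal ‖u‖ : ℂ) ^ 2) = ‖u‖ ^ 2 := by
        rw [← RCLike.ofReal_pow, RCLike.ofReal_re]
      rw [e2] at h1
      linarith
    by_contra hne
    have hpos : 0 < ‖u‖ ^ 2 := by positivity
    set q := RCLike.re (inner ℂ u (cosOp R₁ R₂ u)) with hq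
    have := key (‖u‖ ^ 2 / (|q| + 1))
    have habs := neg_abs_le q
    have hq1 : 0 < |q| + 1 := by positivity
    set a := ‖u‖ ^ 2
    have h3 : a / (|q| + 1) * (|q| + 1) = a := div_mul_cancel₀ _ hq1.ne'
    have hε : 0 < a / (|q| + 1) := by positivity
    set ε := a / (|q| + 1)
    have : 2 * a + ε * q ≤ 0 := by
      have : ε * (2 * a + ε * q) ≤ 0 := by nlinarith
      by_contra hh
      push Not at hh
      nlinarith [mul_pos hε hh]
    nlinarith
  have e : R₁ (R₂ v) = -R₂ (R₁ v) := eq_neg_of_add_eq_zero_left hC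
  have e2 : R₁ (R₂ (R₁ (R₂ v))) = -v := by rw [e, map_neg, map_neg, h₂, h₁]
  rw [passOp_apply, e2]
  module

end

/-! ### Controlled reflections and rounds of interference -/

section
variable {ι : Type} [Fintype ι] [DecidableEq ι]

theorem QGate.IsTarget.touches {J : Type} {i : J} {g : QGate J} (h : g.IsTarget i) :
    g.Touches i := by
  cases g with
  | not j => exact h
  | had j => exact h
  | phase k b j => exact h.elim
  | cnot c j => exact Or.inr h
  | toffoli c d j => exact Or.inr (Or.inr h)

theorem QGate.preserves_of_dependsOn {g : QGate ι} {p : (ι → Bool) → Prop} {s : Set ι}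
    (hp : DependsOn p s) (h : ∀ i, g.IsTarget i → i ∉ s) : g.Preserves p := by
  intro i hi z b
  refine iff_of_eq (hp fun j hj => Function.update_of_ne (fun e => h i hi ?_) _ _)
  rwa [← e]

theorem dependsOn_bit (c : ι) (b : Bool) : DependsOn (fun z : ι → Bool => z c = b) {c} := by
  intro x y h
  dsimp only
  rw [h c rfl]

theorem QGate.preserves_bit {g : QGate ι} {c : ι} (h : ¬ g.IsTarget c) (b : Bool) :
    g.Preserves fun z => z c = b :=
  QGate.preserves_of_dependsOn (dependsOn_bit c b) fun i hi hic => h (by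
    rw [Set.mem_singleton_iff] at hic; rwa [← hic])

theorem forall_invL {J : Type} {good : QGate J → Prop} (hinv : ∀ g, good g → good g.inv)
    {L : List (QGate J)} (h : ∀ g ∈ L, good g) : ∀ g ∈ invL L, good g := by
  intro g hg
  simp only [invL, List.mem_reverse, List.mem_map] at hg
  obtain ⟨g, hg, rfl⟩ := hg
  exact hinv g (h g hg)

theorem not_touches_invL {J : Type} {L : List (QGate J)} {c : J} (h : ∀ g ∈ L, ¬ g.Touches c) :
    ∀ g ∈ invL L, ¬ g.Touches c :=
  forall_invL (good := fun g => ¬ g.Touches c) (fun g h => by rwa [QGate.touches_inv]) h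

theorem phaseFactor_one : QGate.phaseFactor 1 false = -1 := by
  rw [QGate.phaseFactor, ← Complex.exp_pi_mul_I]
  congr 1
  simp
  ring

theorem op_phase_one_apply (f : ι) (ψ : State ι) (z : ι → Bool) :
    (QGate.phase 1 false f).op ψ z = (if z f then -1 else 1) * ψ z := by
  rw [QGate.op_apply (g := .phase 1 false f) trivial, QGate.act, phaseFactor_one]

/-- A controlled `Z` gate, from a CNOT and two Hadamard gates. -/
def czGates {J : Type} (c f : J) : List (QGate J) := [.had f, .cnot c f, .had f]

theorem opL_czGates {c f : ι} (h : c ≠ f) (ψ : State ι) (z : ι → Bool) :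
    opL (czGates c f) ψ z = (if z c && z f then -1 else 1) * ψ z := by
  have h1 : (QGate.cnot c f).Distinct := h
  have h2 : (QGate.had f).Distinct := trivial
  have e : Function.update z f (z f) = z := Function.update_eq_self f z
  have hs := QGate.sqrt_half_sq
  simp only [czGates, opL_cons, opL_nil, isometry_mul_apply, one_mul]
  rw [QGate.op_apply h2]
  simp only [QGate.act, QGate.op_apply h1, QGate.op_apply h2, Function.update_idem,
    Function.update_self, Function.update_of_ne h]
  generalize ((1 / Real.sqrt 2 : ℝ) : ℂ) = s at *
  cases hc : z c <;> cases hz : z f <;> rw [hz] at e <;>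
    simp only [e, Bool.false_eq_true, Bool.xor_true, Bool.xor_false, Bool.not_true, Bool.not_false,
      Bool.and_true, Bool.and_false, Bool.and_self, if_false, if_true]
  · linear_combination (2 * ψ z) * hs
  · linear_combination (2 * ψ z) * hs
  · linear_combination (2 * ψ z) * hs
  · linear_combination (-2 * ψ z) * hs

/-- The reflection `U⁻¹ Z_f U`, where `U` is the unitary of the circuit `L`. -/
noncomputable def refl (L : List (QGate ι)) (f : ι) : State ι ≃ₗᵢ[ℂ] State ι :=
  (opL L)⁻¹ * (QGate.phase 1 false f).op * opL L

/-- The reflection `refl L f` controlled by the qubit `c`. -/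
def block {J : Type} (L : List (QGate J)) (c f : J) : List (QGate J) := L ++ czGates c f ++ invL L

theorem isometry_inv_apply_self {E : Type*} [NormedAddCommGroup E] [InnerProductSpace ℂ E]
    (f : E ≃ₗᵢ[ℂ] E) (v : E) : f⁻¹ (f v) = v := f.symm_apply_apply v

theorem isometry_apply_inv_self {E : Type*} [NormedAddCommGroup E] [InnerProductSpace ℂ E]
    (f : E ≃ₗᵢ[ℂ] E) (v : E) : f (f⁻¹ v) = v := f.apply_symm_apply v

theorem refl_apply (L : List (QGate ι)) (f : ι) (v : State ι) :
    refl L f v = (opL L)⁻¹ ((QGate.phase 1 false f).op (opL L v)) := rfl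

theorem op_phase_one_op_phase_one (f : ι) (v : State ι) :
    (QGate.phase 1 false f).op ((QGate.phase 1 false f).op v) = v := by
  ext z
  rw [op_phase_one_apply, op_phase_one_apply]
  split_ifs <;> simp

theorem refl_refl (L : List (QGate ι)) (f : ι) (v : State ι) : refl L f (refl L f v) = v := by
  rw [refl_apply, refl_apply, isometry_apply_inv_self, op_phase_one_op_phase_one,
    isometry_inv_apply_self]

theorem op_phase_one_eq (f : ι) (v : State ι) :
    (QGate.phase 1 false f).op v = v - (2 : ℂ) • proj (fun z => z f = true) v := by
  ext z
  rw [op_phase_one_apply]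
  simp only [PiLp.sub_apply, PiLp.smul_apply, proj_apply, smul_eq_mul]
  split_ifs
  · ring
  · ring

theorem refl_eq (L : List (QGate ι)) (f : ι) (v : State ι) :
    refl L f v = v - (2 : ℂ) • (opL L)⁻¹ (proj (fun z => z f = true) (opL L v)) := by
  rw [refl_apply, op_phase_one_eq, map_sub, map_smul, isometry_inv_apply_self]

theorem re_inner_refl (L : List (QGate ι)) (f : ι) (v : State ι) :
    RCLike.re (inner ℂ v (refl L f v)) = ‖v‖ ^ 2 - 2 * ‖proj (fun z => z f = true) (opL L v)‖ ^ 2 := by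
  have h : inner ℂ v (refl L f v) = inner ℂ (opL L v) ((QGate.phase 1 false f).op (opL L v)) := by
    rw [refl_apply, ← LinearIsometryEquiv.inner_map_map (opL L) v, isometry_apply_inv_self]
  have h2 : inner ℂ (opL L v) (proj (fun z => z f = true) (opL L v))
      = inner ℂ (proj (fun z => z f = true) (opL L v)) (proj (fun z => z f = true) (opL L v)) := by
    rw [← inner_proj, proj_proj]
    simp only [and_self]
  rw [h, op_phase_one_eq, inner_sub_right, inner_smul_right, h2, map_sub,
    inner_self_eq_norm_sq (𝕜 := ℂ), LinearIsometryEquiv.norm_map]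
  rw [inner_self_eq_norm_sq_to_K, ← RCLike.ofReal_pow]
  have : ∀ x : ℝ, RCLike.re ((2 : ℂ) * (RCLike.ofReal x : ℂ)) = 2 * x := fun x => by simp
  rw [this]

theorem refl_classical {L : List (QGate ι)} (h : ∀ g ∈ L, g.Distinct ∧ g.IsClassical) (f : ι)
    (v : State ι) : refl L f v = v - (2 : ℂ) • proj (fun z => run L z f = true) v := by
  rw [refl_eq, proj_opL_classical h, isometry_inv_apply_self]

theorem opL_block_of_false {L : List (QGate ι)} {c f : ι} (hcf : c ≠ f)
    (hL : ∀ g ∈ L, ¬ g.IsTarget c) {v : State ι} (hv : v ∈ supp fun z => z c = false) :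
    opL (block L c f) v = v := by
  have h := opL_mem_supp (fun g hg => QGate.preserves_bit (hL g hg) false) hv
  have e : opL (czGates c f) (opL L v) = opL L v := by
    rw [mem_supp_iff] at h
    ext z
    rw [opL_czGates hcf]
    cases hz : z c
    · simp
    · simp [h z (by simp [hz])]
  rw [block, opL_append, opL_append, isometry_mul_apply, isometry_mul_apply, e, opL_invL,
    isometry_inv_apply_self]

theorem opL_block_of_true {L : List (QGate ι)} {c f : ι} (hcf : c ≠ f)
    (hL : ∀ g ∈ L, ¬ g.IsTarget c) {v : State ι} (hv : v ∈ supp fun z => z c = true) :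
    opL (block L c f) v = refl L f v := by
  have h := opL_mem_supp (fun g hg => QGate.preserves_bit (hL g hg) true) hv
  have e : opL (czGates c f) (opL L v) = (QGate.phase 1 false f).op (opL L v) := by
    rw [mem_supp_iff] at h
    ext z
    rw [opL_czGates hcf, op_phase_one_apply]
    cases hz : z c
    · simp [h z (by simp [hz])]
    · simp
  rw [block, opL_append, opL_append, isometry_mul_apply, isometry_mul_apply, e, opL_invL,
    refl_apply]

theorem refl_mem_supp {L : List (QGate ι)} {p : (ι → Bool) → Prop} (h : ∀ g ∈ L, g.Preserves p)
    (f : ι) {v : State ι} (hv : v ∈ supp p) : refl L f v ∈ supp p := by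
  rw [refl_apply]
  refine opL_inv_mem_supp h ?_
  have := opL_mem_supp (L := [QGate.phase 1 false f]) (p := p)
    (fun g hg => by
      rw [List.mem_singleton] at hg; subst hg
      exact fun i hi => hi.elim) (opL_mem_supp h hv)
  simpa using this

theorem refl_not_comm {L : List (QGate ι)} {c f : ι} (hcf : c ≠ f)
    (hL : ∀ g ∈ L, ¬ g.Touches c) (v : State ι) :
    refl L f ((QGate.not c).op v) = (QGate.not c).op (refl L f v) := by
  rw [refl_apply, refl_apply, opL_not_comm hL, QGate.op_not_comm (by exact hcf), ← opL_invL,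
    opL_not_comm (not_touches_invL hL)]

theorem op_not_apply (c : ι) (v : State ι) (z : ι → Bool) :
    (QGate.not c).op v z = v (Function.update z c (!z c)) := by
  rw [QGate.op_apply (g := .not c) trivial, QGate.act]

theorem op_not_mem_supp {c : ι} {v : State ι} {b : Bool} (hv : v ∈ supp fun z => z c = b) :
    (QGate.not c).op v ∈ supp fun z => z c = !b := by
  rw [mem_supp_iff] at *
  intro z hz
  rw [op_not_apply]
  apply hv
  cases b <;> simp_all

theorem op_had_of_false {c : ι} {v : State ι} (hv : v ∈ supp fun z => z c = false) :
    (QGate.had c).op v = ((1 / Real.sqrt 2 : ℝ) : ℂ) • (v + (QGate.not c).op v) := by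
  rw [mem_supp_iff] at hv
  ext z
  rw [QGate.op_apply (g := .had c) trivial, QGate.act]
  simp only [PiLp.smul_apply, PiLp.add_apply, smul_eq_mul, op_not_apply]
  have e : Function.update z c (z c) = z := Function.update_eq_self c z
  congr 1
  cases hz : z c <;> rw [hz] at e
  · rw [e, hv (Function.update z c true) (by simp)]
    simp [hv (Function.update z c true) (by simp)]
  · rw [e, hv z (by simp [hz])]
    simp

theorem op_had_op_not_of_false {c : ι} {v : State ι} (hv : v ∈ supp fun z => z c = false) :
    (QGate.had c).op ((QGate.not c).op v)
      = ((1 / Real.sqrt 2 : ℝ) : ℂ) • (v - (QGate.not c).op v) := by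
  rw [mem_supp_iff] at hv
  ext z
  rw [QGate.op_apply (g := .had c) trivial, QGate.act]
  simp only [PiLp.smul_apply, PiLp.sub_apply, smul_eq_mul, op_not_apply, Function.update_idem,
    Function.update_self]
  have e : Function.update z c (z c) = z := Function.update_eq_self c z
  congr 1
  cases hz : z c <;> rw [hz] at e
  · simp [e, hv (Function.update z c true) (by simp)]
  · simp [e, hv z (by simp [hz])]

/-- One round: interference, on the qubit `c`, of the identity with the square of the product
of the reflections `refl L₁ f₁` and `refl L₂ f₂`. -/
def round {J : Type} (L₁ L₂ : List (QGate J)) (f₁ f₂ : J) (c : J) : List (QGate J) :=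
  .had c :: (block L₂ c f₂ ++ block L₁ c f₁ ++ (block L₂ c f₂ ++ block L₁ c f₁)) ++ [.had c]

variable {L₁ L₂ : List (QGate ι)} {f₁ f₂ : ι}

theorem proj_opL_round {c : ι} (h₁ : ∀ g ∈ L₁, ¬ g.Touches c) (h₂ : ∀ g ∈ L₂, ¬ g.Touches c)
    (hf₁ : c ≠ f₁) (hf₂ : c ≠ f₂) {v : State ι} (hv : v ∈ supp fun z => z c = false) :
    proj (fun z => z c = true) (opL (round L₁ L₂ f₁ f₂ c) v)
      = (QGate.not c).op (passOp (refl L₁ f₁) (refl L₂ f₂) v) := by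
  have t₁ : ∀ g ∈ L₁, ¬ g.IsTarget c := fun g hg hi => h₁ g hg hi.touches
  have t₂ : ∀ g ∈ L₂, ¬ g.IsTarget c := fun g hg hi => h₂ g hg hi.touches
  set w := refl L₁ f₁ (refl L₂ f₂ (refl L₁ f₁ (refl L₂ f₂ v))) with hw
  have m₁ : ∀ (b : Bool) {u : State ι}, (u ∈ supp fun z => z c = b) →
      refl L₁ f₁ u ∈ supp fun z => z c = b := fun b u hu =>
    refl_mem_supp (fun g hg => QGate.preserves_bit (t₁ g hg) b) f₁ hu
  have m₂ : ∀ (b : Bool) {u : State ι}, (u ∈ supp fun z => z c = b) →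
      refl L₂ f₂ u ∈ supp fun z => z c = b := fun b u hu =>
    refl_mem_supp (fun g hg => QGate.preserves_bit (t₂ g hg) b) f₂ hu
  have hw0 : w ∈ supp fun z => z c = false := m₁ _ (m₂ _ (m₁ _ (m₂ _ hv)))
  have hX := op_not_mem_supp hv
  rw [Bool.not_false] at hX
  have e0 : opL (block L₂ c f₂ ++ block L₁ c f₁ ++ (block L₂ c f₂ ++ block L₁ c f₁)) v = v := by
    simp only [opL_append, isometry_mul_apply]
    rw [opL_block_of_false hf₂ t₂ hv, opL_block_of_false hf₁ t₁ hv,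
      opL_block_of_false hf₂ t₂ hv, opL_block_of_false hf₁ t₁ hv]
  have e1 : opL (block L₂ c f₂ ++ block L₁ c f₁ ++ (block L₂ c f₂ ++ block L₁ c f₁))
      ((QGate.not c).op v) = (QGate.not c).op w := by
    simp only [opL_append, isometry_mul_apply]
    rw [opL_block_of_true hf₂ t₂ hX, opL_block_of_true hf₁ t₁ (m₂ _ hX),
      opL_block_of_true hf₂ t₂ (m₁ _ (m₂ _ hX)), opL_block_of_true hf₁ t₁ (m₂ _ (m₁ _ (m₂ _ hX))),
      refl_not_comm hf₂ h₂, refl_not_comm hf₁ h₁, refl_not_comm hf₂ h₂, refl_not_comm hf₁ h₁]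
  have hs := QGate.sqrt_half_sq
  rw [round, opL_append, isometry_mul_apply, opL_cons, opL_nil, one_mul, opL_cons,
    isometry_mul_apply, op_had_of_false hv, map_smul, map_add, e0, e1, map_smul, map_add, op_had_of_false hv,
    op_had_op_not_of_false hw0, passOp_apply, ← hw]
  have p0 : ∀ {u : State ι}, (u ∈ supp fun z => z c = false) →
      proj (fun z => z c = true) u = 0 := fun {u} hu => by
    rw [mem_supp_iff] at hu
    ext z
    rw [proj_apply]
    split_ifs with h
    · exact hu z (by simp [h])
    · rfl
  have p1 : ∀ {u : State ι}, (u ∈ supp fun z => z c = false) →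
      proj (fun z => z c = true) ((QGate.not c).op u) = (QGate.not c).op u := fun {u} hu =>
    op_not_mem_supp hu
  simp only [map_smul, map_add, map_sub, p0 hv, p0 hw0, p1 hv, p1 hw0, zero_add, zero_sub]
  rw [← smul_add, smul_smul, hs, sub_eq_add_neg]

theorem passOp_mem_supp {p : (ι → Bool) → Prop} (h₁ : ∀ g ∈ L₁, g.Preserves p)
    (h₂ : ∀ g ∈ L₂, g.Preserves p) {v : State ι} (hv : v ∈ supp p) :
    passOp (refl L₁ f₁) (refl L₂ f₂) v ∈ supp p := by
  rw [passOp_apply]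
  exact Submodule.smul_mem _ _ (Submodule.sub_mem _ hv (refl_mem_supp h₁ f₁ (refl_mem_supp h₂ f₂
    (refl_mem_supp h₁ f₁ (refl_mem_supp h₂ f₂ hv)))))

theorem forall_block {J : Type} {good : QGate J → Prop} (hinv : ∀ g, good g → good g.inv)
    {L : List (QGate J)} {c f : J} (h : ∀ g ∈ L, good g) (hf : good (.had f))
    (hc : good (.cnot c f)) : ∀ g ∈ block L c f, good g := by
  intro g hg
  simp only [block, czGates, List.mem_append, List.mem_cons, List.not_mem_nil, or_false] at hg
  rcases hg with (hg | rfl | rfl | rfl) | hg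
  · exact h g hg
  · exact hf
  · exact hc
  · exact hf
  · exact forall_invL hinv h g hg

theorem forall_round {J : Type} {good : QGate J → Prop} (hinv : ∀ g, good g → good g.inv)
    {L₁ L₂ : List (QGate J)} {f₁ f₂ c : J} (h₁ : ∀ g ∈ L₁, good g) (h₂ : ∀ g ∈ L₂, good g)
    (hf₁ : good (.had f₁)) (hf₂ : good (.had f₂)) (hc₁ : good (.cnot c f₁))
    (hc₂ : good (.cnot c f₂)) (hc : good (.had c)) : ∀ g ∈ round L₁ L₂ f₁ f₂ c, good g := by
  intro g hg
  simp only [round, List.mem_append, List.mem_cons, List.not_mem_nil, or_false] at hg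
  rcases hg with (rfl | (hg | hg) | (hg | hg)) | rfl
  · exact hc
  · exact forall_block hinv h₂ hf₂ hc₂ g hg
  · exact forall_block hinv h₁ hf₁ hc₁ g hg
  · exact forall_block hinv h₂ hf₂ hc₂ g hg
  · exact forall_block hinv h₁ hf₁ hc₁ g hg
  · exact hc

theorem touches_round {J : Type} {L₁ L₂ : List (QGate J)} {f₁ f₂ c d : J}
    (h₁ : ∀ g ∈ L₁, ¬ g.Touches d) (h₂ : ∀ g ∈ L₂, ¬ g.Touches d) (hf₁ : d ≠ f₁) (hf₂ : d ≠ f₂)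
    (hc : d ≠ c) : ∀ g ∈ round L₁ L₂ f₁ f₂ c, ¬ g.Touches d :=
  forall_round (good := fun g => ¬ g.Touches d) (fun g h => by rwa [QGate.touches_inv]) h₁ h₂ hf₁
    hf₂ (not_or.2 ⟨hc, hf₁⟩) (not_or.2 ⟨hc, hf₂⟩) hc

/-- `N` rounds, each with its own control qubit. -/
def rounds {J : Type} (L₁ L₂ : List (QGate J)) (f₁ f₂ : J) (c : ℕ → J) (N : ℕ) : List (QGate J) :=
  (List.range N).flatMap fun i => round L₁ L₂ f₁ f₂ (c i)

theorem rounds_succ {J : Type} (L₁ L₂ : List (QGate J)) (f₁ f₂ : J) (c : ℕ → J) (N : ℕ) :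
    rounds L₁ L₂ f₁ f₂ c (N + 1) = rounds L₁ L₂ f₁ f₂ c N ++ round L₁ L₂ f₁ f₂ (c N) := by
  rw [rounds, List.range_succ, List.flatMap_append, List.flatMap_singleton]; rfl

theorem dependsOn_forall {α : Type*} (c : α → ι) (q : α → Prop) (b : Bool) :
    DependsOn (fun z : ι → Bool => ∀ i, q i → z (c i) = b) {j | ∃ i, q i ∧ c i = j} := by
  intro x y h
  refine propext (forall_congr' fun i => imp_congr_right fun hi => ?_)
  rw [h (c i) ⟨i, hi, rfl⟩]

/-- The component of the final state in which all rounds end with a one. -/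
theorem proj_opL_rounds {c : ℕ → ι} {N : ℕ} (hc : ∀ i < N, ∀ j < N, c i = c j → i = j)
    (h₁ : ∀ i < N, ∀ g ∈ L₁, ¬ g.Touches (c i)) (h₂ : ∀ i < N, ∀ g ∈ L₂, ¬ g.Touches (c i))
    (hf₁ : ∀ i < N, c i ≠ f₁) (hf₂ : ∀ i < N, c i ≠ f₂) {v : State ι}
    (hv : ∀ i < N, v ∈ supp fun z => z (c i) = false) :
    proj (fun z => ∀ i, i < N → z (c i) = true) (opL (rounds L₁ L₂ f₁ f₂ c N) v)
      = opL ((List.range N).map fun i => .not (c i))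
        ((passOp (refl L₁ f₁) (refl L₂ f₂))^[N] v) := by
  induction N with
  | zero =>
    ext z
    rw [proj_apply, if_pos (by intro i hi; omega)]
    rfl
  | succ N ih =>
    have ih := ih (fun i hi j hj => hc i (by omega) j (by omega)) (fun i hi => h₁ i (by omega))
      (fun i hi => h₂ i (by omega)) (fun i hi => hf₁ i (by omega)) (fun i hi => hf₂ i (by omega))
      (fun i hi => hv i (by omega))
    have hlt : N < N + 1 := N.lt_succ_self
    have hne : ∀ i < N, c i ≠ c N := fun i hi h => by
      have := hc i (by omega) N hlt h; omega
    set u := (passOp (refl L₁ f₁) (refl L₂ f₂))^[N] v with hu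
    have hu0 : u ∈ supp fun z => z (c N) = false := by
      have : ∀ j, (passOp (refl L₁ f₁) (refl L₂ f₂))^[j] v ∈ supp fun z => z (c N) = false := by
        intro j
        induction j with
        | zero => exact hv N hlt
        | succ j ihj =>
          rw [Function.iterate_succ_apply']
          exact passOp_mem_supp
            (fun g hg => QGate.preserves_bit (fun h => h₁ N hlt g hg h.touches) false)
            (fun g hg => QGate.preserves_bit (fun h => h₂ N hlt g hg h.touches) false) ihj
      exact this N
    have hsplit : (fun z : ι → Bool => ∀ i, i < N + 1 → z (c i) = true)
        = fun z => z (c N) = true ∧ ∀ i, i < N → z (c i) = true := by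
      funext z
      simp only [Nat.lt_succ_iff_lt_or_eq, or_imp, forall_and, forall_eq]
      rw [and_comm]
    have hpres : ∀ g ∈ round L₁ L₂ f₁ f₂ (c N),
        g.Preserves fun z => ∀ i, i < N → z (c i) = true := fun g hg =>
      QGate.preserves_of_dependsOn (dependsOn_forall c (fun i => i < N) true) (by
        rintro _ hi ⟨i, hiN, rfl⟩
        exact touches_round (h₁ i (by omega)) (h₂ i (by omega)) (hf₁ i (by omega))
          (hf₂ i (by omega)) (hne i hiN) g hg hi.touches)
    have hcomm : ∀ (n : ℕ), n ≤ N → ∀ w : State ι,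
        opL (round L₁ L₂ f₁ f₂ (c N)) (opL ((List.range n).map fun i => .not (c i)) w)
          = opL ((List.range n).map fun i => .not (c i)) (opL (round L₁ L₂ f₁ f₂ (c N)) w) := by
      intro n
      induction n with
      | zero => intro _ w; rfl
      | succ n ihn =>
        intro hn w
        have hn' : n < N + 1 := by omega
        rw [List.range_succ, List.map_append, opL_append, isometry_mul_apply, isometry_mul_apply,
          ← ihn (by omega), List.map_singleton, opL_cons, opL_nil, one_mul,
          opL_not_comm (touches_round (h₁ n hn') (h₂ n hn') (hf₁ n hn') (hf₂ n hn')
            (hne n (by omega)))]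
    have hpX : ∀ g ∈ (List.range N).map (fun i => QGate.not (c i)),
        g.Preserves fun z => z (c N) = true := by
      intro g hg
      simp only [List.mem_map, List.mem_range] at hg
      obtain ⟨i, hi, rfl⟩ := hg
      exact QGate.preserves_bit (g := .not (c i)) (fun h : c N = c i => hne i hi h.symm) true
    rw [rounds_succ, opL_append, isometry_mul_apply, hsplit, ← proj_proj, proj_opL hpres, ih,
      hcomm N le_rfl, proj_opL hpX, proj_opL_round (h₁ N hlt) (h₂ N hlt) (hf₁ N hlt) (hf₂ N hlt) hu0,
      List.range_succ, List.map_append, opL_append, isometry_mul_apply,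
      Function.iterate_succ_apply', ← hu, List.map_singleton, opL_cons, opL_nil, one_mul]
    refine opL_not_comm (fun g hg => ?_) _
    simp only [List.mem_map, List.mem_range] at hg
    obtain ⟨i, hi, rfl⟩ := hg
    exact fun h : c N = c i => hne i hi h.symm

theorem forall_rounds {J : Type} {good : QGate J → Prop} (hinv : ∀ g, good g → good g.inv)
    {L₁ L₂ : List (QGate J)} {f₁ f₂ : J} {c : ℕ → J} {N : ℕ} (h₁ : ∀ g ∈ L₁, good g)
    (h₂ : ∀ g ∈ L₂, good g) (hf₁ : good (.had f₁)) (hf₂ : good (.had f₂))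
    (hc₁ : ∀ i < N, good (.cnot (c i) f₁)) (hc₂ : ∀ i < N, good (.cnot (c i) f₂))
    (hc : ∀ i < N, good (.had (c i))) : ∀ g ∈ rounds L₁ L₂ f₁ f₂ c N, good g := by
  intro g hg
  simp only [rounds, List.mem_flatMap, List.mem_range] at hg
  obtain ⟨i, hi, hg⟩ := hg
  exact forall_round hinv h₁ h₂ hf₁ hf₂ (hc₁ i hi) (hc₂ i hi) (hc i hi) g hg

/-- The probability that all rounds end with a one. -/
theorem norm_proj_opL_rounds {c : ℕ → ι} {N : ℕ} (hc : ∀ i < N, ∀ j < N, c i = c j → i = j)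
    (h₁ : ∀ i < N, ∀ g ∈ L₁, ¬ g.Touches (c i)) (h₂ : ∀ i < N, ∀ g ∈ L₂, ¬ g.Touches (c i))
    (hf₁ : ∀ i < N, c i ≠ f₁) (hf₂ : ∀ i < N, c i ≠ f₂) {v : State ι}
    (hv : ∀ i < N, v ∈ supp fun z => z (c i) = false) :
    ‖proj (fun z => ∀ i, i < N → z (c i) = true) (opL (rounds L₁ L₂ f₁ f₂ c N) v)‖
      = ‖(passOp (refl L₁ f₁) (refl L₂ f₂))^[N] v‖ := by
  rw [proj_opL_rounds hc h₁ h₂ hf₁ hf₂ hv, LinearIsometryEquiv.norm_map]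

end

/-! ### The interference test for the phase -/

section
variable {ι : Type} [Fintype ι] [DecidableEq ι]

/-- The number whose binary digits are the bits `k 0, …, k (t - 1)`, the least significant first. -/
def value {J : Type} (k : ℕ → J) (t : ℕ) (z : J → Bool) : ℕ :=
  ∑ j ∈ Finset.range t, if z (k j) then 2 ^ j else 0

theorem value_succ {J : Type} (k : ℕ → J) (t : ℕ) (z : J → Bool) :
    value k (t + 1) z = value k t z + if z (k t) then 2 ^ t else 0 := Finset.sum_range_succ _ _

theorem value_congr {J : Type} {k : ℕ → J} {t : ℕ} {z w : J → Bool}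
    (h : ∀ j < t, z (k j) = w (k j)) : value k t z = value k t w :=
  Finset.sum_congr rfl fun j hj => by rw [h j (Finset.mem_range.1 hj)]

/-- The controlled phase gate with phase `2π / 2 ^ e`. -/
def cphase {J : Type} (e : ℕ) (x y : J) : List (QGate J) :=
  [.phase (e + 1) false x, .phase (e + 1) false y, .cnot x y, .phase (e + 1) true y, .cnot x y]

theorem phaseFactor_mul_self (e : ℕ) :
    QGate.phaseFactor (e + 1) false * QGate.phaseFactor (e + 1) false
      = QGate.phaseFactor e false := by
  rw [QGate.phaseFactor, QGate.phaseFactor, ← Complex.exp_add, pow_succ]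
  congr 1
  simp
  ring

theorem opL_cphase (e : ℕ) {x y : ι} (h : x ≠ y) (ψ : State ι) (z : ι → Bool) :
    opL (cphase e x y) ψ z = (if z x && z y then QGate.phaseFactor e false else 1) * ψ z := by
  have h1 : (QGate.cnot x y).Distinct := h
  have hp : ∀ b i, (QGate.phase (e + 1) b i : QGate ι).Distinct := fun _ _ => trivial
  have hu : Function.update z y (z y) = z := Function.update_eq_self y z
  have hm := QGate.phaseFactor_mul (e + 1) false
  have hs := phaseFactor_mul_self e
  rw [Bool.not_false] at hm
  simp only [cphase, opL_cons, opL_nil, isometry_mul_apply, one_mul]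
  simp only [QGate.op_apply h1, QGate.op_apply (hp _ _), QGate.act, Function.update_idem,
    Function.update_self, Function.update_of_ne h]
  cases hx : z x <;> cases hy : z y <;> rw [hy] at hu <;> simp [hu]
  · rw [← mul_assoc, hm, one_mul]
  · rw [← mul_assoc, hm, one_mul]
  · rw [← hs, mul_assoc]

/-- Phase gates on `y` that together have the phase `2π K / 2 ^ t`, where `K` is the value of the
bits `k j`. -/
def phaseTest {J : Type} (t : ℕ) (k : ℕ → J) (y : J) : List (QGate J) :=
  (List.range t).flatMap fun j => cphase (t - j) (k j) y

theorem opL_phaseTest {t : ℕ} {k : ℕ → ι} {y : ι} (h : ∀ j < t, k j ≠ y) (ψ : State ι)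
    (z : ι → Bool) : opL (phaseTest t k y) ψ z =
      (if z y then Complex.exp ((2 * (Real.pi * (value k t z / 2 ^ t)) : ℝ) * Complex.I) else 1)
        * ψ z := by
  have key : ∀ n ≤ t, opL ((List.range n).flatMap fun j => cphase (t - j) (k j) y) ψ z =
      (if z y then Complex.exp ((2 * (Real.pi * (value k n z / 2 ^ t)) : ℝ) * Complex.I) else 1)
        * ψ z := by
    intro n
    induction n with
    | zero => intro _; simp [value]
    | succ n ih =>
      intro hn
      rw [List.range_succ, List.flatMap_append, opL_append, isometry_mul_apply,
        List.flatMap_singleton, opL_cphase _ (h n (by omega)), ih (by omega), value_succ]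
      cases hx : z (k n) <;> cases hy : z y <;>
        simp only [Bool.and_true, Bool.and_false, Bool.false_eq_true, if_true, if_false, one_mul,
          add_zero]
      rw [← mul_assoc]
      congr 1
      rw [QGate.phaseFactor, ← Complex.exp_add]
      congr 1
      have e : (2 : ℂ) ^ t = 2 ^ (t - n) * 2 ^ n := by rw [← pow_add]; congr 1; omega
      push_cast
      rw [e]
      field_simp
      ring
  exact key t le_rfl

/-- The test whether the phase `K / 2 ^ t` fits the acceptance probability at the qubit `out`: with
equal probabilities, either `out` is copied to `f` or `f` is set with probability
`sin² (π K / 2 ^ t)`. -/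
def testGates {J : Type} (t : ℕ) (k : ℕ → J) (coin y f out : J) : List (QGate J) :=
  ([.had coin, .had y] ++ phaseTest t k y ++ [.had y]) ++
    [.toffoli coin y f, .not coin, .toffoli coin out f]

theorem norm_sq_one_sub_exp (x : ℝ) :
    ‖1 - Complex.exp ((2 * x : ℝ) * Complex.I)‖ ^ 2 = 4 * Real.sin x ^ 2 := by
  rw [Complex.exp_mul_I, Complex.sq_norm, Complex.normSq_apply, ← Complex.ofReal_cos,
    ← Complex.ofReal_sin]
  have h1 := Real.sin_sq_add_cos_sq (2 * x)
  have h2 := Real.cos_two_mul x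
  have h3 := Real.sin_sq_add_cos_sq x
  generalize Real.cos (2 * x) = a at *
  generalize Real.sin (2 * x) = b at *
  simp
  nlinarith

theorem norm_sq_one_add_exp (x : ℝ) :
    ‖1 + Complex.exp ((2 * x : ℝ) * Complex.I)‖ ^ 2 = 4 * Real.cos x ^ 2 := by
  rw [Complex.exp_mul_I, Complex.sq_norm, Complex.normSq_apply, ← Complex.ofReal_cos,
    ← Complex.ofReal_sin]
  have h1 := Real.sin_sq_add_cos_sq (2 * x)
  have h2 := Real.cos_two_mul x
  have h3 := Real.sin_sq_add_cos_sq x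
  generalize Real.cos (2 * x) = a at *
  generalize Real.sin (2 * x) = b at *
  simp
  nlinarith

open Classical in
/-- The test succeeds with probability `1 / 2` plus half the mean of `[out] - cos² (π K / 2 ^ t)`. -/
theorem norm_proj_test {t : ℕ} {k : ℕ → ι} {coin y f out : ι} (hk : ∀ j < t, k j ≠ y)
    (hk' : ∀ j < t, k j ≠ coin) (h1 : coin ≠ y) (h2 : coin ≠ f) (h3 : coin ≠ out) (h4 : y ≠ f)
    (h5 : y ≠ out) (h6 : f ≠ out) {φ : State ι}
    (hc : φ ∈ supp fun z => z coin = false) (hy : φ ∈ supp fun z => z y = false)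
    (hf : φ ∈ supp fun z => z f = false) :
    4 * ‖proj (fun z => z f = true) (opL (testGates t k coin y f out) φ)‖ ^ 2 - 2 * ‖φ‖ ^ 2
      = 2 * ∑ z, ((if z out then 1 else 0) - Real.cos (Real.pi * (value k t z / 2 ^ t)) ^ 2)
          * ‖φ z‖ ^ 2 := by
  set D : List (QGate ι) := [.had coin, .had y] ++ phaseTest t k y ++ [.had y] with hD
  set χ := opL D φ with hχ
  have hfχ : χ ∈ supp fun z => z f = false := by
    refine opL_mem_supp (fun g hg => QGate.preserves_bit (fun hi => ?_) false) hf
    simp only [hD, phaseTest, cphase, List.mem_append, List.mem_flatMap, List.mem_cons,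
      List.not_mem_nil, or_false] at hg
    rcases hg with ((rfl | rfl) | ⟨j, -, rfl | rfl | rfl | rfl | rfl⟩) | rfl
    · exact h2 (Eq.symm hi)
    · exact h4 (Eq.symm hi)
    · exact hi
    · exact hi
    · exact h4 (Eq.symm hi)
    · exact hi
    · exact h4 (Eq.symm hi)
    · exact h4 (Eq.symm hi)
  have hcl : ∀ g ∈ ([.toffoli coin y f, .not coin, .toffoli coin out f] : List (QGate ι)),
      g.Distinct ∧ g.IsClassical := by
    intro g hg
    simp only [List.mem_cons, List.not_mem_nil, or_false] at hg
    rcases hg with rfl | rfl | rfl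
    · exact ⟨⟨h1, h2, h4⟩, trivial⟩
    · exact ⟨trivial, trivial⟩
    · exact ⟨⟨h3, h2, Ne.symm h6⟩, trivial⟩
  have e1 : ‖proj (fun z => z f = true) (opL (testGates t k coin y f out) φ)‖ ^ 2
      = ∑ z, if (if z coin then z y else z out) then ‖χ z‖ ^ 2 else 0 := by
    rw [testGates, opL_append, isometry_mul_apply, ← hD, ← hχ, proj_opL_classical hcl,
      LinearIsometryEquiv.norm_map, norm_proj_sq]
    refine Finset.sum_congr rfl fun z _ => ?_
    cases hz : z f
    · have : run [.toffoli coin y f, .not coin, .toffoli coin out f] z f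
          = if z coin then z y else z out := by
        simp only [run, QGate.flip]
        cases hzc : z coin <;> simp [h2, h2.symm, h3.symm, h6.symm, hz, hzc]
      rw [this]
      congr
    · rw [mem_supp_iff] at hfχ
      simp [hfχ z (by simp [hz])]
  have e2 : ∀ z, χ z = ((1 / Real.sqrt 2 : ℝ) : ℂ) * (1 / 2) *
      (1 + (if z y then -1 else 1) *
        Complex.exp ((2 * (Real.pi * (value k t z / 2 ^ t)) : ℝ) * Complex.I)) *
      φ (Function.update (Function.update z y false) coin false) := by
    intro z
    have hdc : (QGate.had coin).Distinct := trivial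
    have hdy : (QGate.had y).Distinct := trivial
    have hv : ∀ b, value k t (Function.update z y b) = value k t z := fun b =>
      value_congr fun j hj => Function.update_of_ne (hk j hj) _ _
    rw [mem_supp_iff] at hc hy
    have hφ1 : ∀ w, φ (Function.update w coin true) = 0 := fun w => hc _ (by simp)
    have hφ2 : φ (Function.update (Function.update z y true) coin false) = 0 := hy _ (by
      simp [h1.symm])
    have hs := QGate.sqrt_half_sq
    rw [hχ, hD, opL_append, opL_append]
    simp only [isometry_mul_apply, opL_cons, opL_nil, one_mul]
    rw [QGate.op_apply hdy]
    simp only [QGate.act, opL_phaseTest hk, hv, Function.update_self]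
    simp only [QGate.op_apply hdy, QGate.act, QGate.op_apply hdc, Function.update_idem,
      Function.update_self, hφ1, hφ2]
    generalize ((1 / Real.sqrt 2 : ℝ) : ℂ) = s at *
    generalize Complex.exp _ = w
    simp only [Bool.false_eq_true, if_false, if_true, mul_zero, add_zero]
    linear_combination (s * (1 + (if z y = true then -1 else 1) * w) *
      φ (Function.update (Function.update z y false) coin false)) * hs
  have e3 : ∀ z, z coin = false → z y = false → ∀ b b' : Bool,
      ‖χ (Function.update (Function.update z y b) coin b')‖ ^ 2
        = 1 / 2 * (if b then Real.sin (Real.pi * (value k t z / 2 ^ t)) ^ 2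
          else Real.cos (Real.pi * (value k t z / 2 ^ t)) ^ 2) * ‖φ z‖ ^ 2 := by
    intro z hzc hzy b b'
    have hz : Function.update (Function.update (Function.update (Function.update z y b) coin b')
        y false) coin false = z := by
      funext x
      simp only [Function.update_apply]
      split_ifs <;> simp_all
    have hv : value k t (Function.update (Function.update z y b) coin b') = value k t z :=
      value_congr fun j hj => by
        rw [Function.update_of_ne (hk' j hj), Function.update_of_ne (hk j hj)]
    rw [e2, hv, hz]
    have h2' : ‖((1 / Real.sqrt 2 : ℝ) : ℂ)‖ ^ 2 = 1 / 2 := by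
      rw [Complex.norm_real, Real.norm_eq_abs, sq_abs, div_pow, one_pow, Real.sq_sqrt (by norm_num)]
    have h4' : ‖(1 / 2 : ℂ)‖ ^ 2 = 1 / 4 := by norm_num
    rw [norm_mul, norm_mul, norm_mul, mul_pow, mul_pow, mul_pow, h2', h4']
    cases b
    · simp only [Function.update_of_ne h1.symm, Function.update_self, Bool.false_eq_true, if_false,
        one_mul, norm_sq_one_add_exp]
      ring
    · simp only [Function.update_of_ne h1.symm, Function.update_self, if_true, neg_one_mul,
        ← sub_eq_add_neg, norm_sq_one_sub_exp]
      ring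
  have e4 : ∑ z, (if (if z coin then z y else z out) then ‖χ z‖ ^ 2 else 0)
      = ∑ z, (1 / 2 * (Real.sin (Real.pi * (value k t z / 2 ^ t)) ^ 2
          + if z out then 1 else 0)) * ‖φ z‖ ^ 2 := by
    rw [sum_split coin, sum_split y]
    refine Finset.sum_congr rfl fun z _ => ?_
    rw [mem_supp_iff] at hc hy
    cases hzy : z y
    swap
    · simp [hy z (by simp [hzy])]
    cases hzc : z coin
    swap
    · simp [hc z (by simp [hzc]), hzc, h1]
    have a00 := e3 z hzc hzy false false
    have a01 := e3 z hzc hzy false true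
    have a10 := e3 z hzc hzy true false
    have a11 := e3 z hzc hzy true true
    have u1 : Function.update z y false = z := by rw [← hzy, Function.update_eq_self]
    have u2 : Function.update z coin false = z := by rw [← hzc, Function.update_eq_self]
    have u3 : Function.update (Function.update z y true) coin false = Function.update z y true := by
      rw [← Function.update_comm h1, u2]
    rw [u1, u2] at a00
    rw [u3] at a10
    have hsc := Real.sin_sq_add_cos_sq (Real.pi * (value k t z / 2 ^ t))
    simp only [hzy, hzc, Bool.false_eq_true, if_false, Function.update_self,
      Function.update_of_ne h1, Function.update_of_ne h1.symm, Function.update_of_ne h3.symm,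
      Function.update_of_ne h5.symm, if_true, a00, a10, a11, add_zero]
    split_ifs
    · linear_combination (1 / 2 * ‖φ z‖ ^ 2) * hsc
    · ring
  rw [e1, e4, EuclideanSpace.norm_sq_eq, Finset.mul_sum, Finset.mul_sum, Finset.mul_sum,
    ← Finset.sum_sub_distrib]
  refine Finset.sum_congr rfl fun z _ => ?_
  have hsc := Real.sin_sq_add_cos_sq (Real.pi * (value k t z / 2 ^ t))
  linear_combination (2 * ‖φ z‖ ^ 2) * hsc

/-! ### Chains of classical gates -/

/-- The values of a recursion `x (j + 1) = F j (x j) (u j)`. -/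
def chainVal (F : ℕ → Bool → Bool → Bool) (u : ℕ → Bool) (x : Bool) : ℕ → Bool
  | 0 => x
  | n + 1 => F n (chainVal F u x n) (u n)

/-- Gates that compute a recursion whose values are stored in the bits `a j`. -/
theorem run_chain {blk : ℕ → List (QGate ι)} {F : ℕ → Bool → Bool → Bool} {a q : ℕ → ι} {n : ℕ}
    (ha : ∀ i ≤ n, ∀ j ≤ n, a i = a j → i = j) (hq : ∀ j < n, ∀ i ≤ n, q j ≠ a i)
    (hb : ∀ j < n, ∀ z, run (blk j) z
      = Function.update z (a (j + 1)) (Bool.xor (z (a (j + 1))) (F j (z (a j)) (z (q j)))))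
    {z : ι → Bool} (hz : ∀ j < n, z (a (j + 1)) = false) :
    run ((List.range n).flatMap blk) z (a n) = chainVal F (fun j => z (q j)) (z (a 0)) n ∧
      ∀ y, (∀ j < n, y ≠ a (j + 1)) → run ((List.range n).flatMap blk) z y = z y := by
  induction n with
  | zero => exact ⟨rfl, fun _ _ => rfl⟩
  | succ n ih =>
    obtain ⟨ih1, ih2⟩ := ih (fun i hi j hj => ha i (by omega) j (by omega))
      (fun j hj i hi => hq j (by omega) i (by omega)) (fun j hj => hb j (by omega))
      (fun j hj => hz j (by omega))
    rw [List.range_succ, List.flatMap_append, run_append, List.flatMap_singleton,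
      hb n (by omega)]
    constructor
    · rw [Function.update_self, ih1, ih2 (a (n + 1)), ih2 (q n), hz n (by omega), Bool.false_xor]
      · rfl
      · exact fun j hj => hq n (by omega) (j + 1) (by omega)
      · intro j hj h
        have := ha _ (by omega) _ (by omega) h
        omega
    · intro y hy
      rw [Function.update_of_ne (hy n (by omega)), ih2 y fun j hj => hy j (by omega)]

theorem chainVal_and (u : ℕ → Bool) (x : Bool) (n : ℕ) :
    chainVal (fun _ x y => x && y) u x n = true ↔ x = true ∧ ∀ j < n, u j = true := by
  induction n with
  | zero => simp [chainVal]
  | succ n ih =>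
    simp only [chainVal, Bool.and_eq_true, ih, Nat.lt_succ_iff_lt_or_eq, or_imp, forall_and,
      forall_eq, and_assoc]

theorem chainVal_and_not (u : ℕ → Bool) (x : Bool) (n : ℕ) :
    chainVal (fun _ x y => x && !y) u x n = true ↔ x = true ∧ ∀ j < n, u j = false := by
  induction n with
  | zero => simp [chainVal]
  | succ n ih =>
    simp only [chainVal, Bool.and_eq_true, ih, Nat.lt_succ_iff_lt_or_eq, or_imp, forall_and,
      forall_eq, and_assoc, Bool.not_eq_true']

/-- The `j`-th digit of a number given by the list of its digits. -/
def digit (l : List Bool) (j : ℕ) : Bool := (l.drop j).headD false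

theorem sum_digit_lt (u : ℕ → Bool) (n : ℕ) :
    (∑ j ∈ Finset.range n, if u j then 2 ^ j else 0) < 2 ^ n := by
  induction n with
  | zero => simp
  | succ n ih =>
    rw [Finset.sum_range_succ, pow_succ]
    split_ifs <;> omega

/-- Comparison of two numbers, digit by digit from the least significant one. -/
theorem chainVal_compare (κ : ℕ → Bool) (u : ℕ → Bool) (n : ℕ) :
    chainVal (fun j x y => if κ j then x && y else x || y) u false n = true ↔
      (∑ j ∈ Finset.range n, if κ j then 2 ^ j else 0)
        < ∑ j ∈ Finset.range n, if u j then 2 ^ j else 0 := by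
  induction n with
  | zero => simp [chainVal]
  | succ n ih =>
    have h1 := sum_digit_lt κ n
    have h2 := sum_digit_lt u n
    rw [chainVal, Finset.sum_range_succ, Finset.sum_range_succ]
    cases hk : κ n <;> cases hu : u n <;>
      simp only [Bool.false_eq_true, if_false, if_true, Bool.and_true, Bool.or_false, Bool.and_false,
        Bool.or_true, ih, add_zero, true_iff, false_iff] <;> omega

theorem bval_eq_sum_digit (l : List Bool) :
    bval l = ∑ j ∈ Finset.range l.length, if digit l j then 2 ^ j else 0 := by
  induction l with
  | nil => rfl
  | cons b l ih =>
    rw [List.length_cons, Finset.sum_range_succ', bval, ih, Finset.mul_sum]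
    have h0 : digit (b :: l) 0 = b := rfl
    have h1 : ∀ j, digit (b :: l) (j + 1) = digit l j := fun _ => rfl
    rw [h0, add_comm]
    congr 1
    · refine Finset.sum_congr rfl fun j _ => ?_
      rw [h1, mul_ite, mul_zero, pow_succ, mul_comm]
    · cases b <;> rfl

end

/-! ### The amplified circuit -/

/-- The data from which the amplified circuit is built: a circuit with `n` witness qubits and `m`
ancillae, the number `t` of digits of the phase, the number `N` of rounds, and the digits `κ` of the
largest phase that is accepted. -/
structure Params : Type where
  t : ℕ
  n : ℕ
  m : ℕ
  N : ℕ
  κ : List Bool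
  out : ℕ
  gates : List (QGate ℕ)

namespace Params

variable (P : Params) {J J' : Type} (e : ℕ → J)

/-- The number of qubits of the amplified circuit.  They are, in this order: `t` qubits for the
phase, the `n + m` qubits of the given circuit, a coin, the target of the phase test, its result,
`m + 4` qubits for the comparison of the ancillae with zero, `N` control qubits of the rounds,
`t + 1` qubits for the comparison of the phase with `κ` and `N + 1` qubits for the conjunction of
the results.  The argument `e` of the circuits below labels the qubits. -/
def total : ℕ := 2 * P.t + P.n + 2 * P.m + 2 * P.N + 9

/-- The given circuit, on the qubits from `t` on. -/
def shifted : List (QGate J) := P.gates.map (QGate.map fun i => e (P.t + i))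

/-- The given circuit followed by the test of the phase. -/
def test : List (QGate J) :=
  P.shifted e ++ testGates P.t e (e (P.t + P.n + P.m)) (e (P.t + P.n + P.m + 1))
    (e (P.t + P.n + P.m + 2)) (e (P.t + P.out))

/-- One step of the comparison of the ancillae with zero. -/
def zeroStep (j : ℕ) : List (QGate J) :=
  [.cnot (e (P.t + P.n + P.m + 3 + j)) (e (P.t + P.n + P.m + 3 + (j + 1))),
    .toffoli (e (P.t + P.n + P.m + 3 + j)) (e (P.t + P.n + j))
      (e (P.t + P.n + P.m + 3 + (j + 1)))]

/-- The comparison of the ancillae with zero. -/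
def zeroCheck : List (QGate J) :=
  .not (e (P.t + P.n + P.m + 3)) :: (List.range (P.m + 3)).flatMap (P.zeroStep e)

/-- The rounds of the amplified circuit. -/
def amplify : List (QGate J) :=
  rounds (P.zeroCheck e) (P.test e) (e (P.t + P.n + P.m + 3 + (P.m + 3)))
    (e (P.t + P.n + P.m + 2)) (fun i => e (P.t + P.n + 2 * P.m + 7 + i)) P.N

/-- One step of the comparison of the phase with `κ`. -/
def compareStep (j : ℕ) : List (QGate J) :=
  .toffoli (e (P.t + P.n + 2 * P.m + P.N + 7 + j)) (e j)
      (e (P.t + P.n + 2 * P.m + P.N + 7 + (j + 1))) ::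
    bif digit P.κ j then [] else
      [.cnot (e (P.t + P.n + 2 * P.m + P.N + 7 + j)) (e (P.t + P.n + 2 * P.m + P.N + 7 + (j + 1))),
        .cnot (e j) (e (P.t + P.n + 2 * P.m + P.N + 7 + (j + 1)))]

/-- The comparison of the phase with `κ`. -/
def compare : List (QGate J) :=
  (List.range P.t).flatMap (P.compareStep e) ++
    [.not (e (2 * P.t + P.n + 2 * P.m + P.N + 8)),
      .cnot (e (P.t + P.n + 2 * P.m + P.N + 7 + P.t)) (e (2 * P.t + P.n + 2 * P.m + P.N + 8))]

/-- One step of the conjunction of the results. -/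
def andStep (i : ℕ) : List (QGate J) :=
  [.toffoli (e (2 * P.t + P.n + 2 * P.m + P.N + 8 + i)) (e (P.t + P.n + 2 * P.m + 7 + i))
    (e (2 * P.t + P.n + 2 * P.m + P.N + 8 + (i + 1)))]

/-- The classical evaluation of the results. -/
def final : List (QGate J) := P.compare e ++ (List.range P.N).flatMap (P.andStep e)

/-- The amplified circuit. -/
def circuit : List (QGate J) := P.amplify e ++ P.final e

/-- The given circuit is well formed. -/
structure Valid : Prop where
  out_lt : P.out < P.n + P.m
  distinct : ∀ g ∈ P.gates, g.Distinct
  bound : ∀ g ∈ P.gates, ∀ i, g.Touches i → i < P.n + P.m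

end Params

section
variable {J J' J'' : Type}

theorem QGate.map_map (e : J → J') (e' : J' → J'') (g : QGate J) :
    (g.map e).map e' = g.map (e' ∘ e) := by cases g <;> rfl

theorem QGate.map_inv (e : J → J') (g : QGate J) : (g.map e).inv = g.inv.map e := by
  cases g <;> rfl

theorem QGate.isTarget_map {e : J → J'} {g : QGate J} {x : J'} (h : (g.map e).IsTarget x) :
    ∃ j, g.IsTarget j ∧ x = e j := by
  cases g with
  | not j => exact ⟨j, rfl, h⟩
  | had j => exact ⟨j, rfl, h⟩
  | phase k b j => exact h.elim
  | cnot c j => exact ⟨j, rfl, h⟩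
  | toffoli c d j => exact ⟨j, rfl, h⟩

theorem QGate.touches_map {e : J → J'} {g : QGate J} {x : J'} (h : (g.map e).Touches x) :
    ∃ j, g.Touches j ∧ x = e j := by
  cases g with
  | not j => exact ⟨j, rfl, h⟩
  | had j => exact ⟨j, rfl, h⟩
  | phase k b j => exact ⟨j, rfl, h⟩
  | cnot c j =>
    rcases h with h | h
    · exact ⟨c, Or.inl rfl, h⟩
    · exact ⟨j, Or.inr rfl, h⟩
  | toffoli c d j =>
    rcases h with h | h | h
    · exact ⟨c, Or.inl rfl, h⟩
    · exact ⟨d, Or.inr (Or.inl rfl), h⟩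
    · exact ⟨j, Or.inr (Or.inr rfl), h⟩

theorem QGate.distinct_map_of_injOn {e : J → J'} {g : QGate J}
    (he : ∀ i j, g.Touches i → g.Touches j → e i = e j → i = j) (hg : g.Distinct) :
    (g.map e).Distinct := by
  cases g with
  | not j => trivial
  | had j => trivial
  | phase k b j => trivial
  | cnot c j => exact fun h => hg (he c j (Or.inl rfl) (Or.inr rfl) h)
  | toffoli c d j =>
    exact ⟨fun h => hg.1 (he c d (Or.inl rfl) (Or.inr (Or.inl rfl)) h),
      fun h => hg.2.1 (he c j (Or.inl rfl) (Or.inr (Or.inr rfl)) h),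
      fun h => hg.2.2 (he d j (Or.inr (Or.inl rfl)) (Or.inr (Or.inr rfl)) h)⟩

theorem map_invL (e : J → J') (L : List (QGate J)) :
    (invL L).map (QGate.map e) = invL (L.map (QGate.map e)) := by
  simp [invL, Function.comp_def, QGate.map_inv]

theorem map_block (e : J → J') (L : List (QGate J)) (c f : J) :
    (block L c f).map (QGate.map e) = block (L.map (QGate.map e)) (e c) (e f) := by
  simp [block, czGates, map_invL, QGate.map]

theorem map_rounds (e : J → J') (L₁ L₂ : List (QGate J)) (f₁ f₂ : J) (c : ℕ → J) (N : ℕ) :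
    (rounds L₁ L₂ f₁ f₂ c N).map (QGate.map e)
      = rounds (L₁.map (QGate.map e)) (L₂.map (QGate.map e)) (e f₁) (e f₂) (fun i => e (c i)) N := by
  simp [rounds, round, List.map_flatMap, map_block, QGate.map]

end

namespace Params

variable (P : Params) {J : Type} (e : ℕ → J)

theorem map_test : (P.test id).map (QGate.map e) = P.test e := by
  simp [test, shifted, testGates, phaseTest, cphase, List.map_flatMap, QGate.map,
    Function.comp_def]
  exact fun g _ => by cases g <;> rfl

theorem map_zeroCheck : (P.zeroCheck id).map (QGate.map e) = P.zeroCheck e := by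
  simp [zeroCheck, zeroStep, List.map_flatMap, QGate.map]
  rfl

theorem map_amplify : (P.amplify id).map (QGate.map e) = P.amplify e := by
  rw [amplify, map_rounds, map_test, map_zeroCheck]
  rfl

theorem map_final : (P.final id).map (QGate.map e) = P.final e := by
  have h : ∀ j, (P.compareStep id j).map (QGate.map e) = P.compareStep e j := by
    intro j
    simp only [compareStep]
    cases digit P.κ j <;> rfl
  simp [final, compare, andStep, List.map_flatMap, QGate.map, h]
  rfl

theorem map_circuit : (P.circuit id).map (QGate.map e) = P.circuit e := by
  rw [circuit, List.map_append, map_amplify, map_final]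
  rfl

end Params

namespace Params

variable (P : Params)

/-! ### The qubits on which the parts of the amplified circuit act -/

theorem touches_test (hP : P.Valid) : ∀ g ∈ P.test id, ∀ i, g.Touches i →
    i < P.t + P.n + P.m + 3 := by
  intro g hg i hi
  have := hP.out_lt
  simp only [test, shifted, testGates, phaseTest, cphase, List.mem_append, List.mem_map,
    List.mem_flatMap, List.mem_range, List.mem_cons, List.not_mem_nil, or_false, id] at hg
  rcases hg with ⟨g, hg, rfl⟩ | (((rfl | rfl) | ⟨j, hj, rfl | rfl | rfl | rfl | rfl⟩) | rfl) |
    rfl | rfl | rfl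
  · obtain ⟨j, hj, rfl⟩ := QGate.touches_map hi
    have := hP.bound g hg j hj
    omega
  all_goals
    simp only [QGate.Touches] at hi
    omega

theorem isTarget_test : ∀ g ∈ P.test id, ∀ i, g.IsTarget i → P.t ≤ i := by
  intro g hg i hi
  simp only [test, shifted, testGates, phaseTest, cphase, List.mem_append, List.mem_map,
    List.mem_flatMap, List.mem_range, List.mem_cons, List.not_mem_nil, or_false, id] at hg
  rcases hg with ⟨g, hg, rfl⟩ | (((rfl | rfl) | ⟨j, hj, rfl | rfl | rfl | rfl | rfl⟩) | rfl) |
    rfl | rfl | rfl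
  · obtain ⟨j, hj, rfl⟩ := QGate.isTarget_map hi
    omega
  all_goals
    simp only [QGate.IsTarget] at hi
  all_goals omega

theorem distinct_test (hP : P.Valid) : ∀ g ∈ P.test id, g.Distinct := by
  intro g hg
  have := hP.out_lt
  simp only [test, shifted, testGates, phaseTest, cphase, List.mem_append, List.mem_map,
    List.mem_flatMap, List.mem_range, List.mem_cons, List.not_mem_nil, or_false, id] at hg
  rcases hg with ⟨g, hg, rfl⟩ | (((rfl | rfl) | ⟨j, hj, rfl | rfl | rfl | rfl | rfl⟩) | rfl) |
    rfl | rfl | rfl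
  · exact QGate.distinct_map (add_right_injective _) (hP.distinct g hg)
  all_goals
    simp only [QGate.Distinct]
  all_goals omega

theorem touches_zeroCheck : ∀ g ∈ P.zeroCheck id, ∀ i, g.Touches i →
    P.t + P.n ≤ i ∧ i < P.t + P.n + 2 * P.m + 7 := by
  intro g hg i hi
  simp only [zeroCheck, zeroStep, List.mem_flatMap, List.mem_range, List.mem_cons,
    List.not_mem_nil, or_false, id] at hg
  rcases hg with rfl | ⟨j, hj, rfl | rfl⟩ <;> simp only [QGate.Touches] at hi <;> omega

theorem classical_zeroCheck : ∀ g ∈ P.zeroCheck id, g.Distinct ∧ g.IsClassical := by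
  intro g hg
  simp only [zeroCheck, zeroStep, List.mem_flatMap, List.mem_range, List.mem_cons,
    List.not_mem_nil, or_false, id] at hg
  rcases hg with rfl | ⟨j, hj, rfl | rfl⟩ <;>
    simp only [QGate.Distinct, QGate.IsClassical, and_true] <;> omega

theorem forall_amplify {good : QGate ℕ → Prop} (hinv : ∀ g, good g → good g.inv)
    (h₁ : ∀ g ∈ P.zeroCheck id, good g) (h₂ : ∀ g ∈ P.test id, good g)
    (hf₁ : good (.had (P.t + P.n + P.m + 3 + (P.m + 3))))
    (hf₂ : good (.had (P.t + P.n + P.m + 2)))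
    (hc₁ : ∀ i < P.N, good (.cnot (P.t + P.n + 2 * P.m + 7 + i)
      (P.t + P.n + P.m + 3 + (P.m + 3))))
    (hc₂ : ∀ i < P.N, good (.cnot (P.t + P.n + 2 * P.m + 7 + i) (P.t + P.n + P.m + 2)))
    (hc : ∀ i < P.N, good (.had (P.t + P.n + 2 * P.m + 7 + i))) :
    ∀ g ∈ P.amplify id, good g :=
  forall_rounds hinv h₁ h₂ hf₁ hf₂ hc₁ hc₂ hc

theorem isTarget_amplify (hP : P.Valid) : ∀ g ∈ P.amplify id, ∀ i, g.IsTarget i →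
    P.t ≤ i ∧ i < P.t + P.n + 2 * P.m + P.N + 7 := by
  refine P.forall_amplify (fun g h i hi => h i ((QGate.isTarget_inv i g).1 hi)) ?_ ?_ ?_ ?_ ?_ ?_ ?_
  · intro g hg i hi
    have h1 := P.touches_zeroCheck g hg i hi.touches
    omega
  · intro g hg i hi
    have h1 := P.touches_test hP g hg i hi.touches
    have h2 := P.isTarget_test g hg i hi
    omega
  all_goals
    intros
    simp only [QGate.IsTarget] at *
    omega

theorem mem_final {g : QGate ℕ} (hg : g ∈ P.final id) :
    g.Distinct ∧ g.IsClassical ∧ ∀ i, g.Touches i → i < P.total := by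
  simp only [final, compare, compareStep, andStep, List.mem_append, List.mem_flatMap,
    List.mem_range, List.mem_cons, List.not_mem_nil, or_false, id] at hg
  have key : ∀ j < P.t, g = .toffoli (P.t + P.n + 2 * P.m + P.N + 7 + j) j
        (P.t + P.n + 2 * P.m + P.N + 7 + (j + 1)) ∨
      g = .cnot (P.t + P.n + 2 * P.m + P.N + 7 + j) (P.t + P.n + 2 * P.m + P.N + 7 + (j + 1)) ∨
      g = .cnot j (P.t + P.n + 2 * P.m + P.N + 7 + (j + 1)) →
      g.Distinct ∧ g.IsClassical ∧ ∀ i, g.Touches i → i < P.total := by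
    rintro j hj (rfl | rfl | rfl) <;>
      simp only [QGate.Distinct, QGate.IsClassical, QGate.Touches, total, true_and] <;>
      refine ⟨?_, fun i hi => ?_⟩ <;> omega
  rcases hg with (⟨j, hj, hg⟩ | rfl | rfl) | ⟨j, hj, rfl⟩
  · refine key j hj ?_
    rcases hg with hg | hg
    · exact Or.inl hg
    · cases hd : digit P.κ j
      · rw [hd] at hg
        simp only [cond_false, List.mem_cons, List.not_mem_nil, or_false] at hg
        exact Or.inr hg
      · rw [hd] at hg
        simp at hg
  all_goals
    simp only [QGate.Distinct, QGate.IsClassical, QGate.Touches, total, true_and]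
    first
    | (intro i hi; omega)
    | (refine ⟨?_, fun i hi => ?_⟩ <;> omega)

theorem mem_circuit (hP : P.Valid) {g : QGate ℕ} (hg : g ∈ P.circuit id) :
    g.Distinct ∧ ∀ i, g.Touches i → i < P.total := by
  rw [circuit, List.mem_append] at hg
  rcases hg with hg | hg
  · refine P.forall_amplify (good := fun g => g.Distinct ∧ ∀ i, g.Touches i → i < P.total)
      (fun g h => ⟨(QGate.distinct_inv g).2 h.1, fun i hi => h.2 i ((QGate.touches_inv i g).1 hi)⟩)
      ?_ ?_ ?_ ?_ ?_ ?_ ?_ g hg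
    · intro g hg
      refine ⟨(P.classical_zeroCheck g hg).1, fun i hi => ?_⟩
      have := P.touches_zeroCheck g hg i hi
      rw [total]
      omega
    · intro g hg
      refine ⟨P.distinct_test hP g hg, fun i hi => ?_⟩
      have := P.touches_test hP g hg i hi
      rw [total]
      omega
    all_goals
      intros
      simp only [QGate.Distinct, QGate.Touches, total, true_and]
      first
      | (intro i hi; omega)
      | (refine ⟨?_, fun i hi => ?_⟩ <;> omega)
  · exact ⟨(P.mem_final hg).1, (P.mem_final hg).2.2⟩

end Params

/-! ### Acceptance of the amplified circuit -/

section
variable {ι : Type} [Fintype ι] [DecidableEq ι]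

theorem QGate.Preserves.and {g : QGate ι} {p q : (ι → Bool) → Prop} (hp : g.Preserves p)
    (hq : g.Preserves q) : g.Preserves fun z => p z ∧ q z :=
  fun i hi z b => and_congr (hp i hi z b) (hq i hi z b)

/-- The labelling `e` of qubits is injective below `M`. -/
def Labels (e : ℕ → ι) (M : ℕ) : Prop := ∀ i < M, ∀ j < M, e i = e j → i = j

theorem Labels.ne {e : ℕ → ι} {M : ℕ} (he : Labels e M) {i j : ℕ} (h : i ≠ j ∧ i < M ∧ j < M) :
    e i ≠ e j := fun hij => h.1 (he i h.2.1 j h.2.2 hij)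

theorem preserves_map {e : ℕ → ι} {M : ℕ} (he : Labels e M) {p : (ι → Bool) → Prop} {q : ℕ → Prop}
    (hp : DependsOn p {x | ∃ j, q j ∧ e j = x}) (hq : ∀ j, q j → j < M) {L : List (QGate ℕ)}
    (hL : ∀ g ∈ L, ∀ i, g.IsTarget i → i < M ∧ ¬ q i) :
    ∀ g ∈ L.map (QGate.map e), g.Preserves p := by
  intro g hg
  obtain ⟨g, hg', rfl⟩ := List.mem_map.1 hg
  refine QGate.preserves_of_dependsOn hp ?_
  rintro x hx ⟨j, hj, rfl⟩
  obtain ⟨i, hi, hij⟩ := QGate.isTarget_map hx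
  obtain ⟨h1, h2⟩ := hL g hg' i hi
  exact h2 (he j (hq j hj) i h1 hij ▸ hj)

/-- The qubits with labels in `[lo, M)` are zero. -/
def Zeros (e : ℕ → ι) (M lo : ℕ) (z : ι → Bool) : Prop := ∀ j, lo ≤ j ∧ j < M → z (e j) = false

theorem Zeros.mono {e : ℕ → ι} {M lo lo' : ℕ} (h : lo ≤ lo') {z : ι → Bool} (hz : Zeros e M lo z) :
    Zeros e M lo' z := fun j hj => hz j ⟨h.trans hj.1, hj.2⟩

theorem dependsOn_zeros (e : ℕ → ι) (M lo : ℕ) :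
    DependsOn (Zeros e M lo) {x | ∃ j, (lo ≤ j ∧ j < M) ∧ e j = x} := dependsOn_forall e _ false

theorem dependsOn_value (e : ℕ → ι) (t : ℕ) (Q : ℕ → Prop) :
    DependsOn (fun z : ι → Bool => Q (value e t z)) {x | ∃ j, j < t ∧ e j = x} := by
  intro x y h
  dsimp only
  rw [value_congr fun j hj => h _ ⟨j, hj, rfl⟩]

end

namespace Params

variable (P : Params) {ι : Type} [Fintype ι] [DecidableEq ι] (e : ℕ → ι)

/-- The reflection about the states whose ancillae are zero (up to sign). -/
noncomputable def reflZero : State ι ≃ₗᵢ[ℂ] State ι :=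
  refl (P.zeroCheck e) (e (P.t + P.n + P.m + 3 + (P.m + 3)))

/-- The reflection about the states that pass the test (up to sign). -/
noncomputable def reflTest : State ι ≃ₗᵢ[ℂ] State ι := refl (P.test e) (e (P.t + P.n + P.m + 2))

/-- The configurations of the qubits with all ancillae zero and a phase that satisfies `Q`. -/
def Initial (Q : ℕ → Prop) (z : ι → Bool) : Prop :=
  Zeros e P.total (P.t + P.n) z ∧ Q (value e P.t z)

variable {P e} (hP : P.Valid) (he : Labels e P.total)
include hP he

theorem preserves_shifted {p : (ι → Bool) → Prop} {q : ℕ → Prop}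
    (hp : DependsOn p {x | ∃ j, q j ∧ e j = x}) (hq : ∀ j, q j → j < P.total)
    (hq' : ∀ j, q j → j < P.t ∨ P.t + P.n + P.m ≤ j) : ∀ g ∈ P.shifted e, g.Preserves p := by
  have h : P.shifted e = (P.shifted id).map (QGate.map e) := by
    simp only [shifted, List.map_map]
    refine List.map_congr_left fun g _ => ?_
    rw [Function.comp_apply, QGate.map_map]; rfl
  rw [h]
  refine preserves_map he hp hq fun g hg i hi => ?_
  obtain ⟨g, hg', rfl⟩ := List.mem_map.1 hg
  obtain ⟨j, hj, rfl⟩ := QGate.isTarget_map hi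
  have := hP.bound g hg' j hj.touches
  constructor
  · simp only [id, total]; omega
  · intro hqi
    have := hq' _ hqi
    simp only [id] at this
    omega

theorem preserves_test {p : (ι → Bool) → Prop} {q : ℕ → Prop}
    (hp : DependsOn p {x | ∃ j, q j ∧ e j = x}) (hq : ∀ j, q j → j < P.total)
    (hq' : ∀ j, q j → j < P.t ∨ P.t + P.n + P.m + 3 ≤ j) : ∀ g ∈ P.test e, g.Preserves p := by
  rw [← P.map_test]
  refine preserves_map he hp hq fun g hg i hi => ?_
  have h1 := P.touches_test hP g hg i hi.touches
  have h2 := P.isTarget_test g hg i hi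
  refine ⟨by rw [total]; omega, fun hqi => ?_⟩
  have := hq' i hqi
  omega

theorem preserves_amplify {p : (ι → Bool) → Prop} {q : ℕ → Prop}
    (hp : DependsOn p {x | ∃ j, q j ∧ e j = x}) (hq : ∀ j, q j → j < P.total)
    (hq' : ∀ j, q j → j < P.t ∨ P.t + P.n + 2 * P.m + P.N + 7 ≤ j) :
    ∀ g ∈ P.amplify e, g.Preserves p := by
  rw [← P.map_amplify]
  refine preserves_map he hp hq fun g hg i hi => ?_
  have h1 := P.isTarget_amplify hP g hg i hi
  refine ⟨by rw [total]; omega, fun hqi => ?_⟩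
  have := hq' i hqi
  omega

omit hP in
theorem run_zeroCheck {z : ι → Bool} (hz : Zeros e P.total (P.t + P.n + P.m + 3) z) :
    run (P.zeroCheck e) z (e (P.t + P.n + P.m + 3 + (P.m + 3))) = true ↔
      Zeros e P.total (P.t + P.n) z := by
  set z' := Function.update z (e (P.t + P.n + P.m + 3)) (!z (e (P.t + P.n + P.m + 3))) with hz'
  have hM : P.t + P.n + P.m + 3 + (P.m + 3) < P.total := by rw [total]; omega
  have h := (run_chain (blk := P.zeroStep e) (F := fun _ x y => x && !y)
    (a := fun j => e (P.t + P.n + P.m + 3 + j)) (q := fun j => e (P.t + P.n + j)) (n := P.m + 3)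
    (z := z') (fun i hi j hj hij => by
      have := he _ (by omega) _ (by omega) hij
      omega) (fun j hj i hi => he.ne (by omega)) (fun j hj z => by
      have h1 : e (P.t + P.n + P.m + 3 + j) ≠ e (P.t + P.n + P.m + 3 + (j + 1)) :=
        he.ne (by omega)
      have h2 : e (P.t + P.n + j) ≠ e (P.t + P.n + P.m + 3 + (j + 1)) := he.ne (by omega)
      simp only [zeroStep, run, QGate.flip, Function.update_self, Function.update_of_ne h1,
        Function.update_of_ne h2, Function.update_idem]
      congr 1
      cases z (e (P.t + P.n + P.m + 3 + j)) <;> cases z (e (P.t + P.n + j)) <;> simp)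
    (fun j hj => by
      rw [hz', Function.update_of_ne (he.ne (by omega))]
      exact hz _ (by omega))).1
  have h0 : z' (e (P.t + P.n + P.m + 3)) = true := by
    rw [hz', Function.update_self, hz _ (by omega)]; rfl
  rw [zeroCheck, run, QGate.flip, ← hz', h, chainVal_and_not]
  constructor
  · rintro ⟨-, h1⟩ j hj
    by_cases hj' : j < P.t + P.n + (P.m + 3)
    · have h2 := h1 (j - (P.t + P.n)) (by omega)
      have e1 : P.t + P.n + (j - (P.t + P.n)) = j := by omega
      rwa [e1, hz', Function.update_of_ne (he.ne (by omega))] at h2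
    · exact hz j (by omega)
  · refine fun h1 => ⟨h0, fun j hj => ?_⟩
    rw [hz', Function.update_of_ne (he.ne (by omega))]
    exact h1 _ (by omega)

omit hP in
theorem reflZero_apply (v : State ι) : P.reflZero e v = v - (2 : ℂ) • proj (fun z =>
    run (P.zeroCheck e) z (e (P.t + P.n + P.m + 3 + (P.m + 3))) = true) v := by
  refine refl_classical (fun g hg => ?_) _ v
  rw [← P.map_zeroCheck] at hg
  obtain ⟨g, hg', rfl⟩ := List.mem_map.1 hg
  obtain ⟨h1, h2⟩ := P.classical_zeroCheck g hg'
  refine ⟨QGate.distinct_map_of_injOn (fun i j hi hj hij => ?_) h1, by cases g <;> exact h2⟩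
  have hi := P.touches_zeroCheck g hg' i hi
  have hj := P.touches_zeroCheck g hg' j hj
  exact he i (by rw [total]; omega) j (by rw [total]; omega) hij

omit hP in
theorem reflZero_of_initial {Q : ℕ → Prop} {v : State ι} (hv : v ∈ supp (P.Initial e Q)) :
    P.reflZero e v = -v := by
  have h : v ∈ supp fun z =>
      run (P.zeroCheck e) z (e (P.t + P.n + P.m + 3 + (P.m + 3))) = true :=
    supp_mono (fun z hz => (run_zeroCheck he (hz.1.mono (by omega))).2 hz.1) hv
  rw [reflZero_apply he, mem_supp.1 h]
  module

theorem reflTest_mem {Q : ℕ → Prop} {v : State ι} (hv : v ∈ supp (P.Initial e Q)) :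
    P.reflTest e v ∈ supp fun z => Zeros e P.total (P.t + P.n + P.m + 3) z ∧ Q (value e P.t z) := by
  have hM : P.t + P.n + P.m + 3 < P.total := by rw [total]; omega
  refine refl_mem_supp (fun g hg => QGate.Preserves.and ?_ ?_) _
    (supp_mono (fun z hz => ⟨hz.1.mono (by omega), hz.2⟩) hv)
  · exact preserves_test hP he (dependsOn_zeros e _ _) (fun j hj => hj.2)
      (fun j hj => Or.inr hj.1) g hg
  · exact preserves_test hP he (dependsOn_value e _ Q) (fun j hj => by omega)
      (fun j hj => Or.inl hj) g hg

theorem cosOp_eq {Q : ℕ → Prop} {v : State ι} (hv : v ∈ supp (P.Initial e Q)) :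
    cosOp (P.reflZero e) (P.reflTest e) v = -((2 : ℂ) • proj (fun z =>
      run (P.zeroCheck e) z (e (P.t + P.n + P.m + 3 + (P.m + 3))) = true) (P.reflTest e v)) := by
  rw [cosOp_apply, reflZero_of_initial he hv, reflZero_apply he, map_neg]
  module

theorem cosOp_mem {Q : ℕ → Prop} {v : State ι} (hv : v ∈ supp (P.Initial e Q)) :
    cosOp (P.reflZero e) (P.reflTest e) v ∈ supp (P.Initial e Q) := by
  rw [cosOp_eq hP he hv]
  refine Submodule.neg_mem _ (Submodule.smul_mem _ _ ?_)
  refine supp_mono ?_ (mem_supp_and (proj_mem_supp _ _)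
    (p := fun z => run (P.zeroCheck e) z (e (P.t + P.n + P.m + 3 + (P.m + 3))) = true)
    (q := fun z => Zeros e P.total (P.t + P.n + P.m + 3) z ∧ Q (value e P.t z)) ?_)
  · rintro z ⟨h1, h2, h3⟩
    exact ⟨(run_zeroCheck he h2).1 h1, h3⟩
  · have h := reflTest_mem hP he hv
    rw [mem_supp_iff] at *
    intro z hz
    rw [proj_apply, h z hz, ite_self]

theorem shifted_mem {Q : ℕ → Prop} {v : State ι} (hv : v ∈ supp (P.Initial e Q)) :
    opL (P.shifted e) v ∈ supp fun z =>
      Zeros e P.total (P.t + P.n + P.m) z ∧ Q (value e P.t z) := by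
  have hM : P.t + P.n + P.m < P.total := by rw [total]; omega
  refine opL_mem_supp (fun g hg => QGate.Preserves.and ?_ ?_)
    (supp_mono (fun z hz => ⟨hz.1.mono (by omega), hz.2⟩) hv)
  · exact preserves_shifted hP he (dependsOn_zeros e _ _) (fun j hj => hj.2)
      (fun j hj => Or.inr hj.1) g hg
  · exact preserves_shifted hP he (dependsOn_value e _ Q) (fun j hj => by omega)
      (fun j hj => Or.inl hj) g hg

/-- The form `⟨v, C v⟩` compares the acceptance probability with the phase. -/
theorem re_inner_cosOp {Q : ℕ → Prop} {v : State ι} (hv : v ∈ supp (P.Initial e Q)) :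
    RCLike.re (inner ℂ v (cosOp (P.reflZero e) (P.reflTest e) v))
      = 2 * ∑ z, ((if z (e (P.t + P.out)) then 1 else 0)
        - Real.cos (Real.pi * (value e P.t z / 2 ^ P.t)) ^ 2) * ‖opL (P.shifted e) v z‖ ^ 2 := by
  have hM : P.t + P.n + P.m + 2 < P.total := by rw [total]; omega
  have hout := hP.out_lt
  have h : v ∈ supp fun z =>
      run (P.zeroCheck e) z (e (P.t + P.n + P.m + 3 + (P.m + 3))) = true :=
    supp_mono (fun z hz => (run_zeroCheck he (hz.1.mono (by omega))).2 hz.1) hv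
  have hφ : ∀ j, P.t + P.n + P.m ≤ j → j < P.total →
      opL (P.shifted e) v ∈ supp fun z => z (e j) = false := fun j h1 h2 =>
    supp_mono (fun z hz => hz.1 j ⟨h1, h2⟩) (shifted_mem hP he hv)
  rw [← norm_proj_test (k := e) (t := P.t) (coin := e (P.t + P.n + P.m))
    (y := e (P.t + P.n + P.m + 1)) (f := e (P.t + P.n + P.m + 2)) (out := e (P.t + P.out))
    (fun j hj => he.ne (by omega)) (fun j hj => he.ne (by omega)) (he.ne (by omega))
    (he.ne (by omega)) (he.ne (by omega)) (he.ne (by omega)) (he.ne (by omega)) (he.ne (by omega))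
    (hφ _ (by omega) (by omega)) (hφ _ (by omega) (by omega)) (hφ _ (by omega) (by omega))]
  rw [cosOp_eq hP he hv, inner_neg_right, inner_smul_right, inner_proj, mem_supp.1 h]
  have hr := re_inner_refl (P.test e) (e (P.t + P.n + P.m + 2)) v
  have ht : opL (P.test e) v = opL (testGates P.t e (e (P.t + P.n + P.m)) (e (P.t + P.n + P.m + 1))
      (e (P.t + P.n + P.m + 2)) (e (P.t + P.out))) (opL (P.shifted e) v) := by
    rw [test, opL_append, isometry_mul_apply]
  rw [← ht, LinearIsometryEquiv.norm_map]
  have : ∀ x : ℂ, RCLike.re (-(2 * x)) = -(2 * RCLike.re x) := fun x => by simp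
  rw [this, reflTest, hr]
  ring

end Params

namespace Params

variable {P : Params} {ι : Type} [Fintype ι] [DecidableEq ι] {e : ℕ → ι}

theorem emb_injective (he : Labels e P.total) :
    Function.Injective fun i : Fin (P.n + P.m) => e (P.t + i) := by
  intro i j h
  have := he _ (by rw [total]; omega) _ (by rw [total]; omega) h
  exact Fin.ext (by omega)

/-- The probability of `out` in the presence of further qubits, by slices.  Each slice is counted once
for each configuration of the qubits of the given circuit. -/
theorem sum_out (he : Labels e P.total) {G : List (QGate (Fin (P.n + P.m)))}
    (hG : ∀ g ∈ G, g.Distinct) (hGP : P.gates = G.map (QGate.map fun i : Fin (P.n + P.m) => (i : ℕ)))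
    {o : Fin (P.n + P.m)} (ho : P.out = o) (v : State ι) :
    Fintype.card (Fin (P.n + P.m) → Bool) *
        ∑ z, (if z (e (P.t + P.out)) then ‖opL (P.shifted e) v z‖ ^ 2 else 0)
      = ∑ w, ‖proj (fun y => y o = true)
          (opL G (slice (fun i : Fin (P.n + P.m) => e (P.t + i)) v w))‖ ^ 2 := by
  have hinj := emb_injective he
  rw [← sum_extend hinj]
  refine Finset.sum_congr rfl fun w _ => ?_
  rw [norm_proj_sq]
  refine Finset.sum_congr rfl fun y _ => ?_
  have h1 : Function.extend (fun i : Fin (P.n + P.m) => e (P.t + i)) y w (e (P.t + P.out)) = y o := by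
    rw [ho]
    exact hinj.extend_apply y w o
  have h2 : P.shifted e = G.map (QGate.map fun i : Fin (P.n + P.m) => e (P.t + i)) := by
    rw [shifted, hGP, List.map_map]
    refine List.map_congr_left fun g _ => ?_
    rw [Function.comp_apply, QGate.map_map]; rfl
  rw [h1, h2, opL_map hinj hG]
  congr

theorem norm_sq_slice (he : Labels e P.total) (v : State ι) :
    Fintype.card (Fin (P.n + P.m) → Bool) * ‖v‖ ^ 2
      = ∑ w, ‖slice (fun i : Fin (P.n + P.m) => e (P.t + i)) v w‖ ^ 2 := by
  rw [EuclideanSpace.norm_sq_eq, ← sum_extend (emb_injective he)]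
  refine Finset.sum_congr rfl fun w _ => ?_
  rw [EuclideanSpace.norm_sq_eq]
  rfl

/-- A bound for the acceptance probability of a circuit also holds if further qubits are present. -/
theorem sum_out_le (he : Labels e P.total) {G : List (QGate (Fin (P.n + P.m)))}
    (hG : ∀ g ∈ G, g.Distinct) (hGP : P.gates = G.map (QGate.map fun i : Fin (P.n + P.m) => (i : ℕ)))
    {o : Fin (P.n + P.m)} (ho : P.out = o) {b : ℝ}
    (hb : ∀ χ : State (Fin (P.n + P.m)),
      (χ ∈ supp fun y => ∀ i : Fin (P.n + P.m), P.n ≤ i → y i = false) →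
      ‖proj (fun y => y o = true) (opL G χ)‖ ^ 2 ≤ b * ‖χ‖ ^ 2)
    {v : State ι} (hv : v ∈ supp (Zeros e P.total (P.t + P.n))) :
    ∑ z, (if z (e (P.t + P.out)) then ‖opL (P.shifted e) v z‖ ^ 2 else 0) ≤ b * ‖v‖ ^ 2 := by
  have hc : (0 : ℝ) < Fintype.card (Fin (P.n + P.m) → Bool) := by exact_mod_cast Fintype.card_pos
  refine le_of_mul_le_mul_left ?_ hc
  rw [sum_out he hG hGP ho, mul_left_comm, norm_sq_slice he, Finset.mul_sum]
  refine Finset.sum_le_sum fun w _ => hb _ ?_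
  rw [mem_supp_iff] at *
  intro y hy
  refine hv _ fun hz => hy fun i hi => ?_
  have := hz (P.t + i) ⟨by omega, by rw [total]; omega⟩
  rwa [(emb_injective he).extend_apply] at this

/-- The classical part accepts if all rounds have ended with a one and the phase is at most `κ`. -/
theorem run_final (he : Labels e P.total) (hκ : P.κ.length = P.t) {z : ι → Bool}
    (hz : Zeros e P.total (P.t + P.n + 2 * P.m + P.N + 7) z) :
    run (P.final e) z (e (2 * P.t + P.n + 2 * P.m + P.N + 8 + P.N)) = true ↔
      (∀ i, i < P.N → z (e (P.t + P.n + 2 * P.m + 7 + i)) = true) ∧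
        value e P.t z ≤ bval P.κ := by
  have hM : 2 * P.t + P.n + 2 * P.m + P.N + 8 + P.N < P.total := by rw [total]; omega
  obtain ⟨h1, h2⟩ := run_chain (blk := P.compareStep e)
    (F := fun j x y => if digit P.κ j then x && y else x || y)
    (a := fun j => e (P.t + P.n + 2 * P.m + P.N + 7 + j)) (q := e) (n := P.t)
    (z := z) (fun i hi j hj hij => by
      have := he _ (by omega) _ (by omega) hij
      omega) (fun j hj i hi => he.ne (by omega)) (fun j hj z => by
      have h1 : e (P.t + P.n + 2 * P.m + P.N + 7 + j)
        ≠ e (P.t + P.n + 2 * P.m + P.N + 7 + (j + 1)) := he.ne (by omega)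
      have h2 : e j ≠ e (P.t + P.n + 2 * P.m + P.N + 7 + (j + 1)) := he.ne (by omega)
      cases hd : digit P.κ j
      · simp only [compareStep, hd, cond_false, run, QGate.flip, Function.update_self,
          Function.update_of_ne h1, Function.update_of_ne h2, Function.update_idem,
          Bool.false_eq_true, if_false]
        congr 1
        cases z (e (P.t + P.n + 2 * P.m + P.N + 7 + j)) <;> cases z (e j) <;> simp
      · simp only [compareStep, hd, cond_true, run, QGate.flip, if_true])
    (fun j hj => hz _ (by omega))
  set w := run ((List.range P.t).flatMap (P.compareStep e)) z with hw
  set d := e (2 * P.t + P.n + 2 * P.m + P.N + 8) with hd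
  set z₂ := Function.update w d (!w (e (P.t + P.n + 2 * P.m + P.N + 7 + P.t))) with hz₂
  have hwd : w d = false := by
    rw [h2 d fun j hj => he.ne (by omega)]
    exact hz _ (by omega)
  have hrun : run (P.compare e) z = z₂ := by
    have hne : e (P.t + P.n + 2 * P.m + P.N + 7 + P.t) ≠ d := he.ne (by omega)
    rw [compare, run_append, ← hw]
    simp only [run, QGate.flip, ← hd, Function.update_self, Function.update_of_ne hne,
      Function.update_idem, hwd, Bool.not_false, Bool.true_xor, hz₂]
  have hz₂0 : z₂ d = true ↔ value e P.t z ≤ bval P.κ := by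
    have h3 := chainVal_compare (digit P.κ) (fun j => z (e j)) P.t
    rw [← hκ, ← bval_eq_sum_digit, hκ] at h3
    have h0 : z (e (P.t + P.n + 2 * P.m + P.N + 7 + 0)) = false := hz _ (by omega)
    rw [h0] at h1
    rw [hz₂, Function.update_self, h1, Bool.not_eq_true', ← not_lt, ← Bool.not_eq_true]
    exact not_congr h3
  have hw' : ∀ j, j < P.total → ¬ (P.t + P.n + 2 * P.m + P.N + 8 ≤ j ∧
      j ≤ 2 * P.t + P.n + 2 * P.m + P.N + 8) → z₂ (e j) = z (e j) := by
    intro j hj hj'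
    rw [hz₂, Function.update_of_ne (he.ne (by omega)), h2 _ fun i hi => he.ne (by omega)]
  have h4 := (run_chain (blk := P.andStep e) (F := fun _ x y => x && y)
    (a := fun j => e (2 * P.t + P.n + 2 * P.m + P.N + 8 + j))
    (q := fun j => e (P.t + P.n + 2 * P.m + 7 + j)) (n := P.N) (z := z₂)
    (fun i hi j hj hij => by
      have := he _ (by omega) _ (by omega) hij
      omega) (fun j hj i hi => he.ne (by omega)) (fun j hj z => rfl)
    (fun j hj => by
      rw [hw' _ (by omega) (by omega)]
      exact hz _ (by omega))).1
  rw [final, run_append, hrun, h4, chainVal_and, and_comm]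
  refine and_congr (forall₂_congr fun i hi => ?_) hz₂0
  rw [hw' _ (by omega) (by omega)]

/-- The probability that all rounds succeed and the phase is at most `κ`. -/
theorem norm_proj_circuit (hP : P.Valid) (he : Labels e P.total) (hκ : P.κ.length = P.t)
    {v : State ι} (hv : v ∈ supp (Zeros e P.total (P.t + P.n))) :
    ‖proj (fun z => z (e (2 * P.t + P.n + 2 * P.m + P.N + 8 + P.N)) = true)
        (opL (P.circuit e) v)‖
      = ‖(passOp (P.reflZero e) (P.reflTest e))^[P.N]
          (proj (fun z => value e P.t z ≤ bval P.κ) v)‖ := by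
  have hM : 2 * P.t + P.n + 2 * P.m + P.N + 8 + P.N < P.total := by rw [total]; omega
  have hcl : ∀ g ∈ P.final e, g.Distinct ∧ g.IsClassical := by
    intro g hg
    rw [← P.map_final] at hg
    obtain ⟨g, hg', rfl⟩ := List.mem_map.1 hg
    obtain ⟨h1, h2, h3⟩ := P.mem_final hg'
    exact ⟨QGate.distinct_map_of_injOn (fun i j hi hj hij => he i (h3 i hi) j (h3 j hj) hij) h1,
      by cases g <;> exact h2⟩
  have hz : opL (P.amplify e) v ∈ supp (Zeros e P.total (P.t + P.n + 2 * P.m + P.N + 7)) :=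
    opL_mem_supp (preserves_amplify hP he (dependsOn_zeros e _ _) (fun j hj => hj.2)
      (fun j hj => Or.inr hj.1)) (supp_mono (fun z hz => hz.mono (by omega)) hv)
  have ht : ∀ i < P.N, ∀ g ∈ P.test e, ¬ g.Touches (e (P.t + P.n + 2 * P.m + 7 + i)) := by
    intro i hi g hg hgi
    rw [← P.map_test] at hg
    obtain ⟨g, hg', rfl⟩ := List.mem_map.1 hg
    obtain ⟨j, hj, hij⟩ := QGate.touches_map hgi
    have := P.touches_test hP g hg' j hj
    have := he _ (by omega) _ (by omega) hij
    omega
  have hzc : ∀ i < P.N, ∀ g ∈ P.zeroCheck e, ¬ g.Touches (e (P.t + P.n + 2 * P.m + 7 + i)) := by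
    intro i hi g hg hgi
    rw [← P.map_zeroCheck] at hg
    obtain ⟨g, hg', rfl⟩ := List.mem_map.1 hg
    obtain ⟨j, hj, hij⟩ := QGate.touches_map hgi
    have := P.touches_zeroCheck g hg' j hj
    have := he _ (by omega) _ (by omega) hij
    omega
  rw [circuit, opL_append, isometry_mul_apply, proj_opL_classical hcl,
    LinearIsometryEquiv.norm_map, proj_congr hz fun z hz => run_final he hκ hz, ← proj_proj,
    proj_opL (preserves_amplify hP he (dependsOn_value e P.t (· ≤ bval P.κ))
      (fun j hj => by omega) fun j hj => Or.inl hj)]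
  refine norm_proj_opL_rounds (c := fun i => e (P.t + P.n + 2 * P.m + 7 + i))
    (fun i hi j hj hij => ?_) hzc ht (fun i hi => he.ne (by omega)) (fun i hi => he.ne (by omega))
    (fun i hi => ?_)
  · have := he _ (by omega) _ (by omega) hij
    omega
  · rw [mem_supp_iff] at *
    intro z hz
    rw [proj_apply, hv z fun h => hz (h _ (by omega)), ite_self]

theorem proj_mem_initial {v : State ι} (hv : v ∈ supp (Zeros e P.total (P.t + P.n)))
    (Q : ℕ → Prop) : proj (fun z => Q (value e P.t z)) v ∈ supp (P.Initial e Q) := by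
  rw [mem_supp_iff] at *
  intro z hz
  rw [proj_apply]
  split_ifs with h
  · exact hv z fun h' => hz ⟨h', h⟩
  · rfl

/-- If the acceptance probability of the given circuit is smaller, by `g`, than the one that belongs
to each phase up to `κ`, then the amplified circuit accepts with small probability. -/
theorem norm_proj_circuit_le (hP : P.Valid) (he : Labels e P.total) (hκ : P.κ.length = P.t)
    {G : List (QGate (Fin (P.n + P.m)))}
    (hG : ∀ g ∈ G, g.Distinct) (hGP : P.gates = G.map (QGate.map fun i : Fin (P.n + P.m) => (i : ℕ)))
    {o : Fin (P.n + P.m)} (ho : P.out = o) {b g : ℝ} (hg : 0 ≤ g) (hg1 : g ≤ 1)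
    (hb : ∀ χ : State (Fin (P.n + P.m)),
      (χ ∈ supp fun y => ∀ i : Fin (P.n + P.m), P.n ≤ i → y i = false) →
      ‖proj (fun y => y o = true) (opL G χ)‖ ^ 2 ≤ b * ‖χ‖ ^ 2)
    (hK : ∀ K ≤ bval P.κ, b + g ≤ Real.cos (Real.pi * (K / 2 ^ P.t)) ^ 2)
    {j : ℕ} (hj : P.N = 2 * j) {v : State ι} (hv : v ∈ supp (Zeros e P.total (P.t + P.n))) :
    ‖proj (fun z => z (e (2 * P.t + P.n + 2 * P.m + P.N + 8 + P.N)) = true)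
        (opL (P.circuit e) v)‖ ^ 2 ≤ (1 - g ^ 2) ^ j * ‖v‖ ^ 2 := by
  rw [norm_proj_circuit hP he hκ hv, hj]
  refine (norm_passOp_iterate_le (refl_refl _ _) (refl_refl _ _)
    (supp (P.Initial e (· ≤ bval P.κ))) (fun v hv => cosOp_mem hP he hv) hg (fun u hu => ?_) j _
    (proj_mem_initial hv _)).trans ?_
  · have h1 := shifted_mem hP he hu
    rw [mem_supp_iff] at h1
    have h2 := sum_out_le he hG hGP ho hb (supp_mono (fun z hz => hz.1) hu)
    have h3 : ∑ z, ‖opL (P.shifted e) u z‖ ^ 2 = ‖u‖ ^ 2 := by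
      rw [← EuclideanSpace.norm_sq_eq, LinearIsometryEquiv.norm_map]
    rw [re_inner_cosOp hP he hu]
    have h4 : ∑ z, ((if z (e (P.t + P.out)) then 1 else 0)
        - Real.cos (Real.pi * (value e P.t z / 2 ^ P.t)) ^ 2) * ‖opL (P.shifted e) u z‖ ^ 2
        ≤ ∑ z, ((if z (e (P.t + P.out)) then ‖opL (P.shifted e) u z‖ ^ 2 else 0)
          - (b + g) * ‖opL (P.shifted e) u z‖ ^ 2) := by
      refine Finset.sum_le_sum fun z _ => ?_
      by_cases hz : value e P.t z ≤ bval P.κ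
      · have := hK _ hz
        have h5 := sq_nonneg ‖opL (P.shifted e) u z‖
        split_ifs <;> nlinarith
      · rw [h1 z fun h => hz h.2]
        simp
    rw [Finset.sum_sub_distrib, ← Finset.mul_sum, h3] at h4
    linarith
  · have h1 : 0 ≤ 1 - g ^ 2 := by nlinarith
    have h2 := norm_proj_le (fun z => value e P.t z ≤ bval P.κ) v
    gcongr

theorem exists_sum_eq (t : ℕ) : ∀ k < 2 ^ t, ∃ u : ℕ → Bool,
    (∑ j ∈ Finset.range t, if u j then 2 ^ j else 0) = k := by
  induction t with
  | zero => intro k hk; exact ⟨fun _ => false, by simp at hk ⊢; omega⟩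
  | succ t ih =>
    intro k hk
    rw [pow_succ] at hk
    by_cases h : k < 2 ^ t
    · obtain ⟨u, hu⟩ := ih k h
      refine ⟨Function.update u t false, ?_⟩
      rw [Finset.sum_range_succ, Function.update_self, ← hu]
      simp only [Bool.false_eq_true, if_false, add_zero]
      exact Finset.sum_congr rfl fun j hj => by
        rw [Function.update_of_ne (Finset.mem_range.1 hj).ne]
    · obtain ⟨u, hu⟩ := ih (k - 2 ^ t) (by omega)
      refine ⟨Function.update u t true, ?_⟩
      rw [Finset.sum_range_succ, Function.update_self, if_pos rfl,
        Finset.sum_congr rfl fun j hj => by rw [Function.update_of_ne (Finset.mem_range.1 hj).ne],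
        hu]
      omega

/-- If the acceptance probability of the given circuit has its maximum at `χ`, and this maximum
belongs to the phase `k / 2 ^ t`, then the amplified circuit accepts some state with certainty. -/
theorem exists_norm_proj_circuit_eq (hP : P.Valid) (he : Labels e P.total) (hκ : P.κ.length = P.t)
    {G : List (QGate (Fin (P.n + P.m)))}
    (hG : ∀ g ∈ G, g.Distinct) (hGP : P.gates = G.map (QGate.map fun i : Fin (P.n + P.m) => (i : ℕ)))
    {o : Fin (P.n + P.m)} (ho : P.out = o) {k : ℕ} (hk : k < 2 ^ P.t) (hkκ : k ≤ bval P.κ)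
    (hb : ∀ χ : State (Fin (P.n + P.m)),
      (χ ∈ supp fun y => ∀ i : Fin (P.n + P.m), P.n ≤ i → y i = false) →
      ‖proj (fun y => y o = true) (opL G χ)‖ ^ 2
        ≤ Real.cos (Real.pi * (k / 2 ^ P.t)) ^ 2 * ‖χ‖ ^ 2)
    {χ : State (Fin (P.n + P.m))} (hχ0 : χ ≠ 0)
    (hχz : χ ∈ supp fun y => ∀ i : Fin (P.n + P.m), P.n ≤ i → y i = false)
    (hχ : ‖proj (fun y => y o = true) (opL G χ)‖ ^ 2
        = Real.cos (Real.pi * (k / 2 ^ P.t)) ^ 2 * ‖χ‖ ^ 2) :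
    ∃ v ∈ supp (Zeros e P.total (P.t + P.n)), v ≠ 0 ∧
      ‖proj (fun z => z (e (2 * P.t + P.n + 2 * P.m + P.N + 8 + P.N)) = true)
        (opL (P.circuit e) v)‖ = ‖v‖ := by
  classical
  have hinj := emb_injective he
  have hM : P.t + P.n + P.m < P.total := by rw [total]; omega
  -- the state `|k⟩ χ`, with all further qubits zero
  set v : State ι := WithLp.toLp 2 fun z =>
    if Zeros e P.total (P.t + P.n + P.m) z ∧ value e P.t z = k then
      χ fun i => z (e (P.t + i)) else 0 with hv
  have hvz : ∀ z, v z = if Zeros e P.total (P.t + P.n + P.m) z ∧ value e P.t z = k then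
      χ fun i => z (e (P.t + i)) else 0 := fun z => rfl
  rw [mem_supp_iff] at hχz
  have hvS : v ∈ supp (P.Initial e (· = k)) := by
    rw [mem_supp_iff]
    intro z hz
    rw [hvz]
    split_ifs with h
    · refine hχz _ fun hy => hz ⟨fun j hj => ?_, h.2⟩
      by_cases hj' : P.t + P.n + P.m ≤ j
      · exact h.1 j ⟨hj', hj.2⟩
      · have h1 := hy ⟨j - P.t, by omega⟩ (by simp only; omega)
        have e1 : P.t + (j - P.t) = j := by omega
        simp only [e1] at h1
        exact h1
    · rfl
  have hvZ : v ∈ supp (Zeros e P.total (P.t + P.n)) := supp_mono (fun z hz => hz.1) hvS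
  have hslice : ∀ w, slice (fun i : Fin (P.n + P.m) => e (P.t + i)) v w
      = if Zeros e P.total (P.t + P.n + P.m) w ∧ value e P.t w = k then χ else 0 := by
    intro w
    ext y
    have h1 : ∀ j, j < P.total → (j < P.t ∨ P.t + P.n + P.m ≤ j) →
        Function.extend (fun i : Fin (P.n + P.m) => e (P.t + i)) y w (e j) = w (e j) := by
      intro j hj hj'
      refine Function.extend_apply' _ _ _ ?_
      rintro ⟨i, hi⟩
      have := he _ (by omega) _ hj hi
      omega
    have h2 : Zeros e P.total (P.t + P.n + P.m)
        (Function.extend (fun i : Fin (P.n + P.m) => e (P.t + i)) y w)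
        ↔ Zeros e P.total (P.t + P.n + P.m) w :=
      forall₂_congr fun j hj => by rw [h1 j hj.2 (Or.inr hj.1)]
    have h3 : value e P.t (Function.extend (fun i : Fin (P.n + P.m) => e (P.t + i)) y w)
        = value e P.t w := value_congr fun j hj => h1 j (by omega) (Or.inl hj)
    have h4 : (fun i : Fin (P.n + P.m) =>
        Function.extend (fun i : Fin (P.n + P.m) => e (P.t + i)) y w (e (P.t + i))) = y :=
      funext fun i => hinj.extend_apply y w i
    change v (Function.extend _ y w) = _
    rw [hvz, h2, h3, h4]
    split_ifs <;> rfl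
  have hsum : ∑ z, (if z (e (P.t + P.out)) then ‖opL (P.shifted e) v z‖ ^ 2 else 0)
      = Real.cos (Real.pi * (k / 2 ^ P.t)) ^ 2 * ‖v‖ ^ 2 := by
    have hc : (Fintype.card (Fin (P.n + P.m) → Bool) : ℝ) ≠ 0 := by
      exact_mod_cast Fintype.card_ne_zero
    refine mul_left_cancel₀ hc ?_
    rw [sum_out he hG hGP ho, mul_left_comm, norm_sq_slice he, Finset.mul_sum]
    refine Finset.sum_congr rfl fun w _ => ?_
    rw [hslice]
    split_ifs
    · exact hχ
    · simp
  have hform : ∀ u ∈ supp (P.Initial e (· = k)),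
      RCLike.re (inner ℂ u (cosOp (P.reflZero e) (P.reflTest e) u))
        = 2 * (∑ z, (if z (e (P.t + P.out)) then ‖opL (P.shifted e) u z‖ ^ 2 else 0)
          - Real.cos (Real.pi * (k / 2 ^ P.t)) ^ 2 * ‖u‖ ^ 2) := by
    intro u hu
    have h1 := shifted_mem hP he hu
    rw [mem_supp_iff] at h1
    have h3 : ‖u‖ ^ 2 = ∑ z, ‖opL (P.shifted e) u z‖ ^ 2 := by
      rw [← EuclideanSpace.norm_sq_eq, LinearIsometryEquiv.norm_map]
    rw [re_inner_cosOp hP he hu, h3]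
    congr 1
    rw [Finset.mul_sum, ← Finset.sum_sub_distrib]
    refine Finset.sum_congr rfl fun z _ => ?_
    by_cases hz : value e P.t z = k
    · rw [hz]
      split_ifs <;> ring
    · rw [h1 z fun h => hz h.2]
      simp
  have hpass : passOp (P.reflZero e) (P.reflTest e) v = v := by
    refine passOp_eq_self (refl_refl _ _) (refl_refl _ _) (supp (P.Initial e (· = k)))
      (fun u hu => cosOp_mem hP he hu) (fun u hu => ?_) v hvS ?_
    · rw [hform u hu]
      have := sum_out_le he hG hGP ho hb (supp_mono (fun z hz => hz.1) hu)
      linarith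
    · rw [hform v hvS, hsum, sub_self, mul_zero]
  refine ⟨v, hvZ, ?_, ?_⟩
  · -- a configuration at which `v` does not vanish
    obtain ⟨u, hu⟩ := exists_sum_eq P.t k hk
    intro h0
    apply hχ0
    ext y
    have : ∃ z : ι → Bool, (∀ j < P.total, z (e j) = if j < P.t then u j else
        if h : j - P.t < P.n + P.m then y ⟨j - P.t, h⟩ else false) := by
      refine ⟨fun x => if h : ∃ j, j < P.total ∧ e j = x then (if h.choose < P.t then u h.choose else
        if h : h.choose - P.t < P.n + P.m then y ⟨_, h⟩ else false) else false, fun j hj => ?_⟩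
      have hex : ∃ i, i < P.total ∧ e i = e j := ⟨j, hj, rfl⟩
      have hch : hex.choose = j := he _ hex.choose_spec.1 _ hj hex.choose_spec.2
      dsimp only
      rw [dif_pos hex]
      simp only [hch]
    obtain ⟨z, hz⟩ := this
    have hk0 : value e P.t z = k := by
      rw [← hu]
      refine Finset.sum_congr rfl fun j hj => ?_
      rw [Finset.mem_range] at hj
      rw [hz j (by omega), if_pos hj]
    have hz0 : Zeros e P.total (P.t + P.n + P.m) z := fun j hj => by
      rw [hz _ hj.2, if_neg (by omega), dif_neg (by omega)]
    have hy : (fun i : Fin (P.n + P.m) => z (e (P.t + i))) = y := by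
      funext i
      rw [hz _ (by omega), if_neg (by omega)]
      have e1 : P.t + (i : ℕ) - P.t = i := by omega
      simp only [e1, dif_pos i.2]
    have h1 := hvz z
    rw [if_pos ⟨hz0, hk0⟩, h0, hy] at h1
    exact h1.symm
  · have hfix : ∀ j, (passOp (P.reflZero e) (P.reflTest e))^[j] v = v := fun j =>
      Function.iterate_fixed hpass j
    have hproj : proj (fun z => value e P.t z ≤ bval P.κ) v = v :=
      supp_mono (fun z hz => hz.2 ▸ hkκ) hvS
    rw [norm_proj_circuit hP he hκ hvZ, hproj, hfix]

end Params

/-! ### Verifier circuits as operators -/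

/-- The gate without the proofs that its qubits are distinct. -/
def Gate.toQ {M : ℕ} : Gate M → QGate (Fin M)
  | .not i => .not i
  | .had i => .had i
  | .phase k b i => .phase k b i
  | .cnot c i _ => .cnot c i
  | .toffoli c d i _ _ _ => .toffoli c d i

theorem Gate.distinct_toQ {M : ℕ} (g : Gate M) : g.toQ.Distinct := by
  cases g with
  | not i => trivial
  | had i => trivial
  | phase k b i => trivial
  | cnot c i h => exact h
  | toffoli c d i h1 h2 h3 => exact ⟨h1, h2, h3⟩

theorem Gate.act_toQ {M : ℕ} (g : Gate M) (ψ : Amplitudes M) : g.toQ.act ψ = g.apply ψ := by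
  cases g <;> rfl

theorem foldl_apply {M : ℕ} (L : List (Gate M)) (ψ : State (Fin M)) :
    L.foldl (fun φ g => g.apply φ) ψ.ofLp = (opL (L.map Gate.toQ) ψ).ofLp := by
  induction L generalizing ψ with
  | nil => rfl
  | cons g L ih =>
    have h : g.apply ψ.ofLp = (g.toQ.op ψ).ofLp := by
      rw [← Gate.act_toQ]
      exact funext fun z => (QGate.op_apply g.distinct_toQ ψ z).symm
    rw [List.foldl_cons, h, ih]
    rfl

namespace Circuit

variable (V : Circuit)

/-- The gates of the circuit. -/
def qgates : List (QGate (Fin (V.witness + V.ancilla))) := V.gates.map Gate.toQ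

/-- The basis states with all ancillae zero. -/
def Start (y : Fin (V.witness + V.ancilla) → Bool) : Prop :=
  ∀ i : Fin (V.witness + V.ancilla), V.witness ≤ i → y i = false

/-- The witness state that belongs to a state of all qubits. -/
def witnessState (χ : State (Fin (V.witness + V.ancilla))) : Amplitudes V.witness :=
  fun y => χ (Fin.append y fun _ => false)

variable {V}

theorem start_iff {z : Fin (V.witness + V.ancilla) → Bool} :
    V.Start z ↔ ∀ j : Fin V.ancilla, z (Fin.natAdd V.witness j) = false := by
  constructor
  · intro h j
    exact h _ (Nat.le_add_right _ _)
  · intro h i hi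
    have := h ⟨i - V.witness, by omega⟩
    rwa [show Fin.natAdd V.witness ⟨i - V.witness, _⟩ = i from Fin.ext (by simp; omega)] at this

theorem startState_mem (ψ : Amplitudes V.witness) :
    (WithLp.toLp 2 (V.startState ψ) : State (Fin (V.witness + V.ancilla))) ∈ supp V.Start := by
  rw [mem_supp_iff]
  intro z hz
  exact if_neg (by rwa [start_iff] at hz)

theorem startState_witnessState {χ : State (Fin (V.witness + V.ancilla))}
    (hχ : χ ∈ supp V.Start) : V.startState (V.witnessState χ) = χ.ofLp := by
  rw [mem_supp_iff] at hχ
  funext z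
  by_cases h : ∀ j : Fin V.ancilla, z (Fin.natAdd V.witness j) = false
  · rw [startState, if_pos h, witnessState]
    have h' : (fun _ : Fin V.ancilla => false) = fun j => z (Fin.natAdd V.witness j) :=
      funext fun j => (h j).symm
    rw [h']
    rw [Fin.append_castAdd_natAdd]
  · rw [startState, if_neg h, hχ z (by rwa [start_iff])]

theorem norm_sq_startState (ψ : Amplitudes V.witness) :
    ‖(WithLp.toLp 2 (V.startState ψ) : State (Fin (V.witness + V.ancilla)))‖ ^ 2
      = ∑ y, ‖ψ y‖ ^ 2 := by
  rw [EuclideanSpace.norm_sq_eq, ← (Fin.appendEquiv V.witness V.ancilla).sum_comp,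
    Fintype.sum_prod_type]
  refine Finset.sum_congr rfl fun y _ => ?_
  rw [Finset.sum_eq_single fun _ => false]
  · simp [startState, Fin.appendEquiv]
  · intro w _ hw
    have : ¬ ∀ j, w j = false := fun h => hw (funext h)
    simp [startState, Fin.appendEquiv, this]
  · simp

theorem acceptProb_eq (ψ : Amplitudes V.witness) :
    V.acceptProb ψ = ‖proj (fun z => z V.output = true)
      (opL V.qgates (WithLp.toLp 2 (V.startState ψ)))‖ ^ 2 := by
  rw [norm_proj_sq, acceptProb]
  refine Finset.sum_congr rfl fun z _ => ?_
  have h : V.finalState ψ = (opL V.qgates (WithLp.toLp 2 (V.startState ψ))).ofLp :=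
    foldl_apply V.gates (WithLp.toLp 2 (V.startState ψ))
  rw [h]
  congr

theorem isState_iff (ψ : Amplitudes V.witness) : IsState ψ ↔
    ‖(WithLp.toLp 2 (V.startState ψ) : State (Fin (V.witness + V.ancilla)))‖ = 1 := by
  rw [IsState, ← norm_sq_startState, pow_eq_one_iff_of_nonneg (norm_nonneg _) two_ne_zero]

theorem acceptProb_nonneg (ψ : Amplitudes V.witness) : 0 ≤ V.acceptProb ψ := by
  rw [acceptProb_eq]; exact sq_nonneg _

theorem acceptProb_le_one {ψ : Amplitudes V.witness} (hψ : IsState ψ) : V.acceptProb ψ ≤ 1 := by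
  rw [acceptProb_eq]
  refine (norm_proj_le _ _).trans ?_
  rw [LinearIsometryEquiv.norm_map, (isState_iff ψ).1 hψ, one_pow]

/-- Every nonzero state with ancillae zero is a multiple of the start state of a witness. -/
theorem exists_isState {χ : State (Fin (V.witness + V.ancilla))} (hχ : χ ∈ supp V.Start)
    (h0 : χ ≠ 0) : ∃ ψ : Amplitudes V.witness, IsState ψ ∧
      V.acceptProb ψ * ‖χ‖ ^ 2 = ‖proj (fun z => z V.output = true) (opL V.qgates χ)‖ ^ 2 := by
  have hn : ‖χ‖ ≠ 0 := norm_ne_zero_iff.2 h0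
  set u : State (Fin (V.witness + V.ancilla)) := ((‖χ‖⁻¹ : ℝ) : ℂ) • χ with hu
  have h1 : V.startState (V.witnessState u) = u.ofLp :=
    startState_witnessState (Submodule.smul_mem _ _ hχ)
  have hn' : ‖((‖χ‖⁻¹ : ℝ) : ℂ)‖ = ‖χ‖⁻¹ := by
    rw [Complex.norm_real, norm_inv, norm_norm]
  refine ⟨V.witnessState u, ?_, ?_⟩
  · rw [isState_iff, h1]
    change ‖u‖ = 1
    rw [hu, norm_smul, hn', inv_mul_cancel₀ hn]
  · rw [acceptProb_eq, h1]
    change ‖proj _ (opL V.qgates u)‖ ^ 2 * _ = _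
    rw [hu, map_smul, map_smul, norm_smul, hn', mul_pow, mul_right_comm, ← mul_pow,
      inv_mul_cancel₀ hn, one_pow, one_mul]

theorem norm_proj_le_of_forall {b : ℝ} (hb : ∀ ψ : Amplitudes V.witness, IsState ψ →
    V.acceptProb ψ ≤ b) {χ : State (Fin (V.witness + V.ancilla))} (hχ : χ ∈ supp V.Start) :
    ‖proj (fun z => z V.output = true) (opL V.qgates χ)‖ ^ 2 ≤ b * ‖χ‖ ^ 2 := by
  by_cases h0 : χ = 0
  · simp [h0]
  · obtain ⟨ψ, h1, h2⟩ := exists_isState hχ h0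
    rw [← h2]
    exact mul_le_mul_of_nonneg_right (hb ψ h1) (sq_nonneg _)

theorem exists_isState' (M : ℕ) : ∃ ψ : Amplitudes M, IsState ψ :=
  ⟨fun y => if y = fun _ => false then 1 else 0, by
    rw [IsState, Finset.sum_eq_single fun _ => false]
    · simp
    · intro y _ hy; simp [hy]
    · simp⟩

/-- The highest acceptance probability is attained. -/
theorem exists_acceptProb_eq_max (V : Circuit) : ∃ ψ : Amplitudes V.witness, IsState ψ ∧
    V.acceptProb ψ = V.maxAcceptProb ∧ ∀ φ, IsState φ → V.acceptProb φ ≤ V.maxAcceptProb := by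
  set K : Set (State (Fin (V.witness + V.ancilla))) := Metric.sphere 0 1 ∩ supp V.Start with hK
  have hKc : IsCompact K := (isCompact_sphere _ _).inter_right
    (Submodule.closed_of_finiteDimensional _)
  obtain ⟨ψ₀, hψ₀⟩ := exists_isState' V.witness
  have hmem : ∀ ψ : Amplitudes V.witness, IsState ψ → WithLp.toLp 2 (V.startState ψ) ∈ K :=
    fun ψ hψ => ⟨by rw [mem_sphere_zero_iff_norm, ← isState_iff]; exact hψ, startState_mem ψ⟩
  have hf : Continuous fun χ : State (Fin (V.witness + V.ancilla)) =>
      ‖proj (fun z => z V.output = true) (opL V.qgates χ)‖ ^ 2 :=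
    ((LinearMap.continuous_of_finiteDimensional _).comp (opL V.qgates).continuous).norm.pow 2
  obtain ⟨χ, hχ, hmax⟩ := hKc.exists_isMaxOn ⟨_, hmem ψ₀ hψ₀⟩ hf.continuousOn
  have hs := startState_witnessState hχ.2
  have hstate : IsState (V.witnessState χ) := by
    rw [isState_iff, hs]
    exact mem_sphere_zero_iff_norm.1 hχ.1
  have hle : ∀ φ, IsState φ → V.acceptProb φ ≤ V.acceptProb (V.witnessState χ) := by
    intro φ hφ
    rw [acceptProb_eq, acceptProb_eq, hs]
    exact hmax (hmem φ hφ)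
  have hsup : V.maxAcceptProb = V.acceptProb (V.witnessState χ) := by
    refine IsGreatest.csSup_eq ⟨⟨_, hstate, rfl⟩, ?_⟩
    rintro _ ⟨φ, hφ, rfl⟩
    exact hle φ hφ
  exact ⟨_, hstate, hsup.symm, fun φ hφ => hsup ▸ hle φ hφ⟩

theorem maxAcceptProb_nonneg (V : Circuit) : 0 ≤ V.maxAcceptProb := by
  obtain ⟨ψ, -, h, -⟩ := V.exists_acceptProb_eq_max
  rw [← h]; exact acceptProb_nonneg ψ

theorem maxAcceptProb_le_one (V : Circuit) : V.maxAcceptProb ≤ 1 := by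
  obtain ⟨ψ, hψ, h, -⟩ := V.exists_acceptProb_eq_max
  rw [← h]; exact acceptProb_le_one hψ

end Circuit

/-! ### The amplified verifier -/

/-- The qubit with the number `j` (modulo the number of qubits). -/
def label (M : ℕ) (h : 0 < M) (j : ℕ) : Fin M := ⟨j % M, Nat.mod_lt _ h⟩

/-- A gate on `M` qubits; junk if the qubits of the given gate are not distinct and below `M`. -/
def QGate.toGate {M : ℕ} (h : 0 < M) : QGate ℕ → Gate M
  | .not i => .not (label M h i)
  | .had i => .had (label M h i)
  | .phase k b i => .phase k b (label M h i)
  | .cnot c i => if h1 : label M h c ≠ label M h i then .cnot _ _ h1 else .not (label M h i)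
  | .toffoli c d i =>
    if h1 : label M h c ≠ label M h d ∧ label M h c ≠ label M h i ∧ label M h d ≠ label M h i then
      .toffoli _ _ _ h1.1 h1.2.1 h1.2.2 else .not (label M h i)

/-- Bit-string description of a gate. -/
def QGate.encode : QGate ℕ → List Bool
  | .not i => unary 0 ++ unary i
  | .had i => unary 1 ++ unary i
  | .phase k b i => unary 2 ++ unary k ++ [b] ++ unary i
  | .cnot c i => unary 3 ++ unary c ++ unary i
  | .toffoli c d i => unary 4 ++ unary c ++ unary d ++ unary i

theorem label_val {M : ℕ} (h : 0 < M) {j : ℕ} (hj : j < M) : (label M h j : ℕ) = j :=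
  Nat.mod_eq_of_lt hj

theorem labels_label {M : ℕ} (h : 0 < M) : Labels (label M h) M := by
  intro i hi j hj hij
  rw [← label_val h hi, ← label_val h hj, hij]

theorem QGate.toQ_toGate {M : ℕ} (h : 0 < M) {g : QGate ℕ} (hg : g.Distinct)
    (hM : ∀ i, g.Touches i → i < M) : (g.toGate h).toQ = g.map (label M h) := by
  have hd := QGate.distinct_map_of_injOn (e := label M h)
    (fun i j hi hj hij => labels_label h i (hM i hi) j (hM j hj) hij) hg
  cases g with
  | not i => rfl
  | had i => rfl
  | phase k b i => rfl
  | cnot c i =>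
    have hd : label M h c ≠ label M h i := hd
    rw [QGate.toGate, dif_pos hd]; rfl
  | toffoli c d i =>
    have hd : label M h c ≠ label M h d ∧ label M h c ≠ label M h i ∧ label M h d ≠ label M h i := hd
    rw [QGate.toGate, dif_pos hd]; rfl

theorem QGate.encode_toGate {M : ℕ} (h : 0 < M) {g : QGate ℕ} (hg : g.Distinct)
    (hM : ∀ i, g.Touches i → i < M) : (g.toGate h).encode = g.encode := by
  have hd := QGate.distinct_map_of_injOn (e := label M h)
    (fun i j hi hj hij => labels_label h i (hM i hi) j (hM j hj) hij) hg
  cases g with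
  | not i => rw [toGate, Gate.encode, encode, label_val h (hM i rfl)]
  | had i => rw [toGate, Gate.encode, encode, label_val h (hM i rfl)]
  | phase k b i => rw [toGate, Gate.encode, encode, label_val h (hM i rfl)]
  | cnot c i =>
    have hd : label M h c ≠ label M h i := hd
    rw [toGate, dif_pos hd, Gate.encode, encode, label_val h (hM c (Or.inl rfl)),
      label_val h (hM i (Or.inr rfl))]
  | toffoli c d i =>
    have hd : label M h c ≠ label M h d ∧ label M h c ≠ label M h i ∧ label M h d ≠ label M h i := hd
    rw [toGate, dif_pos hd, Gate.encode, encode, label_val h (hM c (Or.inl rfl)),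
      label_val h (hM d (Or.inr (Or.inl rfl))), label_val h (hM i (Or.inr (Or.inr rfl)))]

theorem Gate.encode_toQ {M : ℕ} (g : Gate M) :
    (g.toQ.map fun i : Fin M => (i : ℕ)).encode = g.encode := by
  cases g <;> rfl

namespace Circuit

variable (V : Circuit) (t N : ℕ) (κ : List Bool)

/-- The data for the amplification of `V`. -/
def params : Params where
  t := t
  n := V.witness
  m := V.ancilla
  N := N
  κ := κ
  out := V.output
  gates := V.qgates.map (QGate.map fun i : Fin (V.witness + V.ancilla) => (i : ℕ))

theorem distinct_qgates : ∀ g ∈ V.qgates, g.Distinct := by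
  intro g hg
  obtain ⟨g, -, rfl⟩ := List.mem_map.1 hg
  exact g.distinct_toQ

theorem valid_params : (V.params t N κ).Valid where
  out_lt := V.output.2
  distinct g hg := by
    obtain ⟨g, hg', rfl⟩ := List.mem_map.1 hg
    exact QGate.distinct_map Fin.val_injective (V.distinct_qgates g hg')
  bound g hg i hi := by
    obtain ⟨g, -, rfl⟩ := List.mem_map.1 hg
    obtain ⟨j, -, rfl⟩ := QGate.touches_map hi
    exact j.2

/-- The number of ancillae of the amplified verifier. -/
def amplifiedAncilla : ℕ := t + 2 * V.ancilla + 2 * N + 9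

theorem total_params : (V.params t N κ).total = V.witness + t + V.amplifiedAncilla t N := by
  simp only [params, Params.total, amplifiedAncilla]
  omega

theorem amplified_pos : 0 < V.witness + t + V.amplifiedAncilla t N := by
  rw [amplifiedAncilla]; omega

/-- The verifier that makes `N` rounds of the test and checks that the phase is at most `κ`. -/
def amplified : Circuit where
  witness := V.witness + t
  ancilla := V.amplifiedAncilla t N
  output := label _ (V.amplified_pos t N) (2 * t + V.witness + 2 * V.ancilla + N + 8 + N)
  gates := ((V.params t N κ).circuit id).map (QGate.toGate (V.amplified_pos t N))

theorem encode_amplified : (V.amplified t N κ).encode = unary (V.witness + t) ++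
    unary (t + 2 * V.ancilla + 2 * N + 9) ++
    unary (2 * t + V.witness + 2 * V.ancilla + N + 8 + N) ++
    ((V.params t N κ).circuit id).flatMap QGate.encode := by
  have h : (2 * t + V.witness + 2 * V.ancilla + N + 8 + N)
      < V.witness + t + V.amplifiedAncilla t N := by
    rw [amplifiedAncilla]; omega
  have e1 : (((V.params t N κ).circuit id).map (QGate.toGate (V.amplified_pos t N))).flatMap
      Gate.encode = ((V.params t N κ).circuit id).flatMap QGate.encode := by
    rw [List.flatMap_map]
    refine List.flatMap_congr fun g hg => ?_
    obtain ⟨h1, h2⟩ := (V.params t N κ).mem_circuit (V.valid_params t N κ) hg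
    exact QGate.encode_toGate _ h1 fun i hi => V.total_params t N κ ▸ h2 i hi
  rw [encode]
  simp only [amplified]
  rw [label_val _ h, e1]
  rfl

theorem qgates_amplified : (V.amplified t N κ).qgates
    = (V.params t N κ).circuit (label _ (V.amplified_pos t N)) := by
  rw [← Params.map_circuit, qgates]
  simp only [amplified]
  rw [List.map_map]
  refine List.map_congr_left fun g hg => ?_
  obtain ⟨h1, h2⟩ := (V.params t N κ).mem_circuit (V.valid_params t N κ) hg
  exact QGate.toQ_toGate _ h1 fun i hi => V.total_params t N κ ▸ h2 i hi

theorem labels_amplified :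
    Labels (label _ (V.amplified_pos t N)) (V.params t N κ).total := by
  rw [total_params]
  exact labels_label _

theorem start_amplified (z : Fin (V.witness + t + V.amplifiedAncilla t N) → Bool) :
    (V.amplified t N κ).Start z ↔
      Zeros (label _ (V.amplified_pos t N)) (V.params t N κ).total (t + V.witness) z := by
  rw [Zeros, total_params]
  constructor
  · intro h j hj
    refine h _ ?_
    change V.witness + t ≤ (label _ (V.amplified_pos t N) j : ℕ)
    rw [label_val _ hj.2]
    omega
  · intro h i hi
    have hi' : V.witness + t ≤ (i : ℕ) := hi
    have h1 : (i : ℕ) < V.witness + t + V.amplifiedAncilla t N := i.2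
    have := h i ⟨by omega, h1⟩
    rwa [show label _ (V.amplified_pos t N) (i : ℕ) = i from Fin.ext (label_val _ h1)] at this

variable {V t N κ}

/-- Soundness of the amplified verifier. -/
theorem acceptProb_amplified_le (hκ : κ.length = t) {b g : ℝ} (hg : 0 ≤ g) (hg1 : g ≤ 1)
    (hb : ∀ ψ : Amplitudes V.witness, IsState ψ → V.acceptProb ψ ≤ b)
    (hK : ∀ K ≤ bval κ, b + g ≤ Real.cos (Real.pi * (K / 2 ^ t)) ^ 2)
    {j : ℕ} (hj : N = 2 * j) {ψ : Amplitudes (V.amplified t N κ).witness} (hψ : IsState ψ) :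
    (V.amplified t N κ).acceptProb ψ ≤ (1 - g ^ 2) ^ j := by
  have h := Params.norm_proj_circuit_le (V.valid_params t N κ) (V.labels_amplified t N κ) hκ
    V.distinct_qgates rfl (o := V.output) rfl hg hg1
    (fun χ hχ => norm_proj_le_of_forall hb hχ) hK hj
    (v := WithLp.toLp 2 ((V.amplified t N κ).startState ψ))
    (supp_mono (fun z hz => (V.start_amplified t N κ z).1 hz) (startState_mem ψ))
  rw [acceptProb_eq, qgates_amplified]
  refine h.trans (le_of_eq ?_)
  have h1 : ‖(WithLp.toLp 2 ((V.amplified t N κ).startState ψ) :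
      State (Fin ((V.amplified t N κ).witness + (V.amplified t N κ).ancilla)))‖ = 1 :=
    (isState_iff ψ).1 hψ
  have h2 : ‖(WithLp.toLp 2 ((V.amplified t N κ).startState ψ) :
      State (Fin (V.witness + t + V.amplifiedAncilla t N)))‖ = 1 := h1
  rw [h2, one_pow, mul_one]

/-- Completeness of the amplified verifier. -/
theorem exists_acceptProb_amplified_eq_one (hκ : κ.length = t) {k : ℕ} (hk : k < 2 ^ t)
    (hkκ : k ≤ bval κ) (hV : V.minPhase = k / 2 ^ t) :
    ∃ ψ : Amplitudes (V.amplified t N κ).witness, IsState ψ ∧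
      (V.amplified t N κ).acceptProb ψ = 1 := by
  obtain ⟨φ, hφ, hmax, hle⟩ := V.exists_acceptProb_eq_max
  have hp : Real.cos (Real.pi * (k / 2 ^ t)) ^ 2 = V.maxAcceptProb := by
    rw [← hV]
    exact cos_sq_angle V.maxAcceptProb_nonneg V.maxAcceptProb_le_one
  have hn := (isState_iff φ).1 hφ
  obtain ⟨v, hv, hv0, h⟩ := Params.exists_norm_proj_circuit_eq (V.valid_params t N κ)
    (V.labels_amplified t N κ) hκ V.distinct_qgates rfl (o := V.output) rfl hk hkκ
    (fun χ hχ => by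
      change _ ≤ Real.cos (Real.pi * (k / 2 ^ t)) ^ 2 * _
      rw [hp]; exact norm_proj_le_of_forall hle hχ)
    (χ := WithLp.toLp 2 (V.startState φ)) (fun h0 => by
      have : ‖(WithLp.toLp 2 (V.startState φ) : State (Fin (V.witness + V.ancilla)))‖ = 0 := by
        rw [norm_eq_zero]; exact h0
      rw [this] at hn; exact zero_ne_one hn) (startState_mem φ) (by
      change _ = Real.cos (Real.pi * (k / 2 ^ t)) ^ 2 * _
      rw [hp, ← hmax, acceptProb_eq]
      have h2 : ‖(WithLp.toLp 2 (V.startState φ) :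
        State (Fin ((V.params t N κ).n + (V.params t N κ).m)))‖ = 1 := hn
      rw [h2, one_pow, mul_one]
      rfl)
  obtain ⟨ψ, hψ, h1⟩ := exists_isState (V := V.amplified t N κ)
    (supp_mono (fun z hz => (V.start_amplified t N κ z).2 hz) hv) hv0
  refine ⟨ψ, hψ, ?_⟩
  rw [qgates_amplified] at h1
  have h2 : (V.amplified t N κ).acceptProb ψ * ‖v‖ ^ 2 = ‖v‖ ^ 2 := h1.trans (by rw [← h]; rfl)
  have h3 : ‖v‖ ^ 2 ≠ 0 := pow_ne_zero _ (norm_ne_zero_iff.2 hv0)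
  exact mul_right_cancel₀ h3 (h2.trans (one_mul _).symm)

end Circuit

open Code

/-! ### Computing with descriptions of circuits -/

/-- The fields of a gate: its kind, the sign of its phase, its qubits and the exponent of its
phase. -/
def QGate.fields : QGate ℕ → ℕ × Bool × ℕ × ℕ × ℕ × ℕ
  | .not i => (0, false, i, 0, 0, 0)
  | .had i => (1, false, i, 0, 0, 0)
  | .phase k b i => (2, b, i, 0, 0, k)
  | .cnot c i => (3, false, c, i, 0, 0)
  | .toffoli c d i => (4, false, c, d, i, 0)

instance : Code (QGate ℕ) := ⟨fun g => enc g.fields⟩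

namespace PolyFun

variable {α : Type*} [Code α]

theorem fields {g : α → QGate ℕ} (hg : PolyFun g) : PolyFun fun a => (g a).fields :=
  hg.of_enc fun _ => rfl

@[fun_prop]
theorem not_gate {i : α → ℕ} (hi : PolyFun i) : PolyFun fun a => QGate.not (i a) :=
  ((const 0).mk ((const false).mk (hi.mk ((const 0).mk ((const 0).mk (const 0)))))).of_enc
    fun _ => rfl

@[fun_prop]
theorem had_gate {i : α → ℕ} (hi : PolyFun i) : PolyFun fun a => QGate.had (i a) :=
  ((const 1).mk ((const false).mk (hi.mk ((const 0).mk ((const 0).mk (const 0)))))).of_enc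
    fun _ => rfl

@[fun_prop]
theorem phase_gate {k i : α → ℕ} {b : α → Bool} (hk : PolyFun k) (hb : PolyFun b)
    (hi : PolyFun i) : PolyFun fun a => QGate.phase (k a) (b a) (i a) :=
  ((const 2).mk (hb.mk (hi.mk ((const 0).mk ((const 0).mk hk))))).of_enc fun _ => rfl

@[fun_prop]
theorem cnot_gate {c i : α → ℕ} (hc : PolyFun c) (hi : PolyFun i) :
    PolyFun fun a => QGate.cnot (c a) (i a) :=
  ((const 3).mk ((const false).mk (hc.mk (hi.mk ((const 0).mk (const 0)))))).of_enc fun _ => rfl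

@[fun_prop]
theorem toffoli_gate {c d i : α → ℕ} (hc : PolyFun c) (hd : PolyFun d) (hi : PolyFun i) :
    PolyFun fun a => QGate.toffoli (c a) (d a) (i a) :=
  ((const 4).mk ((const false).mk (hc.mk (hd.mk (hi.mk (const 0)))))).of_enc fun _ => rfl

@[fun_prop]
theorem inv_gate {g : α → QGate ℕ} (hg : PolyFun g) : PolyFun fun a => (g a).inv := by
  have hf := hg.fields
  have h : PolyFun fun a => ((g a).fields.1,
      (bif (g a).fields.1.beq 2 then !(g a).fields.2.1 else (g a).fields.2.1),
      (g a).fields.2.2) := by fun_prop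
  refine h.of_enc fun a => ?_
  cases g a <;> rfl

theorem shift_gate {g : α → QGate ℕ} {t : α → ℕ} (hg : PolyFun g) (ht : PolyFun t) :
    PolyFun fun a => (g a).map fun i => t a + i := by
  have hf := hg.fields
  have h : PolyFun fun a => ((g a).fields.1, (g a).fields.2.1, t a + (g a).fields.2.2.1,
      (bif Nat.ble 3 (g a).fields.1 then t a + (g a).fields.2.2.2.1 else 0),
      (bif Nat.ble 4 (g a).fields.1 then t a + (g a).fields.2.2.2.2.1 else 0),
      (g a).fields.2.2.2.2.2) := by fun_prop
  refine h.of_enc fun a => ?_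
  cases g a <;> rfl

@[fun_prop]
theorem unary_fun {n : α → ℕ} (hn : PolyFun n) : PolyFun fun a => unary (n a) :=
  (hn.list_replicate (const true)).list_append (const [false])

@[fun_prop]
theorem encode_gate {g : α → QGate ℕ} (hg : PolyFun g) : PolyFun fun a => (g a).encode := by
  have hf := hg.fields
  have h : PolyFun fun a => unary (g a).fields.1 ++
      (bif (g a).fields.1.beq 2 then unary (g a).fields.2.2.2.2.2 ++ [(g a).fields.2.1] else []) ++
      unary (g a).fields.2.2.1 ++
      (bif Nat.ble 3 (g a).fields.1 then unary (g a).fields.2.2.2.1 else []) ++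
      (bif Nat.ble 4 (g a).fields.1 then unary (g a).fields.2.2.2.2.1 else []) := by fun_prop
  refine h.of_enc fun a => ?_
  cases g a <;> simp [QGate.encode, QGate.fields, Nat.ble, Nat.beq]

/-! ### Reading the description of a circuit -/

end PolyFun

/-- The number of ones at the beginning of a bit string. -/
def leadingOnes (l : List Bool) : ℕ :=
  (l.foldl (fun (s : Bool × ℕ) b => (s.1 && b, bif s.1 && b then s.2 + 1 else s.2)) (true, 0)).2

/-- What is left after reading a number in unary. -/
def afterUnary (l : List Bool) : List Bool := l.drop (leadingOnes l + 1)

theorem leadingOnes_unary (k : ℕ) (l : List Bool) : leadingOnes (unary k ++ l) = k := by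
  have h1 : ∀ (l : List Bool) c, l.foldl (fun (s : Bool × ℕ) b =>
      (s.1 && b, bif s.1 && b then s.2 + 1 else s.2)) (false, c) = (false, c) := by
    intro l c
    induction l with
    | nil => rfl
    | cons b l ih => exact ih
  have h2 : ∀ k c, (unary k ++ l).foldl (fun (s : Bool × ℕ) b =>
      (s.1 && b, bif s.1 && b then s.2 + 1 else s.2)) (true, c) = (false, c + k) := by
    intro k
    induction k with
    | zero => intro c; exact h1 l c
    | succ k ih =>
      intro c
      refine (ih (c + 1)).trans ?_
      rw [add_right_comm, add_assoc]
  rw [leadingOnes, h2, zero_add]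

theorem afterUnary_unary (k : ℕ) (l : List Bool) : afterUnary (unary k ++ l) = l := by
  rw [afterUnary, leadingOnes_unary]
  exact List.drop_left' (by simp [unary])

/-- Reads a gate. -/
def readGate (l : List Bool) : QGate ℕ :=
  let tag := leadingOnes l
  let l₁ := afterUnary l
  let l₂ := afterUnary l₁
  bif tag.beq 0 then .not (leadingOnes l₁)
  else bif tag.beq 1 then .had (leadingOnes l₁)
  else bif tag.beq 2 then .phase (leadingOnes l₁) (l₂.headD false) (leadingOnes l₂.tail)
  else bif tag.beq 3 then .cnot (leadingOnes l₁) (leadingOnes l₂)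
  else .toffoli (leadingOnes l₁) (leadingOnes l₂) (leadingOnes (afterUnary l₂))

/-- What is left after reading a gate. -/
def afterGate (l : List Bool) : List Bool :=
  let tag := leadingOnes l
  let l₁ := afterUnary l
  let l₂ := afterUnary l₁
  bif Nat.ble tag 1 then l₂
  else bif tag.beq 2 then afterUnary l₂.tail
  else bif tag.beq 3 then afterUnary l₂
  else afterUnary (afterUnary l₂)

theorem readGate_encode (g : QGate ℕ) (l : List Bool) : readGate (g.encode ++ l) = g := by
  cases g <;>
    simp [QGate.encode, readGate, leadingOnes_unary, afterUnary_unary, List.append_assoc, Nat.beq]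

theorem afterGate_encode (g : QGate ℕ) (l : List Bool) : afterGate (g.encode ++ l) = l := by
  cases g <;>
    simp [QGate.encode, afterGate, leadingOnes_unary, afterUnary_unary, List.append_assoc,
      Nat.ble, Nat.beq]

/-- Moves one gate from a description to a list. -/
def readStep (s : List Bool × List (QGate ℕ)) : List Bool × List (QGate ℕ) :=
  bif s.1.isEmpty then s else (afterGate s.1, readGate s.1 :: s.2)

theorem readStep_iterate (L : List (QGate ℕ)) (n : ℕ) :
    readStep^[n] (L.flatMap QGate.encode, []) =
      ((L.drop n).flatMap QGate.encode, (L.take n).reverse) := by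
  have hne : ∀ (g : QGate ℕ) l, (g.encode ++ l).isEmpty = false := fun g l => by
    cases g <;> simp [QGate.encode, unary]
  have h : ∀ (L : List (QGate ℕ)) n acc, readStep^[n] (L.flatMap QGate.encode, acc)
      = ((L.drop n).flatMap QGate.encode, (L.take n).reverse ++ acc) := by
    intro L n
    induction n generalizing L with
    | zero => intro acc; rfl
    | succ n ih =>
      intro acc
      rw [Function.iterate_succ_apply]
      cases L with
      | nil => exact (ih [] acc).trans (by simp)
      | cons g L =>
        have e : readStep ((g :: L).flatMap QGate.encode, acc)
            = (L.flatMap QGate.encode, g :: acc) := by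
          simp only [List.flatMap_cons, readStep, hne, cond_false, afterGate_encode, readGate_encode]
        rw [e, ih]
        simp
  rw [h, List.append_nil]

theorem size_gate_le (g : QGate ℕ) : 2 * size g + 1 ≤ 30 * g.encode.length := by
  have h : size g = size g.fields := rfl
  have hu : ∀ k, (unary k).length = k + 1 := fun k => by simp [unary]
  rw [h]
  cases g <;> simp [QGate.fields, QGate.encode, hu] <;> omega

theorem size_gates_le (L : List (QGate ℕ)) : size L ≤ 30 * (L.flatMap QGate.encode).length := by
  induction L with
  | nil => simp
  | cons g L ih =>
    have := size_gate_le g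
    rw [size_cons, List.flatMap_cons, List.length_append]
    omega

theorem length_le_length_flatMap_encode (L : List (QGate ℕ)) :
    L.length ≤ (L.flatMap QGate.encode).length := by
  induction L with
  | nil => simp
  | cons g L ih =>
    have := size_gate_le g
    rw [List.length_cons, List.flatMap_cons, List.length_append]
    omega

namespace PolyFun

variable {α : Type*} [Code α]

@[fun_prop]
theorem leadingOnes_fun {l : α → List Bool} (hl : PolyFun l) : PolyFun fun a => leadingOnes (l a) :=
  snd (foldl_of_growth (f := fun _ (s : Bool × ℕ) b =>
    (s.1 && b, bif s.1 && b then s.2 + 1 else s.2)) hl (const (true, 0)) (by fun_prop)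
    (PolyBdd.const 1) (by
      intro a s b _
      rcases s with ⟨_ | _, c⟩ <;> cases b <;> simp
      omega))

@[fun_prop]
theorem afterUnary_fun {l : α → List Bool} (hl : PolyFun l) : PolyFun fun a => afterUnary (l a) :=
  hl.list_drop (hl.leadingOnes_fun.nat_add (const 1))

@[fun_prop]
theorem readGate_fun {l : α → List Bool} (hl : PolyFun l) : PolyFun fun a => readGate (l a) := by
  unfold readGate
  fun_prop

@[fun_prop]
theorem afterGate_fun {l : α → List Bool} (hl : PolyFun l) : PolyFun fun a => afterGate (l a) := by
  unfold afterGate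
  fun_prop

@[fun_prop]
theorem readStep_fun {s : α → List Bool × List (QGate ℕ)} (hs : PolyFun s) :
    PolyFun fun a => readStep (s a) := by
  unfold readStep
  fun_prop

theorem read_gates {L : α → List (QGate ℕ)}
    (h : PolyFun fun a => (L a).flatMap QGate.encode) : PolyFun L := by
  have h1 := iterate' (n := fun a => ((L a).flatMap QGate.encode).length)
    (init := fun a => ((L a).flatMap QGate.encode, ([] : List (QGate ℕ))))
    (f := fun _ s => readStep s) h.list_length (h.mk (const [])) (by fun_prop)
    (M := fun a => 100 * size ((L a).flatMap QGate.encode) + 1)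
    (((PolyBdd.const 100).mul h.size_bdd).add (PolyBdd.const 1)) (by
      intro a i _
      rw [readStep_iterate, size_pair, size_reverse, size_listBool, size_listBool]
      have e : (L a).flatMap QGate.encode = ((L a).take i).flatMap QGate.encode
          ++ ((L a).drop i).flatMap QGate.encode := by
        rw [← List.flatMap_append, List.take_append_drop]
      have h1 := size_gates_le ((L a).take i)
      rw [e, List.length_append]
      omega)
  refine (snd h1).list_reverse.of_enc fun a => ?_
  rw [readStep_iterate, List.reverse_reverse,
    List.take_of_length_le (length_le_length_flatMap_encode _)]

end PolyFun

theorem Circuit.encode_eq (V : Circuit) (t N : ℕ) (κ : List Bool) :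
    V.encode = unary V.witness ++ (unary V.ancilla ++ (unary V.output ++
      (V.params t N κ).gates.flatMap QGate.encode)) := by
  have h : V.gates.flatMap Gate.encode = (V.params t N κ).gates.flatMap QGate.encode := by
    simp only [params, qgates, List.map_map, List.flatMap_map]
    exact List.flatMap_congr fun g _ => (Gate.encode_toQ g).symm
  rw [Circuit.encode, h]
  simp only [List.append_assoc]

/-- The parameters are computable in polynomial time. -/
structure PolyParams {α : Type*} [Code α] (P : α → Params) : Prop where
  t : PolyFun fun a => (P a).t
  n : PolyFun fun a => (P a).n
  m : PolyFun fun a => (P a).m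
  N : PolyFun fun a => (P a).N
  κ : PolyFun fun a => (P a).κ
  out : PolyFun fun a => (P a).out
  gates : PolyFun fun a => (P a).gates

theorem polyParams {V : List Bool → Circuit} (hV : Uniform V) {t N : Str → ℕ} {κ : Str → List Bool}
    (ht : PolyFun t) (hN : PolyFun N) (hκ : PolyFun κ) :
    PolyParams fun x : Str => (V x.bits).params (t x) (N x) (κ x) := by
  have h0 := (polyTime_iff' _).1 hV
  have h1 := h0.afterUnary_fun
  have h2 := h1.afterUnary_fun
  have h3 := h2.afterUnary_fun
  have e0 : ∀ x : Str, (V x.bits).encode = unary (V x.bits).witness ++ (unary (V x.bits).ancilla ++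
      (unary (V x.bits).output ++
        ((V x.bits).params (t x) (N x) (κ x)).gates.flatMap QGate.encode)) := fun x =>
    Circuit.encode_eq _ _ _ _
  have g0 := h0.leadingOnes_fun
  have g1 := h1.leadingOnes_fun
  have g2 := h2.leadingOnes_fun
  simp only [e0, afterUnary_unary, leadingOnes_unary] at g0 g1 g2 h3
  exact ⟨ht, g0, g1, hN, hκ, g2, PolyFun.read_gates h3⟩

namespace PolyFun

variable {α : Type*} [Code α]

/-! ### Generating the amplified circuit -/

theorem invL_fun {L : α → List (QGate ℕ)} (hL : PolyFun L) : PolyFun fun a => invL (L a) :=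
  (list_map (f := fun _ g => QGate.inv g) hL (by fun_prop)).list_reverse

theorem block_fun {L : α → List (QGate ℕ)} {c f : α → ℕ} (hL : PolyFun L) (hc : PolyFun c)
    (hf : PolyFun f) : PolyFun fun a => block (L a) (c a) (f a) := by
  have := invL_fun hL
  unfold block czGates
  fun_prop

theorem round_fun {L₁ L₂ : α → List (QGate ℕ)} {f₁ f₂ c : α → ℕ} (h₁ : PolyFun L₁)
    (h₂ : PolyFun L₂) (hf₁ : PolyFun f₁) (hf₂ : PolyFun f₂) (hc : PolyFun c) :
    PolyFun fun a => round (L₁ a) (L₂ a) (f₁ a) (f₂ a) (c a) := by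
  have b1 := block_fun h₁ hc hf₁
  have b2 := block_fun h₂ hc hf₂
  unfold round
  fun_prop

end PolyFun

namespace PolyParams

variable {α : Type*} [Code α] {P : α → Params} (hP : PolyParams P)
include hP

theorem test : PolyFun fun a => (P a).test id := by
  obtain ⟨ht, hn, hm, hN, hκ, ho, hg⟩ := hP
  have h1 : PolyFun fun a => (P a).shifted id :=
    PolyFun.list_map (f := fun a g => QGate.map (fun i => id ((P a).t + i)) g) hg
      (PolyFun.shift_gate (PolyFun.snd PolyFun.id') (ht.comp PolyFun.prod_fst))
  have h2 : PolyFun fun a => phaseTest (P a).t id ((P a).t + (P a).n + (P a).m + 1) := by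
    have h3 : PolyFun fun p : α × ℕ => (P p.1).t := ht.comp PolyFun.prod_fst
    have h4 : PolyFun fun p : α × ℕ => (P p.1).n := hn.comp PolyFun.prod_fst
    have h5 : PolyFun fun p : α × ℕ => (P p.1).m := hm.comp PolyFun.prod_fst
    refine PolyFun.list_flatMap (f := fun a j => cphase ((P a).t - j) j
      ((P a).t + (P a).n + (P a).m + 1)) ht.list_range ?_
    unfold cphase
    fun_prop
  unfold Params.test testGates
  simp only [id] at *
  fun_prop

theorem zeroCheck : PolyFun fun a => (P a).zeroCheck id := by
  obtain ⟨ht, hn, hm, hN, hκ, ho, hg⟩ := hP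
  have h2 : PolyFun fun a => (List.range ((P a).m + 3)).flatMap ((P a).zeroStep id) := by
    have h3 : PolyFun fun p : α × ℕ => (P p.1).t := ht.comp PolyFun.prod_fst
    have h4 : PolyFun fun p : α × ℕ => (P p.1).n := hn.comp PolyFun.prod_fst
    have h5 : PolyFun fun p : α × ℕ => (P p.1).m := hm.comp PolyFun.prod_fst
    refine PolyFun.list_flatMap (f := fun a j => (P a).zeroStep id j) (by fun_prop) ?_
    unfold Params.zeroStep
    simp only [id]
    fun_prop
  unfold Params.zeroCheck
  simp only [id] at *
  fun_prop

theorem amplify : PolyFun fun a => (P a).amplify id := by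
  have hz := hP.zeroCheck
  have hw := hP.test
  obtain ⟨ht, hn, hm, hN, hκ, ho, hg⟩ := hP
  have h3 : PolyFun fun p : α × ℕ => (P p.1).t := ht.comp PolyFun.prod_fst
  have h4 : PolyFun fun p : α × ℕ => (P p.1).n := hn.comp PolyFun.prod_fst
  have h5 : PolyFun fun p : α × ℕ => (P p.1).m := hm.comp PolyFun.prod_fst
  refine PolyFun.list_flatMap (f := fun a i => round ((P a).zeroCheck id) ((P a).test id)
    ((P a).t + (P a).n + (P a).m + 3 + ((P a).m + 3)) ((P a).t + (P a).n + (P a).m + 2)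
    ((P a).t + (P a).n + 2 * (P a).m + 7 + i)) hN.list_range ?_
  exact PolyFun.round_fun (hz.comp PolyFun.prod_fst) (hw.comp PolyFun.prod_fst) (by fun_prop)
    (by fun_prop) (by fun_prop)

theorem final : PolyFun fun a => (P a).final id := by
  obtain ⟨ht, hn, hm, hN, hκ, ho, hg⟩ := hP
  have h3 : PolyFun fun p : α × ℕ => (P p.1).t := ht.comp PolyFun.prod_fst
  have h4 : PolyFun fun p : α × ℕ => (P p.1).n := hn.comp PolyFun.prod_fst
  have h5 : PolyFun fun p : α × ℕ => (P p.1).m := hm.comp PolyFun.prod_fst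
  have h6 : PolyFun fun p : α × ℕ => (P p.1).N := hN.comp PolyFun.prod_fst
  have h7 : PolyFun fun p : α × ℕ => (P p.1).κ := hκ.comp PolyFun.prod_fst
  have h8 : PolyFun fun a => (List.range (P a).t).flatMap ((P a).compareStep id) := by
    refine PolyFun.list_flatMap (f := fun a j => (P a).compareStep id j) (by fun_prop) ?_
    unfold Params.compareStep digit
    simp only [id]
    fun_prop
  have h9 : PolyFun fun a => (List.range (P a).N).flatMap ((P a).andStep id) := by
    refine PolyFun.list_flatMap (f := fun a j => (P a).andStep id j) (by fun_prop) ?_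
    unfold Params.andStep
    simp only [id]
    fun_prop
  unfold Params.final Params.compare
  simp only [id] at *
  fun_prop

theorem encode : PolyFun fun a => ((P a).circuit id).flatMap QGate.encode :=
  PolyFun.list_flatMap (f := fun _ g => QGate.encode g) (hP.amplify.list_append hP.final)
    (by fun_prop)

end PolyParams

theorem uniform_amplified {V : List Bool → Circuit} (hV : Uniform V) {t N : List Bool → ℕ}
    {κ : List Bool → List Bool} (ht : PolyFun fun x : Str => t x.bits)
    (hN : PolyFun fun x : Str => N x.bits) (hκ : PolyFun fun x : Str => κ x.bits) :
    Uniform fun x => (V x).amplified (t x) (N x) (κ x) := by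
  rw [Uniform, polyTime_iff']
  have hP := polyParams hV ht hN hκ
  have h1 := hP.encode
  have hn : PolyFun fun x : Str => (V x.bits).witness := hP.n
  have hm : PolyFun fun x : Str => (V x.bits).ancilla := hP.m
  have key : ∀ {t n m N : Str → ℕ} {L : Str → List Bool}, PolyFun t → PolyFun n → PolyFun m →
      PolyFun N → PolyFun L → PolyFun fun x => unary (n x + t x) ++
        unary (t x + 2 * m x + 2 * N x + 9) ++
        unary (2 * t x + n x + 2 * m x + N x + 8 + N x) ++ L x := by
    intro t n m N L ht hn hm hN hL
    fun_prop
  exact (key ht hn hm hN h1).of_enc fun x => by rw [Circuit.encode_amplified]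

open Code

/-! ### Amplification -/

theorem polyFun_of_polyTime_unary {t : ℕ → ℕ} (ht : PolyTime fun x => unary (t x.length)) :
    PolyFun fun x : Str => t x.bits.length := by
  refine ((polyTime_iff' _).1 ht).leadingOnes_fun.of_enc fun x => ?_
  have := leadingOnes_unary (t x.bits.length) []
  rw [List.append_nil] at this
  rw [this]

/-- The digits of the threshold for the phases: the phase that belongs to `a`, up to an error
below `1 / (8 q)`. -/
def thresholdDigits (a : ℚ) (t q : ℕ) : List Bool :=
  threshold t (Nat.log 2 (8 * q)) a.num.natAbs.bits a.den.bits

theorem PolyFun.thresholdDigits_fun {a : ℕ → ℚ} {t q : ℕ → ℕ}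
    (ha : PolyTime fun x => encodeRat (a x.length)) (ht : PolyFun fun x : Str => t x.bits.length)
    (hq : PolyFun fun x : Str => q x.bits.length) (hq0 : ∀ l, 0 < q l) :
    PolyFun fun x : Str => thresholdDigits (a x.bits.length) (t x.bits.length)
      (q x.bits.length) := by
  have h8 : PolyFun fun x : Str => 8 * q x.bits.length := (const 8).nat_mul hq
  have h1 : ∀ l, 1 ≤ 8 * q l := fun l => by have := hq0 l; omega
  have hr : PolyFun fun x : Str => readBin (encodeRat (a x.bits.length)) :=
    PolyFun.readBin_fun.comp ((polyTime_iff' _).1 ha)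
  have hN : PolyFun fun x : Str => (readBin (encodeRat (a x.bits.length))).tail.headD [] := by
    fun_prop
  have hD : PolyFun fun x : Str => (readBin (encodeRat (a x.bits.length))).headD [] := by
    fun_prop
  have hlog := PolyFun.nat_log h8 fun x => h1 x.bits.length
  refine (PolyFun.threshold_fun ht hlog hN hD ?_).of_enc fun x => ?_
  · refine h8.size_bdd.mono fun x => ?_
    rw [size_nat]
    exact Nat.pow_log_le_self 2 (by have := h1 x.bits.length; omega)
  · rw [readBin_encodeRat]
    rfl

theorem num_div_den {a : ℚ} (ha : 0 ≤ a) :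
    (a : ℝ) = (bval a.num.natAbs.bits : ℝ) / bval a.den.bits := by
  rw [bval_bits, bval_bits]
  have h1 : ((a.num.natAbs : ℤ) : ℝ) = (a.num : ℝ) := by
    rw [Int.natAbs_of_nonneg (Rat.num_nonneg.2 ha)]
  rw [← Int.cast_natCast, h1]
  exact Rat.cast_def a

theorem cos_sq_ge_of_le_thresholdDigits {a b : ℚ} {t q : ℕ} (hq : 0 < q) (ha0 : 0 < a) (ha1 : a ≤ 1)
    (hab : 1 / (q : ℚ) ≤ a - b) {K : ℕ} (hK : K ≤ bval (thresholdDigits a t q)) :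
    (b : ℝ) + 1 / (2 * q) ≤ Real.cos (Real.pi * (K / 2 ^ t)) ^ 2 := by
  have ha0' : (0 : ℝ) < a := by exact_mod_cast ha0
  have ha1' : (a : ℝ) ≤ 1 := by exact_mod_cast ha1
  have hab' : ((1 / (q : ℚ) : ℚ) : ℝ) ≤ ((a - b : ℚ) : ℝ) := by exact_mod_cast hab
  push_cast at hab'
  have hq' : (0 : ℝ) < q := by exact_mod_cast hq
  have h1 := le_of_le_threshold ha0' ha1' _ _ (by rw [bval_bits]; exact a.den_pos)
    (num_div_den ha0.le) _ t K hK
  have h2 := cos_sq_ge_of_le ha0'.le ha1' (by positivity) (by positivity) h1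
  have h3 : (8 * q : ℝ) ≤ 2 ^ (Nat.log 2 (8 * q) + 1) := by
    have := (Nat.lt_pow_succ_log_self (b := 2) (by norm_num) (8 * q)).le
    exact_mod_cast this
  have h4 : 4 * (1 / (2 : ℝ) ^ (Nat.log 2 (8 * q) + 1)) ≤ 1 / (2 * q) := by
    calc 4 * (1 / (2 : ℝ) ^ (Nat.log 2 (8 * q) + 1)) ≤ 4 * (1 / (8 * q)) := by gcongr
      _ = 1 / (2 * q) := by field_simp; norm_num
  have h5 : 1 / (q : ℝ) = 1 / (2 * q) + 1 / (2 * q) := by field_simp; norm_num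
  linarith

theorem pow_le_exp {q r : ℕ} (hq : 0 < q) :
    (1 - (1 / (2 * q : ℝ)) ^ 2) ^ (4 * q ^ 2 * r) ≤ Real.exp (-(r : ℝ)) := by
  have hq1 : (1 : ℝ) ≤ q := by exact_mod_cast hq
  have h0 : (1 / (2 * q : ℝ)) ^ 2 ≤ 1 := by
    have : 1 / (2 * q : ℝ) ≤ 1 := by rw [div_le_one (by positivity)]; linarith
    exact pow_le_one₀ (by positivity) this
  have h1 := Real.one_sub_le_exp_neg ((1 / (2 * q : ℝ)) ^ 2)
  calc (1 - (1 / (2 * q : ℝ)) ^ 2) ^ (4 * q ^ 2 * r)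
      ≤ Real.exp (-(1 / (2 * q : ℝ)) ^ 2) ^ (4 * q ^ 2 * r) :=
        pow_le_pow_left₀ (by linarith) h1 _
    _ = Real.exp (-(r : ℝ)) := by
      rw [← Real.exp_nat_mul]
      congr 1
      push_cast
      field_simp
      ring

/-- Amplification with perfect completeness of a verifier whose phase is exactly expressible. -/
theorem exists_amplified {L : PromiseProblem} {V : List Bool → Circuit} {a b : ℕ → ℚ} {t : ℕ → ℕ}
    (hV : IsVerifier L V a b) (ht : PolyTime fun x => unary (t x.length))
    (hE : HasExactPhase L V t) (r : Polynomial ℕ) :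
    ∃ V' : List Bool → Circuit, Uniform V' ∧
      (∀ x, (V' x).witness = (V x).witness + t x.length) ∧
      (∃ q : Polynomial ℕ, ∀ x, (V' x).ancilla ≤ q.eval x.length) ∧
      (∀ x ∈ L.yes, ∃ ψ : Amplitudes (V' x).witness,
        Circuit.IsState ψ ∧ (V' x).acceptProb ψ = 1) ∧
      (∀ x ∈ L.no, ∀ ψ : Amplitudes (V' x).witness,
        Circuit.IsState ψ → (V' x).acceptProb ψ ≤ Real.exp (-((r.eval x.length : ℕ) : ℝ))) := by
  obtain ⟨q, hq⟩ := hV.gap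
  have hlen : PolyFun fun x : Str => x.bits.length := by fun_prop
  have htF := polyFun_of_polyTime_unary ht
  have hqF : PolyFun fun x : Str => q.eval x.bits.length := PolyFun.poly_eval q hlen
  have hNF : PolyFun fun x : Str =>
      2 * (4 * q.eval x.bits.length ^ 2 * r.eval x.bits.length) :=
    (PolyFun.const 2).nat_mul (((PolyFun.const 4).nat_mul (hqF.nat_pow 2)).nat_mul
      (PolyFun.poly_eval r hlen))
  have hκF := PolyFun.thresholdDigits_fun hV.computable_a htF hqF fun l => (hq l).1
  have ha0 : ∀ l, 0 < a l := fun l => by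
    have h1 := hV.b_nonneg l
    have h2 := (hq l).2
    have h3 : 0 < 1 / ((q.eval l : ℕ) : ℚ) := by
      have : (0 : ℚ) < (q.eval l : ℕ) := by exact_mod_cast (hq l).1
      positivity
    linarith
  refine ⟨fun x => (V x).amplified (t x.length) (2 * (4 * q.eval x.length ^ 2 * r.eval x.length))
    (thresholdDigits (a x.length) (t x.length) (q.eval x.length)),
    uniform_amplified hV.uniform htF hNF hκF, fun x => rfl, ?_, ?_, ?_⟩
  · have hm : PolyFun fun x : Str => (V x.bits).ancilla := (polyParams hV.uniform htF hNF hκF).m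
    have hF : PolyFun fun x : Str => t x.bits.length + 2 * (V x.bits).ancilla +
        2 * (2 * (4 * q.eval x.bits.length ^ 2 * r.eval x.bits.length)) + 9 :=
      ((htF.nat_add ((PolyFun.const 2).nat_mul hm)).nat_add
        ((PolyFun.const 2).nat_mul hNF)).nat_add (PolyFun.const 9)
    obtain ⟨p, hp⟩ := hF.size_bdd
    refine ⟨p, fun x => ?_⟩
    have h : size (t x.length + 2 * (V x).ancilla +
        2 * (2 * (4 * q.eval x.length ^ 2 * r.eval x.length)) + 9) ≤ p.eval x.length := hp ⟨x⟩
    rwa [size_nat] at h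
  · intro x hx
    obtain ⟨k, hk, hmin⟩ := hE x hx
    refine Circuit.exists_acceptProb_amplified_eq_one (length_threshold _ _ _ _) hk ?_ hmin
    have ha0' : (0 : ℝ) < a x.length := by exact_mod_cast ha0 x.length
    have ha1' : (a x.length : ℝ) ≤ 1 := by exact_mod_cast hV.a_le_one x.length
    refine le_threshold ha0' ha1' _ _ (by rw [bval_bits]; exact (a x.length).den_pos)
      (num_div_den (ha0 _).le) _ _ k ?_
    rw [← hmin]
    obtain ⟨ψ, hψ, h⟩ := hV.complete x hx
    obtain ⟨-, -, -, hle⟩ := (V x).exists_acceptProb_eq_max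
    exact angle_anti (h.trans (hle ψ hψ))
  · intro x hx ψ hψ
    have hq' : (0 : ℝ) < (q.eval x.length : ℕ) := by exact_mod_cast (hq x.length).1
    refine (Circuit.acceptProb_amplified_le (length_threshold _ _ _ _)
      (g := 1 / (2 * (q.eval x.length : ℕ))) (by positivity) ?_ (hV.sound x hx)
      (fun K hK => cos_sq_ge_of_le_thresholdDigits (hq _).1 (ha0 _) (hV.a_le_one _) (hq _).2 hK)
      rfl hψ).trans (pow_le_exp (hq _).1)
    have hq1 : (1 : ℝ) ≤ (q.eval x.length : ℕ) := by exact_mod_cast (hq x.length).1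
    rw [div_le_one (by positivity)]
    linarith

/-! ### The two classes -/

theorem polyTime_const_encodeRat (c : ℚ) : PolyTime fun _ => encodeRat c :=
  (polyTime_iff' _).2 (PolyFun.const _)

theorem qmaExactPhase_subset : QMAExactPhase ⊆ QMA₁ := by
  rintro L ⟨V, a, b, t, hV, ⟨c, hc⟩, hE⟩
  -- the phase is padded with zeros to a number of digits that is easy to compute
  obtain ⟨t', hle, ht⟩ : ∃ t' : ℕ → ℕ, (∀ l, t l ≤ t' l) ∧
      PolyTime fun x => unary (t' x.length) := by
    have hlen : PolyFun fun x : Str => x.bits.length := by fun_prop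
    refine ⟨fun l => c * l ^ c + c, fun l => (hc l).trans ?_, ?_⟩
    · have := Nat.pow_le_pow_left (Nat.log_le_self 2 l) c
      dsimp only
      gcongr
    · rw [polyTime_iff']
      exact (((PolyFun.const c).nat_mul (hlen.nat_pow c)).nat_add (PolyFun.const c)).unary_fun
  have hE' : HasExactPhase L V t' := by
    intro x hx
    obtain ⟨k, hk, h⟩ := hE x hx
    have e := pow_add 2 (t x.length) (t' x.length - t x.length)
    rw [Nat.add_sub_cancel' (hle _)] at e
    refine ⟨k * 2 ^ (t' x.length - t x.length), ?_, ?_⟩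
    · rw [e]
      gcongr
    · have e' : (2 : ℝ) ^ t' x.length = 2 ^ t x.length * 2 ^ (t' x.length - t x.length) := by
        exact_mod_cast e
      rw [h, e']
      push_cast
      field_simp
  obtain ⟨V', hU, -, -, hyes, hno⟩ := exists_amplified hV ht hE' 1
  have hcomp : ∀ x ∈ L.yes, ∃ ψ : Amplitudes (V' x).witness,
      Circuit.IsState ψ ∧ (((1 : ℚ) : ℝ)) ≤ (V' x).acceptProb ψ := by
    intro x hx
    obtain ⟨ψ, hψ, h⟩ := hyes x hx
    exact ⟨ψ, hψ, by rw [h, Rat.cast_one]⟩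
  have hsound : ∀ x ∈ L.no, ∀ ψ : Amplitudes (V' x).witness,
      Circuit.IsState ψ → (V' x).acceptProb ψ ≤ ((1 / 2 : ℚ) : ℝ) := by
    intro x hx ψ hψ
    refine (hno x hx ψ hψ).trans ?_
    have h2 : (2 : ℝ) ≤ Real.exp 1 := by
      have := Real.add_one_le_exp (1 : ℝ)
      linarith
    rw [Polynomial.eval_one, Nat.cast_one, Real.exp_neg]
    push_cast
    rw [one_div]
    gcongr
  have hgap : ∃ q : Polynomial ℕ, ∀ l : ℕ, 0 < q.eval l ∧
      1 / ((q.eval l : ℕ) : ℚ) ≤ 1 - 1 / 2 :=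
    ⟨Polynomial.C 2, fun l => by rw [Polynomial.eval_C]; norm_num⟩
  exact ⟨V', fun _ => 1 / 2, {
    uniform := hU
    computable_a := polyTime_const_encodeRat 1
    computable_b := polyTime_const_encodeRat (1 / 2)
    b_nonneg := fun _ => by norm_num
    a_le_one := fun _ => le_rfl
    gap := hgap
    complete := hcomp
    sound := hsound }⟩

theorem qma₁_subset : QMA₁ ⊆ QMAExactPhase := by
  rintro L ⟨V, b, hV⟩
  refine ⟨V, _, b, fun _ => 0, hV, ⟨0, fun l => le_rfl.trans (by simp)⟩, fun x hx =>
    ⟨0, by simp, ?_⟩⟩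
  obtain ⟨ψ, hψ, h⟩ := hV.complete x hx
  obtain ⟨-, -, -, hle⟩ := (V x).exists_acceptProb_eq_max
  have h1 : (V x).maxAcceptProb = 1 :=
    le_antisymm (V x).maxAcceptProb_le_one (le_trans (by simpa using h) (hle ψ hψ))
  rw [Circuit.minPhase, h1]
  simp

end QMA

theorem theorem2 :
    (∀ (L : QMA.PromiseProblem) (V : List Bool → QMA.Circuit) (a b : ℕ → ℚ) (t : ℕ → ℕ),
      QMA.IsVerifier L V a b →
      QMA.IsPolylog t →
      QMA.PolyTime (fun x => QMA.unary (t x.length)) →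
      QMA.HasExactPhase L V t →
      ∀ r : Polynomial ℕ, ∃ V' : List Bool → QMA.Circuit,
        QMA.Uniform V' ∧
        (∀ x, (V' x).witness = (V x).witness + t x.length) ∧
        (∃ q : Polynomial ℕ, ∀ x, (V' x).ancilla ≤ q.eval x.length) ∧
        (∀ x ∈ L.yes, ∃ ψ : QMA.Amplitudes (V' x).witness,
          QMA.Circuit.IsState ψ ∧ (V' x).acceptProb ψ = 1) ∧
        (∀ x ∈ L.no, ∀ ψ : QMA.Amplitudes (V' x).witness,
          QMA.Circuit.IsState ψ → (V' x).acceptProb ψ ≤ Real.exp (-((r.eval x.length : ℕ) : ℝ)))) ∧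
    QMA.QMAExactPhase = QMA.QMA₁ := by
  exact ⟨fun L V a b t hV _ ht hE r => QMA.exists_amplified hV ht hE r,
    Set.Subset.antisymm QMA.qmaExactPhase_subset QMA.qma₁_subset⟩
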